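/- **Setting.** Let $d\ge 1$ be fixed, and let $P=(p_1,\dots,p_n)$ be a finite sequence of points of the nonnegative orthant $\mathbb X=\{x\in\mathbb R^d: x_i\ge 0 \text{ for all } i\}$ (in particular, an $n$-point set). For $u\in\mathbb X$ and a nonempty $S\subseteq P$, let $\omega_k(u,S)$ ($1\le k\le |S|$) be the $k$-th largest of the scores $\langle u,p\rangle$, $p\in S$, counted with multiplicity. For $1\le k\le n$ and a nonempty $Q\subseteq P$ put $$\ell_k(u,Q)=\frac{\max\{0,\ \omega_k(u,P)-\omega_1(u,Q)\}}{\omega_k(u,P)}$$ (read as $0$ if $\omega_k(u,P)=0$), and let $\ell_k(Q)=\sup_{u\in\mathbb X}\ell_k(u,Q)$ be the regret ratio of $Q$. **Statement.** For every $d\ge1$: (a) There are a program for the real RAM (unit cost per operation; exact arithmetic $+,-,\times,/$ and comparisons on reals; addition, subtraction and comparison of indices, and indirect addressing; no floor function) and a constant $C$, both depending only on $d$, such that for all $n$, all $1\le k\le n$, all $P\in\mathbb X^n$ and all nonempty $Q\subseteq P$, the supremum defining $\ell_k(Q)$ is attained and the program, on input $(n,k,P,Q)$, halts with output exactly $\ell_k(Q)$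 after at most $C\,n^{2d-1}$ steps. (b) The RMS decision problem in dimension $d$ is in $\mathrm{NP}$: given (in binary) integers $n,k,r$ with $1\le k\le n$ and $r\ge 0$, a rational $\epsilon\ge0$, and $n$ points of $\mathbb X$ with rational coordinates, each rational being given as a fraction of natural numbers with positive denominator, decide whether there is a nonempty subset $Q$ of the points with $|Q|\le r$ and $\ell_k(Q)\le\epsilon$. Here $\mathrm{NP}$ is the class of sets $L$ of finite sequences of natural numbers for which there are polynomials $p,q$ and a program for the integer RAM with logarithmic cost such that, for every input $x$ and every certificate $y$ of size at most $q(|x|)$, the program halts on $(x,y)$ in time at most $p(|x|)$, and $x\in L$ if and only if it accepts $(x,y)$ for some such $y$ (sizes are lengths in binary). -/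

import Mathlib

namespace RMS

/-! ### Scores, regret and regret ratio

A point set is a finite family `P : Fin n → (Fin d → ℝ)`, and a subset of it is a
`Finset` of indices. -/

/-- The score of the object `p` for the preference `u`. -/
def score {d : ℕ} (u p : Fin d → ℝ) : ℝ := ∑ j, u j * p j

/-- The `k`-th largest score for the preference `u` among the objects `P i`, `i ∈ S`: the score of an
object such that fewer than `k` objects have a larger score and at least `k` objects have a score
at least as large.  For `1 ≤ k ≤ #S` the set below has exactly one element
(see `kthScore_unique` and `kthScore_spec`). -/
noncomputable def kthScore {n d : ℕ} (P : Fin n → Fin d → ℝ) (S : Finset (Fin n)) (k : ℕ)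
    (u : Fin d → ℝ) : ℝ :=
  sSup {t : ℝ | (∃ i ∈ S, score u (P i) = t) ∧
    (S.filter fun j => t < score u (P j)).card < k ∧
    k ≤ (S.filter fun j => t ≤ score u (P j)).card}

theorem kthScore_unique {n d : ℕ} {P : Fin n → Fin d → ℝ} {S : Finset (Fin n)} {k : ℕ}
    {u : Fin d → ℝ} {t t' : ℝ}
    (h : (S.filter fun j => t < score u (P j)).card < k)
    (h' : k ≤ (S.filter fun j => t' ≤ score u (P j)).card) : t' ≤ t := by
  by_contra! hlt
  have : (S.filter fun j => t' ≤ score u (P j)).card ≤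
      (S.filter fun j => t < score u (P j)).card :=
    Finset.card_le_card fun j hj => by
      rw [Finset.mem_filter] at hj ⊢
      exact ⟨hj.1, hlt.trans_le hj.2⟩
  omega

theorem kthScore_spec {n d : ℕ} (P : Fin n → Fin d → ℝ) (S : Finset (Fin n)) (k : ℕ)
    (u : Fin d → ℝ) (hk : 1 ≤ k) (hkS : k ≤ S.card) :
    (∃ i ∈ S, score u (P i) = kthScore P S k u) ∧
    (S.filter fun j => kthScore P S k u < score u (P j)).card < k ∧
    k ≤ (S.filter fun j => kthScore P S k u ≤ score u (P j)).card := by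
  have hS : S.Nonempty := Finset.card_pos.mp (by omega)
  obtain ⟨m, hmS, hm⟩ := S.exists_min_image (fun i => score u (P i)) hS
  have hT : (S.filter fun i =>
      k ≤ (S.filter fun j => score u (P i) ≤ score u (P j)).card).Nonempty := by
    refine ⟨m, Finset.mem_filter.mpr ⟨hmS, ?_⟩⟩
    rwa [Finset.filter_true_of_mem hm]
  obtain ⟨i, hiT, hi⟩ := Finset.exists_max_image _ (fun i => score u (P i)) hT
  obtain ⟨hiS, hik⟩ := Finset.mem_filter.mp hiT
  have hlt : (S.filter fun j => score u (P i) < score u (P j)).card < k := by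
    by_contra! hge
    obtain ⟨l, hl, hlmin⟩ := Finset.exists_min_image _ (fun i => score u (P i))
      (Finset.card_pos.mp (show 0 < (S.filter fun j => score u (P i) < score u (P j)).card by omega))
    obtain ⟨hlS, hil⟩ := Finset.mem_filter.mp hl
    refine absurd (hi l (Finset.mem_filter.mpr ⟨hlS, hge.trans (Finset.card_le_card ?_)⟩))
      (not_le.mpr hil)
    intro j hj
    exact Finset.mem_filter.mpr ⟨(Finset.mem_filter.mp hj).1, hlmin j hj⟩
  have hset : {t : ℝ | (∃ i ∈ S, score u (P i) = t) ∧
      (S.filter fun j => t < score u (P j)).card < k ∧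
      k ≤ (S.filter fun j => t ≤ score u (P j)).card} = {score u (P i)} := by
    ext t
    constructor
    · rintro ⟨_, h1, h2⟩
      exact le_antisymm (kthScore_unique hlt h2) (kthScore_unique h1 hik)
    · rintro rfl
      exact ⟨⟨i, hiS, rfl⟩, hlt, hik⟩
  have : kthScore P S k u = score u (P i) := by
    rw [kthScore, hset, csSup_singleton]
  rw [this]
  exact ⟨⟨i, hiS, rfl⟩, hlt, hik⟩

/-- The regret of `Q` for the preference `u` with respect to `P`.  Lean's `0 / 0 = 0` makes the regret
`0` at preferences for which the `k`-th largest score is `0`. -/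
noncomputable def regret {n d : ℕ} (P : Fin n → Fin d → ℝ) (Q : Finset (Fin n)) (k : ℕ)
    (u : Fin d → ℝ) : ℝ :=
  max 0 (kthScore P Finset.univ k u - kthScore P Q 1 u) / kthScore P Finset.univ k u

/-- All regrets of `Q`, over the preferences in the nonnegative orthant. -/
def regrets {n d : ℕ} (P : Fin n → Fin d → ℝ) (Q : Finset (Fin n)) (k : ℕ) : Set ℝ :=
  {ρ : ℝ | ∃ u : Fin d → ℝ, (∀ j, 0 ≤ u j) ∧ regret P Q k u = ρ}

/-- The regret ratio of `Q` with respect to `P`. -/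
noncomputable def regretRatio {n d : ℕ} (P : Fin n → Fin d → ℝ) (Q : Finset (Fin n)) (k : ℕ) : ℝ :=
  sSup (regrets P Q k)

/-! ### Random access machines

One structured programming language for random access machines.  A machine has index registers and
an index memory, holding natural numbers and used for control and addressing, and value registers
and a value memory, holding elements of `K`.  A program mentions finitely many registers; the
memories are accessed by indirect addressing.
With `K = ℝ` and unit cost this is the real RAM (without a floor function or any other passage from
reals to indices); with `K = ℤ` and logarithmic cost it is the integer RAM with logarithmic cost,
which is polynomially equivalent to Turing machines. -/

/-- A configuration: index registers, index memory, value registers, value memory. -/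
structure State (K : Type) where
  ireg : ℕ → ℕ
  imem : ℕ → ℕ
  vreg : ℕ → K
  vmem : ℕ → K

/-- The arithmetic operations on values. -/
inductive Op where
  | add | sub | mul | div

/-- The result of an arithmetic operation (`/` is the quotient in `ℝ`, integer division in `ℤ`). -/
def Op.eval {K : Type} [CommRing K] [Div K] : Op → K → K → K
  | .add, a, b => a + b
  | .sub, a, b => a - b
  | .mul, a, b => a * b
  | .div, a, b => a / b

/-- Primitive instructions; all arguments are register numbers, except the constants `c`. -/
inductive Instr where
  /-- `ireg x := c` -/
  | iconst (x : ℕ) (c : ℕ)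
  /-- `ireg x := ireg y + ireg z` -/
  | iadd (x y z : ℕ)
  /-- `ireg x := ireg y - ireg z`, truncated at `0` -/
  | isub (x y z : ℕ)
  /-- `ireg x := imem[ireg y]` -/
  | iload (x y : ℕ)
  /-- `imem[ireg x] := ireg y` -/
  | istore (x y : ℕ)
  /-- `vreg x := c` -/
  | vconst (x : ℕ) (c : ℤ)
  /-- `vreg x := ireg y` -/
  | vcast (x y : ℕ)
  /-- `vreg x := vreg y ∘ vreg z` for an arithmetic operation `∘` -/
  | vop (o : Op) (x y z : ℕ)
  /-- `vreg x := vmem[ireg y]` -/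
  | vload (x y : ℕ)
  /-- `vmem[ireg x] := vreg y` -/
  | vstore (x y : ℕ)

/-- Tests compare the contents of two registers. -/
inductive Test where
  | ilt (x y : ℕ)
  | ile (x y : ℕ)
  | vlt (x y : ℕ)
  | vle (x y : ℕ)

/-- Programs. -/
inductive Cmd where
  | skip
  | prim (i : Instr)
  | seq (a b : Cmd)
  | ite (b : Test) (thenCmd elseCmd : Cmd)
  | while (b : Test) (body : Cmd)

/-- The cost charged for each index and each value that an instruction handles, on top of the cost `1`
of the instruction itself. -/
structure CostModel (K : Type) where
  icost : ℕ → ℕ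
  vcost : K → ℕ

/-- Unit cost: every instruction and every test costs `1`. -/
def unitCost (K : Type) : CostModel K where
  icost _ := 0
  vcost _ := 0

/-- Logarithmic cost: every number handled (operand, address or result) is charged its length in
binary. -/
def logCost : CostModel ℤ where
  icost a := a.size
  vcost a := a.natAbs.size

section Semantics

variable {K : Type} [CommRing K] [Div K] [LinearOrder K]

/-- The effect of an instruction. -/
def Instr.step (s : State K) : Instr → State K
  | .iconst x c => { s with ireg := Function.update s.ireg x c }
  | .iadd x y z => { s with ireg := Function.update s.ireg x (s.ireg y + s.ireg z) }
  | .isub x y z => { s with ireg := Function.update s.ireg x (s.ireg y - s.ireg z) }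
  | .iload x y => { s with ireg := Function.update s.ireg x (s.imem (s.ireg y)) }
  | .istore x y => { s with imem := Function.update s.imem (s.ireg x) (s.ireg y) }
  | .vconst x c => { s with vreg := Function.update s.vreg x (c : K) }
  | .vcast x y => { s with vreg := Function.update s.vreg x (s.ireg y : K) }
  | .vop o x y z => { s with vreg := Function.update s.vreg x (o.eval (s.vreg y) (s.vreg z)) }
  | .vload x y => { s with vreg := Function.update s.vreg x (s.vmem (s.ireg y)) }
  | .vstore x y => { s with vmem := Function.update s.vmem (s.ireg x) (s.vreg y) }

/-- The cost of an instruction. -/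
def Instr.cost (M : CostModel K) (s : State K) : Instr → ℕ
  | .iconst _ c => 1 + M.icost c
  | .iadd _ y z => 1 + M.icost (s.ireg y) + M.icost (s.ireg z) + M.icost (s.ireg y + s.ireg z)
  | .isub _ y z => 1 + M.icost (s.ireg y) + M.icost (s.ireg z) + M.icost (s.ireg y - s.ireg z)
  | .iload _ y => 1 + M.icost (s.ireg y) + M.icost (s.imem (s.ireg y))
  | .istore x y => 1 + M.icost (s.ireg x) + M.icost (s.ireg y)
  | .vconst _ c => 1 + M.vcost (c : K)
  | .vcast _ y => 1 + M.icost (s.ireg y) + M.vcost (s.ireg y : K)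
  | .vop o _ y z => 1 + M.vcost (s.vreg y) + M.vcost (s.vreg z) +
      M.vcost (o.eval (s.vreg y) (s.vreg z))
  | .vload _ y => 1 + M.icost (s.ireg y) + M.vcost (s.vmem (s.ireg y))
  | .vstore x y => 1 + M.icost (s.ireg x) + M.vcost (s.vreg y)

/-- The truth of a test. -/
def Test.holds (s : State K) : Test → Prop
  | .ilt x y => s.ireg x < s.ireg y
  | .ile x y => s.ireg x ≤ s.ireg y
  | .vlt x y => s.vreg x < s.vreg y
  | .vle x y => s.vreg x ≤ s.vreg y

/-- The cost of a test. -/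
def Test.cost (M : CostModel K) (s : State K) : Test → ℕ
  | .ilt x y => 1 + M.icost (s.ireg x) + M.icost (s.ireg y)
  | .ile x y => 1 + M.icost (s.ireg x) + M.icost (s.ireg y)
  | .vlt x y => 1 + M.vcost (s.vreg x) + M.vcost (s.vreg y)
  | .vle x y => 1 + M.vcost (s.vreg x) + M.vcost (s.vreg y)

/-- `Exec M c s s' t`: the program `c`, started in `s`, halts in `s'`, and its running time
is `t`. -/
inductive Exec (M : CostModel K) : Cmd → State K → State K → ℕ → Prop
  | skip (s : State K) : Exec M .skip s s 0
  | prim (i : Instr) (s : State K) : Exec M (.prim i) s (i.step s) (i.cost M s)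
  | seq {a b : Cmd} {s₁ s₂ s₃ : State K} {t₁ t₂ : ℕ} :
      Exec M a s₁ s₂ t₁ → Exec M b s₂ s₃ t₂ → Exec M (.seq a b) s₁ s₃ (t₁ + t₂)
  | ite_true {b : Test} {c₁ c₂ : Cmd} {s s' : State K} {t : ℕ} :
      b.holds s → Exec M c₁ s s' t → Exec M (.ite b c₁ c₂) s s' (b.cost M s + t)
  | ite_false {b : Test} {c₁ c₂ : Cmd} {s s' : State K} {t : ℕ} :
      ¬ b.holds s → Exec M c₂ s s' t → Exec M (.ite b c₁ c₂) s s' (b.cost M s + t)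
  | while_false {b : Test} {c : Cmd} {s : State K} :
      ¬ b.holds s → Exec M (.while b c) s s (b.cost M s)
  | while_true {b : Test} {c : Cmd} {s₁ s₂ s₃ : State K} {t₁ t₂ : ℕ} :
      b.holds s₁ → Exec M c s₁ s₂ t₁ → Exec M (.while b c) s₂ s₃ t₂ →
      Exec M (.while b c) s₁ s₃ (b.cost M s₁ + t₁ + t₂)

/-- Execution is deterministic. -/
theorem Exec.deterministic {M : CostModel K} {c : Cmd} {s s₁ s₂ : State K} {t₁ t₂ : ℕ}
    (h₁ : Exec M c s s₁ t₁) (h₂ : Exec M c s s₂ t₂) : s₁ = s₂ ∧ t₁ = t₂ := by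
  induction h₁ generalizing s₂ t₂ with
  | skip s => cases h₂; exact ⟨rfl, rfl⟩
  | prim i s => cases h₂; exact ⟨rfl, rfl⟩
  | seq _ _ iha ihb =>
    cases h₂ with
    | seq ha hb =>
      obtain ⟨rfl, rfl⟩ := iha ha
      obtain ⟨rfl, rfl⟩ := ihb hb
      exact ⟨rfl, rfl⟩
  | ite_true hb _ ih =>
    cases h₂ with
    | ite_true _ h => obtain ⟨rfl, rfl⟩ := ih h; exact ⟨rfl, rfl⟩
    | ite_false hn _ => exact absurd hb hn
  | ite_false hn _ ih =>
    cases h₂ with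
    | ite_true hb _ => exact absurd hb hn
    | ite_false _ h => obtain ⟨rfl, rfl⟩ := ih h; exact ⟨rfl, rfl⟩
  | while_false hn =>
    cases h₂ with
    | while_false _ => exact ⟨rfl, rfl⟩
    | while_true hb _ _ => exact absurd hb hn
  | while_true hb _ _ iha ihb =>
    cases h₂ with
    | while_false hn => exact absurd hb hn
    | while_true _ h h' =>
      obtain ⟨rfl, rfl⟩ := iha h
      obtain ⟨rfl, rfl⟩ := ihb h'
      exact ⟨rfl, rfl⟩

end Semantics

/-- The input of the regret-ratio computation on the real RAM: `n` and `k` in index registers `0`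
and `1`, the indicator of `Q` in the index memory, the coordinates of the points, row by row, in the
value memory; everything else is `0`. -/
noncomputable def regretInput {n d : ℕ} (P : Fin n → Fin d → ℝ) (Q : Finset (Fin n)) (k : ℕ) :
    State ℝ where
  ireg x := if x = 0 then n else if x = 1 then k else 0
  imem a := if h : a < n then (if (⟨a, h⟩ : Fin n) ∈ Q then 1 else 0) else 0
  vreg _ := 0
  vmem a := if h : a < n * d then P (Fin.divNat ⟨a, h⟩) (Fin.modNat ⟨a, h⟩) else 0

/-! ### The class NP over the integer RAM with logarithmic cost

Inputs and certificates are finite sequences of natural numbers; their size is their length in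
binary. -/

/-- The number of binary digits of a finite sequence of natural numbers, plus `1` per entry. -/
def inputSize (x : List ℕ) : ℕ := (x.map fun a => a.size + 1).sum

/-- The input `x` with the certificate `y`: the sequence `x` followed by `y` in the index memory, and
their numbers of entries in index registers `0` and `1`; everything else is `0`. -/
def verifierInput (x y : List ℕ) : State ℤ where
  ireg i := if i = 0 then x.length else if i = 1 then y.length else 0
  imem a := (x ++ y).getD a 0
  vreg _ := 0
  vmem _ := 0

/-- The program halts on `(x, y)` with `1` in index register `0`. -/
def Accepts (c : Cmd) (x y : List ℕ) : Prop :=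
  ∃ (s : State ℤ) (t : ℕ), Exec logCost c (verifierInput x y) s t ∧ s.ireg 0 = 1

/-- The class NP: there is a verifier which, for certificates of polynomially bounded size, halts in
polynomial time, and the members of `L` are the inputs for which it accepts some such
certificate. -/
def InNP (L : Set (List ℕ)) : Prop :=
  ∃ (c : Cmd) (p q : Polynomial ℕ), ∀ x : List ℕ,
    (∀ y : List ℕ, inputSize y ≤ q.eval (inputSize x) →
      ∃ (s : State ℤ) (t : ℕ), Exec logCost c (verifierInput x y) s t ∧
        t ≤ p.eval (inputSize x)) ∧
    (x ∈ L ↔ ∃ y : List ℕ, inputSize y ≤ q.eval (inputSize x) ∧ Accepts c x y)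

/-- An instance of the RMS decision problem in dimension `d`: a sequence of `n` points in the
nonnegative orthant with rational coordinates `num i j / den i j`, a rank `1 ≤ k ≤ n`, a size bound
`r`, and a rational regret bound `epsNum / epsDen`. -/
structure Instance (d : ℕ) where
  n : ℕ
  k : ℕ
  r : ℕ
  epsNum : ℕ
  epsDen : ℕ
  num : Fin n → Fin d → ℕ
  den : Fin n → Fin d → ℕ
  one_le_k : 1 ≤ k
  k_le_n : k ≤ n
  epsDen_pos : 0 < epsDen
  den_pos : ∀ i j, 0 < den i j

/-- The points of an instance. -/
noncomputable def Instance.points {d : ℕ} (I : Instance d) : Fin I.n → Fin d → ℝ :=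
  fun i j => (I.num i j : ℝ) / (I.den i j : ℝ)

/-- Some nonempty set of at most `r` of the points is a `(k, ε)`-regret set. -/
def Instance.IsYes {d : ℕ} (I : Instance d) : Prop :=
  ∃ Q : Finset (Fin I.n), Q.Nonempty ∧ Q.card ≤ I.r ∧
    regretRatio I.points Q I.k ≤ (I.epsNum : ℝ) / (I.epsDen : ℝ)

/-- The encoding of an instance: the parameters, then all numerators, then all denominators, row by
row. -/
def Instance.encode {d : ℕ} (I : Instance d) : List ℕ :=
  [I.n, I.k, I.r, I.epsNum, I.epsDen] ++
    List.ofFn (fun a : Fin (I.n * d) => I.num a.divNat a.modNat) ++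
    List.ofFn (fun a : Fin (I.n * d) => I.den a.divNat a.modNat)

/-- The RMS decision problem in dimension `d`. -/
def rmsLanguage (d : ℕ) : Set (List ℕ) :=
  {x | ∃ I : Instance d, I.encode = x ∧ I.IsYes}

end RMS

namespace RMS

/-! ### Guarded execution over the reals -/

/-- The guard of an instruction: products are bounded by `V`, and division is not used. -/
def Instr.Ok (V : ℝ) (s : State ℝ) : Instr → Prop
  | .vop .mul _ y z => |s.vreg y * s.vreg z| ≤ V
  | .vop .div _ _ _ => False
  | _ => True

/-- Unit-cost execution over the reals without divisions, in which all products are bounded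
by `V`. -/
inductive GExec (V : ℝ) : Cmd → State ℝ → State ℝ → ℕ → Prop
  | skip (s : State ℝ) : GExec V .skip s s 0
  | prim (i : Instr) (s : State ℝ) : i.Ok V s → GExec V (.prim i) s (i.step s) 1
  | seq {a b : Cmd} {s₁ s₂ s₃ : State ℝ} {t₁ t₂ : ℕ} :
      GExec V a s₁ s₂ t₁ → GExec V b s₂ s₃ t₂ → GExec V (.seq a b) s₁ s₃ (t₁ + t₂)
  | ite_true {b : Test} {c₁ c₂ : Cmd} {s s' : State ℝ} {t : ℕ} :
      b.holds s → GExec V c₁ s s' t → GExec V (.ite b c₁ c₂) s s' (1 + t)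
  | ite_false {b : Test} {c₁ c₂ : Cmd} {s s' : State ℝ} {t : ℕ} :
      ¬ b.holds s → GExec V c₂ s s' t → GExec V (.ite b c₁ c₂) s s' (1 + t)
  | while_false {b : Test} {c : Cmd} {s : State ℝ} :
      ¬ b.holds s → GExec V (.while b c) s s 1
  | while_true {b : Test} {c : Cmd} {s₁ s₂ s₃ : State ℝ} {t₁ t₂ : ℕ} :
      b.holds s₁ → GExec V c s₁ s₂ t₁ → GExec V (.while b c) s₂ s₃ t₂ →
      GExec V (.while b c) s₁ s₃ (1 + t₁ + t₂)

theorem Test.cost_unitCost (b : Test) (s : State ℝ) : b.cost (unitCost ℝ) s = 1 := by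
  cases b <;> rfl

theorem Instr.cost_unitCost (i : Instr) (s : State ℝ) : i.cost (unitCost ℝ) s = 1 := by
  cases i <;> rfl

theorem GExec.exec {V : ℝ} {c : Cmd} {s s' : State ℝ} {t : ℕ} (h : GExec V c s s' t) :
    Exec (unitCost ℝ) c s s' t := by
  induction h with
  | skip s => exact .skip s
  | prim i s _ => exact i.cost_unitCost s ▸ .prim i s
  | seq _ _ iha ihb => exact .seq iha ihb
  | @ite_true b _ _ s _ _ hb _ ih => exact b.cost_unitCost s ▸ .ite_true hb ih
  | @ite_false b _ _ s _ _ hb _ ih => exact b.cost_unitCost s ▸ .ite_false hb ih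
  | @while_false b _ s hb => exact b.cost_unitCost s ▸ .while_false hb
  | @while_true b _ s _ _ _ _ hb _ _ iha ihb =>
    exact b.cost_unitCost s ▸ .while_true hb iha ihb

/-! ### Simulation over the integers -/

/-- An integer configuration as a real configuration. -/
def State.toReal (s : State ℤ) : State ℝ where
  ireg := s.ireg
  imem := s.imem
  vreg x := s.vreg x
  vmem x := s.vmem x

/-- All numbers of a configuration have at most `a` binary digits. -/
structure State.SizeLe (s : State ℤ) (a : ℕ) : Prop where
  ireg : ∀ x, (s.ireg x).size ≤ a
  imem : ∀ x, (s.imem x).size ≤ a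
  vreg : ∀ x, (s.vreg x).natAbs.size ≤ a
  vmem : ∀ x, (s.vmem x).natAbs.size ≤ a

theorem State.SizeLe.mono {s : State ℤ} {a b : ℕ} (h : s.SizeLe a) (hab : a ≤ b) : s.SizeLe b :=
  ⟨fun x => (h.ireg x).trans hab, fun x => (h.imem x).trans hab, fun x => (h.vreg x).trans hab,
    fun x => (h.vmem x).trans hab⟩

/-- The largest number of binary digits of a constant in a program. -/
def Cmd.constSize : Cmd → ℕ
  | .skip => 0
  | .prim (.iconst _ c) => c.size
  | .prim (.vconst _ c) => c.natAbs.size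
  | .prim _ => 0
  | .seq a b => max a.constSize b.constSize
  | .ite _ a b => max a.constSize b.constSize
  | .while _ a => a.constSize

theorem size_add_le {m n a : ℕ} (hm : m.size ≤ a) (hn : n.size ≤ a) : (m + n).size ≤ a + 1 := by
  rw [Nat.size_le] at *
  rw [pow_succ]
  omega

theorem State.toReal_inj_update_vreg (s : State ℤ) (x : ℕ) (z : ℤ) :
    (State.toReal { s with vreg := Function.update s.vreg x z }) =
      { s.toReal with vreg := Function.update s.toReal.vreg x (z : ℝ) } := by
  simp only [State.toReal, State.mk.injEq, true_and, and_true]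
  funext y
  by_cases h : y = x <;> simp [h]

theorem State.toReal_inj_update_vmem (s : State ℤ) (x : ℕ) (z : ℤ) :
    (State.toReal { s with vmem := Function.update s.vmem x z }) =
      { s.toReal with vmem := Function.update s.toReal.vmem x (z : ℝ) } := by
  simp only [State.toReal, State.mk.injEq, true_and]
  funext y
  by_cases h : y = x <;> simp [h]

theorem forall_update {α : Type} {p : α → Prop} {f : ℕ → α} (hf : ∀ x, p (f x)) (x : ℕ) {v : α}
    (hv : p v) (y : ℕ) : p (Function.update f x v y) := by
  by_cases h : y = x <;> simp [h, hv, hf]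

theorem Test.holds_toReal (b : Test) (s : State ℤ) : b.holds s.toReal ↔ b.holds s := by
  cases b <;> simp [Test.holds, State.toReal]

theorem Test.cost_logCost_le (b : Test) {s : State ℤ} {a : ℕ} (hs : s.SizeLe a) :
    b.cost logCost s ≤ 1 + 3 * a := by
  rcases b with ⟨x, y⟩ | ⟨x, y⟩ | ⟨x, y⟩ | ⟨x, y⟩ <;> simp only [Test.cost, logCost]
  · have := hs.ireg x; have := hs.ireg y; omega
  · have := hs.ireg x; have := hs.ireg y; omega
  · have := hs.vreg x; have := hs.vreg y; omega
  · have := hs.vreg x; have := hs.vreg y; omega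

theorem Instr.logCost_sim {V : ℝ} (i : Instr) {s : State ℤ} {a : ℕ} (hs : s.SizeLe a)
    (hc : (Cmd.prim i).constSize ≤ a) (hV : ∀ z : ℤ, |(z : ℝ)| ≤ V → z.natAbs.size ≤ a)
    (hok : i.Ok V s.toReal) :
    (i.step s).toReal = i.step s.toReal ∧ (i.step s).SizeLe (a + 1) ∧
      i.cost logCost s ≤ 1 + 3 * (a + 1) := by
  have hs1 : s.SizeLe (a + 1) := hs.mono a.le_succ
  have vop : ∀ (x : ℕ) (z : ℤ), z.natAbs.size ≤ a + 1 →
      State.SizeLe { s with vreg := Function.update s.vreg x z } (a + 1) := fun x z hz =>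
    ⟨hs1.ireg, hs1.imem, fun y => forall_update (p := fun z : ℤ => z.natAbs.size ≤ a + 1)
      hs1.vreg x hz y, hs1.vmem⟩
  have iop : ∀ (x : ℕ) (z : ℕ), z.size ≤ a + 1 →
      State.SizeLe { s with ireg := Function.update s.ireg x z } (a + 1) := fun x z hz =>
    ⟨fun y => forall_update (p := fun z : ℕ => z.size ≤ a + 1)
      hs1.ireg x hz y, hs1.imem, hs1.vreg, hs1.vmem⟩
  cases i with
  | iconst x c =>
    simp only [Cmd.constSize] at hc
    exact ⟨rfl, iop _ _ (by omega), by simp only [Instr.cost, logCost]; omega⟩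
  | iadd x y z =>
    have h := size_add_le (hs.ireg y) (hs.ireg z)
    have := hs.ireg y; have := hs.ireg z
    exact ⟨rfl, iop _ _ h, by simp only [Instr.cost, logCost]; omega⟩
  | isub x y z =>
    have h : (s.ireg y - s.ireg z).size ≤ a :=
      (Nat.size_le_size (Nat.sub_le _ _)).trans (hs.ireg y)
    have := hs.ireg y; have := hs.ireg z
    exact ⟨rfl, iop _ _ (by omega), by simp only [Instr.cost, logCost]; omega⟩
  | iload x y =>
    have := hs.ireg y; have h := hs.imem (s.ireg y)
    exact ⟨rfl, iop _ _ (by omega), by simp only [Instr.cost, logCost]; omega⟩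
  | istore x y =>
    have := hs.ireg x; have := hs.ireg y
    exact ⟨rfl, ⟨hs1.ireg, fun w => forall_update (p := fun z : ℕ => z.size ≤ a + 1)
      hs1.imem _ (hs1.ireg y) w, hs1.vreg, hs1.vmem⟩, by simp only [Instr.cost, logCost]; omega⟩
  | vconst x c =>
    simp only [Cmd.constSize] at hc
    refine ⟨?_, vop _ _ (by simp; omega), by simp only [Instr.cost, logCost, Int.cast_id]; omega⟩
    simp only [Instr.step]
    rw [State.toReal_inj_update_vreg]
    simp
  | vcast x y =>
    have := hs.ireg y
    refine ⟨?_, vop _ _ (by simp; omega),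
      by simp only [Instr.cost, logCost, Int.natAbs_natCast]; omega⟩
    simp only [Instr.step]
    rw [State.toReal_inj_update_vreg]
    simp [State.toReal]
  | vop o x y z =>
    have hy := hs.vreg y; have hz := hs.vreg z
    have key : (((o.eval (s.vreg y) (s.vreg z) : ℤ)) : ℝ) =
        o.eval (s.toReal.vreg y) (s.toReal.vreg z) ∧
        (o.eval (s.vreg y) (s.vreg z)).natAbs.size ≤ a + 1 := by
      cases o with
      | add =>
        refine ⟨by simp [Op.eval, State.toReal], ?_⟩
        exact (Nat.size_le_size (Int.natAbs_add_le _ _)).trans (size_add_le hy hz)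
      | sub =>
        refine ⟨by simp [Op.eval, State.toReal], ?_⟩
        exact (Nat.size_le_size (Int.natAbs_sub_le _ _)).trans (size_add_le hy hz)
      | mul =>
        refine ⟨by simp [Op.eval, State.toReal], ?_⟩
        have := hV (s.vreg y * s.vreg z) (by simpa [Instr.Ok, State.toReal] using hok)
        simp only [Op.eval]
        omega
      | div => exact absurd hok (by simp [Instr.Ok])
    refine ⟨?_, vop _ _ key.2, by have := key.2; simp only [Instr.cost, logCost]; omega⟩
    simp only [Instr.step]
    rw [State.toReal_inj_update_vreg, key.1]
  | vload x y =>
    have := hs.ireg y; have h := hs.vmem (s.ireg y)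
    refine ⟨?_, vop _ _ (by omega), by simp only [Instr.cost, logCost]; omega⟩
    simp only [Instr.step]
    rw [State.toReal_inj_update_vreg]
    simp [State.toReal]
  | vstore x y =>
    have := hs.ireg x; have h := hs.vreg y
    refine ⟨?_, ⟨hs1.ireg, hs1.imem, hs1.vreg, fun w => forall_update
      (p := fun z : ℤ => z.natAbs.size ≤ a + 1) hs1.vmem _ (hs1.vreg y) w⟩,
      by simp only [Instr.cost, logCost]; omega⟩
    simp only [Instr.step]
    rw [State.toReal_inj_update_vmem]
    simp [State.toReal]

theorem mul_add_mul_le {t₁ t₂ x y a : ℕ} (hx : x ≤ t₁ * (1 + 3 * (a + t₁)))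
    (hy : y ≤ t₂ * (1 + 3 * (a + t₁ + t₂))) : x + y ≤ (t₁ + t₂) * (1 + 3 * (a + (t₁ + t₂))) := by
  nlinarith [Nat.zero_le (t₁ * t₂)]

theorem GExec.logCost_sim {V : ℝ} {c : Cmd} {s₁ s₂ : State ℝ} {t : ℕ} (h : GExec V c s₁ s₂ t) :
    ∀ {a : ℕ} {s : State ℤ}, s.toReal = s₁ → c.constSize ≤ a → s.SizeLe a →
      (∀ z : ℤ, |(z : ℝ)| ≤ V → z.natAbs.size ≤ a) →
      ∃ s' t', Exec logCost c s s' t' ∧ s'.toReal = s₂ ∧ s'.SizeLe (a + t) ∧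
        t' ≤ t * (1 + 3 * (a + t)) := by
  induction h with
  | skip s => intro a s hs _ ha _; exact ⟨s, 0, .skip s, hs, ha, by simp⟩
  | prim i s hok =>
    intro a s hs hc ha hV
    subst hs
    obtain ⟨h1, h2, h3⟩ := i.logCost_sim ha hc hV hok
    exact ⟨_, _, .prim i s, h1, h2, by simpa using h3⟩
  | @seq _ _ _ _ _ t₁ t₂ _ _ iha ihb =>
    intro a s hs hc ha hV
    simp only [Cmd.constSize, max_le_iff] at hc
    obtain ⟨s', t', h1, h2, h3, h4⟩ := iha hs hc.1 ha hV
    obtain ⟨s'', t'', h1', h2', h3', h4'⟩ := ihb h2 (by omega) h3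
      (fun z hz => (hV z hz).trans (by omega))
    exact ⟨s'', _, .seq h1 h1', h2', h3'.mono (by omega), mul_add_mul_le h4 h4'⟩
  | @ite_true b _ _ _ _ t hb _ ih =>
    intro a s hs hc ha hV
    simp only [Cmd.constSize, max_le_iff] at hc
    obtain ⟨s', t', h1, h2, h3, h4⟩ := ih hs hc.1 ha hV
    have hb' := b.cost_logCost_le ha
    exact ⟨s', _, .ite_true ((b.holds_toReal s).1 (hs ▸ hb)) h1, h2, h3.mono (by omega),
      mul_add_mul_le (by omega) (h4.trans (Nat.mul_le_mul_left _ (by omega)))⟩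
  | @ite_false b _ _ _ _ t hb _ ih =>
    intro a s hs hc ha hV
    simp only [Cmd.constSize, max_le_iff] at hc
    obtain ⟨s', t', h1, h2, h3, h4⟩ := ih hs hc.2 ha hV
    have hb' := b.cost_logCost_le ha
    exact ⟨s', _, .ite_false (mt (b.holds_toReal s).2 (hs ▸ hb)) h1, h2, h3.mono (by omega),
      mul_add_mul_le (by omega) (h4.trans (Nat.mul_le_mul_left _ (by omega)))⟩
  | @while_false b _ _ hb =>
    intro a s hs hc ha hV
    have hb' := b.cost_logCost_le ha
    exact ⟨s, _, .while_false (mt (b.holds_toReal s).2 (hs ▸ hb)), hs, ha.mono (by omega),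
      by omega⟩
  | @while_true b _ _ _ _ t₁ t₂ hb _ _ iha ihb =>
    intro a s hs hc ha hV
    obtain ⟨s', t', h1, h2, h3, h4⟩ := iha hs hc ha hV
    obtain ⟨s'', t'', h1', h2', h3', h4'⟩ := ihb h2
      ((show Cmd.constSize _ ≤ a from hc).trans (by omega)) h3
      (fun z hz => (hV z hz).trans (by omega))
    have hb' := b.cost_logCost_le ha
    refine ⟨s'', _, .while_true ((b.holds_toReal s).1 (hs ▸ hb)) h1 h1', h2', h3'.mono (by omega),
      mul_add_mul_le (mul_add_mul_le (by omega) (h4.trans (Nat.mul_le_mul_left _ (by omega))))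
        (h4'.trans (Nat.mul_le_mul_left _ (by omega)))⟩

/-! ### Program logic -/

/-- `Runs V c s Q`: the guarded execution of `c` from `s` halts in a configuration and after a time
which satisfy `Q`. -/
def Runs (V : ℝ) (c : Cmd) (s : State ℝ) (Q : State ℝ → ℕ → Prop) : Prop :=
  ∃ s' t, GExec V c s s' t ∧ Q s' t

section Runs

variable {V : ℝ} {s : State ℝ} {Q R : State ℝ → ℕ → Prop}

theorem Runs.mono {c : Cmd} (h : Runs V c s Q) (hQ : ∀ s' t, Q s' t → R s' t) : Runs V c s R :=
  let ⟨s', t, h1, h2⟩ := h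
  ⟨s', t, h1, hQ s' t h2⟩

@[simp] theorem runs_skip : Runs V .skip s Q ↔ Q s 0 :=
  ⟨fun ⟨_, _, h, hQ⟩ => by cases h; exact hQ, fun h => ⟨_, _, .skip s, h⟩⟩

@[simp] theorem runs_prim {i : Instr} : Runs V (.prim i) s Q ↔ i.Ok V s ∧ Q (i.step s) 1 :=
  ⟨fun ⟨_, _, h, hQ⟩ => by cases h with | prim _ _ hok => exact ⟨hok, hQ⟩,
    fun h => ⟨_, _, .prim i s h.1, h.2⟩⟩

@[simp] theorem runs_seq {a b : Cmd} :
    Runs V (.seq a b) s Q ↔ Runs V a s fun s₁ t₁ => Runs V b s₁ fun s₂ t₂ => Q s₂ (t₁ + t₂) :=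
  ⟨fun ⟨_, _, h, hQ⟩ => by cases h with | seq h1 h2 => exact ⟨_, _, h1, _, _, h2, hQ⟩,
    fun ⟨_, _, h1, _, _, h2, hQ⟩ => ⟨_, _, .seq h1 h2, hQ⟩⟩

@[simp] theorem runs_ite {b : Test} {c₁ c₂ : Cmd} :
    Runs V (.ite b c₁ c₂) s Q ↔ (b.holds s → Runs V c₁ s fun s' t => Q s' (1 + t)) ∧
      (¬ b.holds s → Runs V c₂ s fun s' t => Q s' (1 + t)) := by
  constructor
  · rintro ⟨_, _, h, hQ⟩
    cases h with
    | ite_true hb h => exact ⟨fun _ => ⟨_, _, h, hQ⟩, fun hn => absurd hb hn⟩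
    | ite_false hn h => exact ⟨fun hb => absurd hb hn, fun _ => ⟨_, _, h, hQ⟩⟩
  · rintro ⟨h1, h2⟩
    by_cases hb : b.holds s
    · obtain ⟨_, _, h, hQ⟩ := h1 hb
      exact ⟨_, _, .ite_true hb h, hQ⟩
    · obtain ⟨_, _, h, hQ⟩ := h2 hb
      exact ⟨_, _, .ite_false hb h, hQ⟩

/-- The commands of a list, one after the other. -/
def block : List Cmd → Cmd
  | [] => .skip
  | c :: l => .seq c (block l)

end Runs

/-! ### Frames -/

/-- Whether an instruction writes to the index register `r`. -/
def Instr.wi : Instr → ℕ → Bool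
  | .iconst x _, r => x == r
  | .iadd x _ _, r => x == r
  | .isub x _ _, r => x == r
  | .iload x _, r => x == r
  | _, _ => false

/-- Whether an instruction writes to the value register `r`. -/
def Instr.wv : Instr → ℕ → Bool
  | .vconst x _, r => x == r
  | .vcast x _, r => x == r
  | .vop _ x _ _, r => x == r
  | .vload x _, r => x == r
  | _, _ => false

/-- Whether an instruction writes to the index memory. -/
def Instr.wim : Instr → Bool
  | .istore _ _ => true
  | _ => false

/-- Whether an instruction writes to the value memory. -/
def Instr.wvm : Instr → Bool
  | .vstore _ _ => true
  | _ => false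

/-- Whether one of the instructions of a program satisfies `f`. -/
def Cmd.anyInstr (f : Instr → Bool) : Cmd → Bool
  | .skip => false
  | .prim i => f i
  | .seq a b => a.anyInstr f || b.anyInstr f
  | .ite _ a b => a.anyInstr f || b.anyInstr f
  | .while _ a => a.anyInstr f

/-- The program does not change the index register `r`. -/
abbrev Cmd.KeepsI (c : Cmd) (r : ℕ) : Prop := c.anyInstr (Instr.wi · r) = false

/-- The program does not change the value register `r`. -/
abbrev Cmd.KeepsV (c : Cmd) (r : ℕ) : Prop := c.anyInstr (Instr.wv · r) = false

/-- The program does not change the index memory. -/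
abbrev Cmd.KeepsIM (c : Cmd) : Prop := c.anyInstr Instr.wim = false

/-- The program does not change the value memory. -/
abbrev Cmd.KeepsVM (c : Cmd) : Prop := c.anyInstr Instr.wvm = false

/-- The registers and memories not written by `c` agree in `s` and `s'`. -/
structure Frame (c : Cmd) (s s' : State ℝ) : Prop where
  ireg : ∀ r, c.KeepsI r → s'.ireg r = s.ireg r
  vreg : ∀ r, c.KeepsV r → s'.vreg r = s.vreg r
  imem : c.KeepsIM → s'.imem = s.imem
  vmem : c.KeepsVM → s'.vmem = s.vmem

theorem Frame.refl (c : Cmd) (s : State ℝ) : Frame c s s :=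
  ⟨fun _ _ => rfl, fun _ _ => rfl, fun _ => rfl, fun _ => rfl⟩

theorem Frame.trans {c : Cmd} {s₁ s₂ s₃ : State ℝ} (h : Frame c s₁ s₂) (h' : Frame c s₂ s₃) :
    Frame c s₁ s₃ :=
  ⟨fun r hr => (h'.ireg r hr).trans (h.ireg r hr), fun r hr => (h'.vreg r hr).trans (h.vreg r hr),
    fun hr => (h'.imem hr).trans (h.imem hr), fun hr => (h'.vmem hr).trans (h.vmem hr)⟩

theorem Frame.of_imp {c c' : Cmd} {s s' : State ℝ} (h : Frame c s s')
    (hcc : ∀ f, c'.anyInstr f = false → c.anyInstr f = false) : Frame c' s s' :=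
  ⟨fun r hr => h.ireg r (hcc _ hr), fun r hr => h.vreg r (hcc _ hr), fun hr => h.imem (hcc _ hr),
    fun hr => h.vmem (hcc _ hr)⟩

theorem Frame.instr (i : Instr) (s : State ℝ) : Frame (.prim i) s (i.step s) := by
  constructor
  · intro r hr
    cases i <;> first
      | rfl
      | exact Function.update_of_ne (by rintro rfl; simp [Cmd.KeepsI, Cmd.anyInstr, Instr.wi] at hr) _ _
  · intro r hr
    cases i <;> first
      | rfl
      | exact Function.update_of_ne (by rintro rfl; simp [Cmd.KeepsV, Cmd.anyInstr, Instr.wv] at hr) _ _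
  · intro hr
    cases i <;> first
      | rfl
      | simp [Cmd.KeepsIM, Cmd.anyInstr, Instr.wim] at hr
  · intro hr
    cases i <;> first
      | rfl
      | simp [Cmd.KeepsVM, Cmd.anyInstr, Instr.wvm] at hr

theorem GExec.frame {V : ℝ} {c : Cmd} {s s' : State ℝ} {t : ℕ} (h : GExec V c s s' t) :
    Frame c s s' := by
  induction h with
  | skip s => exact .refl _ _
  | prim i s _ => exact .instr i s
  | seq _ _ iha ihb =>
    exact (iha.of_imp fun f hf => by simp_all [Cmd.anyInstr]).trans
      (ihb.of_imp fun f hf => by simp_all [Cmd.anyInstr])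
  | ite_true _ _ ih => exact ih.of_imp fun f hf => by simp_all [Cmd.anyInstr]
  | ite_false _ _ ih => exact ih.of_imp fun f hf => by simp_all [Cmd.anyInstr]
  | while_false _ => exact .refl _ _
  | while_true _ _ _ iha ihb =>
    exact (iha.of_imp fun f hf => by simp_all [Cmd.anyInstr]).trans ihb

section Runs

variable {V : ℝ} {s : State ℝ} {Q R : State ℝ → ℕ → Prop}

theorem Runs.frame {c : Cmd} (h : Runs V c s Q) :
    Runs V c s fun s' t => Q s' t ∧ Frame c s s' :=
  let ⟨s', t, h1, h2⟩ := h
  ⟨s', t, h1, h2, h1.frame⟩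

theorem Runs.bind {a b : Cmd} (h : Runs V a s R)
    (h' : ∀ s₁ t₁, R s₁ t₁ → Frame a s s₁ → Runs V b s₁ fun s₂ t₂ => Q s₂ (t₁ + t₂)) :
    Runs V (.seq a b) s Q :=
  runs_seq.2 (h.frame.mono fun s' t hR => h' s' t hR.1 hR.2)

theorem Runs.ite_intro {b : Test} {c₁ c₂ : Cmd}
    (h₁ : b.holds s → Runs V c₁ s fun s' t => Q s' (1 + t))
    (h₂ : ¬ b.holds s → Runs V c₂ s fun s' t => Q s' (1 + t)) : Runs V (.ite b c₁ c₂) s Q :=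
  runs_ite.2 ⟨h₁, h₂⟩

theorem Runs.while_count {b : Test} {c : Cmd} (Inv : ℕ → State ℝ → Prop) (m T : ℕ)
    (h0 : Inv 0 s)
    (step : ∀ i s', i < m → Frame c s s' → Inv i s' →
      b.holds s' ∧ Runs V c s' fun s'' t => t ≤ T ∧ Inv (i + 1) s'')
    (done : ∀ s', Frame c s s' → Inv m s' → ¬ b.holds s') :
    Runs V (.while b c) s fun s' t => t ≤ m * (T + 1) + 1 ∧ Inv m s' := by
  suffices H : ∀ j i s', i + j = m → Frame c s s' → Inv i s' →
      Runs V (.while b c) s' fun s'' t => t ≤ j * (T + 1) + 1 ∧ Inv m s'' from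
    H m 0 s (by omega) (.refl _ _) h0
  intro j
  induction j with
  | zero =>
    rintro i s' rfl hf hI
    exact ⟨s', 1, .while_false (done s' hf hI), by omega, hI⟩
  | succ j ih =>
    rintro i s' hij hf hI
    obtain ⟨hb, s₁, t₁, he, ht, hI₁⟩ := step i s' (by omega) hf hI
    obtain ⟨s₂, t₂, he₂, ht₂, hI₂⟩ := ih (i + 1) s₁ (by omega) (hf.trans he.frame) hI₁
    exact ⟨s₂, _, .while_true hb he he₂, by rw [Nat.succ_mul]; omega, hI₂⟩

/-- Some iterations of the loop `while b c`, with the test still to be made. -/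
inductive Iter (V : ℝ) (b : Test) (c : Cmd) : State ℝ → State ℝ → ℕ → Prop
  | refl (s : State ℝ) : Iter V b c s s 0
  | step {s₁ s₂ s₃ : State ℝ} {t₁ t₂ : ℕ} : b.holds s₁ → GExec V c s₁ s₂ t₁ →
      Iter V b c s₂ s₃ t₂ → Iter V b c s₁ s₃ (1 + t₁ + t₂)

/-- Some iterations of a loop lead to a configuration and take a time which satisfy `Q`. -/
def Iters (V : ℝ) (b : Test) (c : Cmd) (s : State ℝ) (Q : State ℝ → ℕ → Prop) : Prop :=
  ∃ s' t, Iter V b c s s' t ∧ Q s' t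

theorem Iter.trans {b : Test} {c : Cmd} {s₁ s₂ s₃ : State ℝ} {t₁ t₂ : ℕ}
    (h : Iter V b c s₁ s₂ t₁) (h' : Iter V b c s₂ s₃ t₂) : Iter V b c s₁ s₃ (t₁ + t₂) := by
  induction h with
  | refl s => simpa using h'
  | step hb he _ ih => rw [add_assoc]; exact .step hb he (ih h')

theorem Iter.frame {b : Test} {c : Cmd} {s s' : State ℝ} {t : ℕ} (h : Iter V b c s s' t) :
    Frame c s s' := by
  induction h with
  | refl s => exact .refl _ _
  | step _ he _ ih => exact he.frame.trans ih

theorem Iter.gexec {b : Test} {c : Cmd} {s s' : State ℝ} {t : ℕ} (h : Iter V b c s s' t)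
    (hb : ¬ b.holds s') : GExec V (.while b c) s s' (t + 1) := by
  induction h with
  | refl s => exact .while_false hb
  | step hb' he _ ih => rw [add_assoc]; exact .while_true hb' he (ih hb)

theorem Iters.refl {b : Test} {c : Cmd} (h : Q s 0) : Iters V b c s Q := ⟨s, 0, .refl s, h⟩

theorem Iters.step {b : Test} {c : Cmd} (hb : b.holds s)
    (h : Runs V c s fun s' t => Iters V b c s' fun s'' t' => Q s'' (1 + t + t')) :
    Iters V b c s Q :=
  let ⟨_, _, h1, _, _, h2, h3⟩ := h
  ⟨_, _, .step hb h1 h2, h3⟩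

theorem Iters.bind {b : Test} {c : Cmd} (h : Iters V b c s R)
    (h' : ∀ s₁ t₁, R s₁ t₁ → Frame c s s₁ → Iters V b c s₁ fun s₂ t₂ => Q s₂ (t₁ + t₂)) :
    Iters V b c s Q :=
  let ⟨s₁, t₁, h1, h2⟩ := h
  let ⟨_, _, h3, h4⟩ := h' s₁ t₁ h2 h1.frame
  ⟨_, _, h1.trans h3, h4⟩

theorem Iters.runs {b : Test} {c : Cmd} (h : Iters V b c s R)
    (hR : ∀ s' t, R s' t → ¬ b.holds s' ∧ Q s' (t + 1)) : Runs V (.while b c) s Q :=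
  let ⟨s', t, h1, h2⟩ := h
  ⟨s', t + 1, h1.gexec (hR s' t h2).1, (hR s' t h2).2⟩

end Runs

/-! ### Order statistics of lists -/

/-- `v` is the `k`-th largest entry of `l`. -/
def IsKth (l : List ℝ) (k : ℕ) (v : ℝ) : Prop :=
  l.countP (fun y => v < y) < k ∧ k ≤ l.countP (fun y => v ≤ y)

/-- The entries of a memory at the addresses `b, …, b + m - 1`. -/
def seg {α : Type} (mem : ℕ → α) (b m : ℕ) : List α := (List.range m).map fun i => mem (b + i)

section seg

variable {α : Type} {mem mem' : ℕ → α}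

@[simp] theorem seg_zero (b : ℕ) : seg mem b 0 = [] := rfl

@[simp] theorem length_seg (b m : ℕ) : (seg mem b m).length = m := by simp [seg]

theorem seg_succ (b m : ℕ) : seg mem b (m + 1) = seg mem b m ++ [mem (b + m)] := by
  simp [seg, List.range_succ]

theorem seg_add (b m k : ℕ) : seg mem b (m + k) = seg mem b m ++ seg mem (b + m) k := by
  induction k with
  | zero => simp
  | succ k ih => rw [← add_assoc, seg_succ, ih, seg_succ, List.append_assoc, add_assoc]

theorem seg_congr {b m : ℕ} (h : ∀ a, b ≤ a → a < b + m → mem' a = mem a) :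
    seg mem' b m = seg mem b m := by
  simp only [seg, List.map_inj_left, List.mem_range]
  exact fun i hi => h _ (by omega) (by omega)

theorem mem_seg {b m : ℕ} {x : α} : x ∈ seg mem b m ↔ ∃ i < m, mem (b + i) = x := by
  simp [seg]

end seg

theorem card_filter_eq_countP_ofFn {n : ℕ} (g : Fin n → ℝ) (p : ℝ → Prop) [DecidablePred p] :
    (Finset.univ.filter fun i => p (g i)).card = (List.ofFn g).countP p := by
  rw [List.countP_eq_length_filter, List.ofFn_eq_map, List.filter_map, List.length_map]
  rfl

theorem exists_isKth (l : List ℝ) {k : ℕ} (hk : 1 ≤ k) (hkl : k ≤ l.length) :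
    ∃ v ∈ l, IsKth l k v := by
  have hcard : ∀ p : ℝ → Prop, ∀ [DecidablePred p],
      (Finset.univ.filter fun i : Fin l.length => p (l.get i)).card = l.countP p := by
    intro p _
    rw [card_filter_eq_countP_ofFn, List.ofFn_get]
  obtain ⟨⟨i, _, hi⟩, h1, h2⟩ := kthScore_spec (fun i (_ : Fin 1) => l.get i) Finset.univ k
    (fun _ => 1) hk (by simpa using hkl)
  simp only [score, Finset.univ_unique, Finset.sum_singleton, one_mul] at hi h1 h2
  rw [← hi] at h1 h2
  exact ⟨l.get i, List.get_mem l i, by rw [← hcard]; exact h1, by rw [← hcard]; exact h2⟩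

/-! ### Counting and brute-force selection

Index register `2` holds `1`.  The segment is given by its base address in index register `20` and
its length in index register `21`. -/

/-- Count in index registers `27` and `28` the entries of the segment which are larger than, and at
least as large as, value register `12`. -/
def countProg : Cmd :=
  block [.prim (.iconst 27 0), .prim (.iconst 28 0), .prim (.iconst 25 0),
    .while (.ilt 25 21) (block [.prim (.iadd 26 20 25), .prim (.vload 13 26),
      .ite (.vlt 12 13) (.prim (.iadd 27 27 2)) .skip,
      .ite (.vle 12 13) (.prim (.iadd 28 28 2)) .skip, .prim (.iadd 25 25 2)])]

theorem countProg_runs {V : ℝ} {s : State ℝ} (h2 : s.ireg 2 = 1) :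
    Runs V countProg s fun s' t => t ≤ 8 * s.ireg 21 + 4 ∧
      s'.ireg 27 = (seg s.vmem (s.ireg 20) (s.ireg 21)).countP (fun y => s.vreg 12 < y) ∧
      s'.ireg 28 = (seg s.vmem (s.ireg 20) (s.ireg 21)).countP (fun y => s.vreg 12 ≤ y) := by
  simp only [countProg, block, runs_seq, runs_prim, Instr.Ok, Instr.step, true_and, runs_skip]
  refine (Runs.while_count (fun i s' => s'.ireg 25 = i ∧
    s'.ireg 27 = (seg s.vmem (s.ireg 20) i).countP (fun y => s.vreg 12 < y) ∧
    s'.ireg 28 = (seg s.vmem (s.ireg 20) i).countP (fun y => s.vreg 12 ≤ y)) (s.ireg 21) 7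
    (by simp) ?_ ?_).mono ?_
  · rintro i s' hi hf ⟨h25, h27, h28⟩
    have e2 := hf.ireg 2 rfl
    have e20 := hf.ireg 20 rfl
    have e21 := hf.ireg 21 rfl
    have e12 := hf.vreg 12 rfl
    have em := hf.vmem rfl
    simp at e2 e20 e21 e12 em
    refine ⟨by simp [Test.holds, *], ?_⟩
    by_cases c1 : s.vreg 12 < s.vmem (s.ireg 20 + i) <;>
      by_cases c2 : s.vreg 12 ≤ s.vmem (s.ireg 20 + i) <;>
      simp [Test.holds, Instr.step, Instr.Ok, seg_succ, *]
  · rintro s' hf ⟨h25, -⟩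
    have e21 := hf.ireg 21 rfl
    simp at e21
    simp [Test.holds, *]
  · rintro s' t ⟨ht, h25, h27, h28⟩
    exact ⟨by omega, h27, h28⟩

/-- Find the entry whose rank is given in index register `22` by comparing each entry of the segment
with all others, and put it into value register `11`. -/
def bruteProg : Cmd :=
  block [.prim (.iconst 23 0),
    .while (.ilt 23 21) (block [.prim (.iadd 24 20 23), .prim (.vload 12 24), countProg,
      .ite (.ilt 27 22) (.ite (.ile 22 28) (.prim (.vload 11 24)) .skip) .skip,
      .prim (.iadd 23 23 2)])]

theorem bruteProg_runs {V : ℝ} {s : State ℝ} (h2 : s.ireg 2 = 1) (hk : 1 ≤ s.ireg 22)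
    (hkm : s.ireg 22 ≤ s.ireg 21) :
    Runs V bruteProg s fun s' t => t ≤ s.ireg 21 * (8 * s.ireg 21 + 11) + 2 ∧
      IsKth (seg s.vmem (s.ireg 20) (s.ireg 21)) (s.ireg 22) (s'.vreg 11) := by
  simp only [bruteProg, block, runs_seq, runs_prim, Instr.Ok, Instr.step, true_and, runs_skip]
  set l := seg s.vmem (s.ireg 20) (s.ireg 21) with hl
  refine (Runs.while_count (fun i s' => s'.ireg 23 = i ∧
    ((∃ j < i, IsKth l (s.ireg 22) (s.vmem (s.ireg 20 + j))) → IsKth l (s.ireg 22) (s'.vreg 11)))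
    (s.ireg 21) (8 * s.ireg 21 + 10) (by simp) ?_ ?_).mono ?_
  · rintro i s' hi hf ⟨h23, h11⟩
    have e2 := hf.ireg 2 rfl
    have e20 := hf.ireg 20 rfl
    have e21 := hf.ireg 21 rfl
    have e22 := hf.ireg 22 rfl
    have em := hf.vmem rfl
    simp at e2 e20 e21 e22 em
    refine ⟨by simp [Test.holds, *], ?_⟩
    simp only [runs_seq, runs_prim, Instr.Ok, Instr.step, true_and]
    refine (countProg_runs (by simp [*])).frame.mono ?_
    rintro s₁ t₁ ⟨⟨ht₁, h27, h28⟩, hf₁⟩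
    have f2 := hf₁.ireg 2 rfl
    have f22 := hf₁.ireg 22 rfl
    have f23 := hf₁.ireg 23 rfl
    have f24 := hf₁.ireg 24 rfl
    have f11 := hf₁.vreg 11 rfl
    have fm := hf₁.vmem rfl
    simp [*] at f2 f22 f23 f24 f11 fm h27 h28 ht₁
    rw [← hl] at h27 h28
    have key : IsKth l (s.ireg 22) (s.vmem (s.ireg 20 + i)) ↔
        s₁.ireg 27 < s.ireg 22 ∧ s.ireg 22 ≤ s₁.ireg 28 := by rw [h27, h28]; rfl
    have step : (∃ j < i + 1, IsKth l (s.ireg 22) (s.vmem (s.ireg 20 + j))) →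
        ¬ IsKth l (s.ireg 22) (s.vmem (s.ireg 20 + i)) → IsKth l (s.ireg 22) (s'.vreg 11) := by
      rintro ⟨j, hj, hkj⟩ hn
      refine h11 ⟨j, ?_, hkj⟩
      rcases Nat.lt_succ_iff_lt_or_eq.1 hj with h | rfl
      · exact h
      · exact absurd hkj hn
    by_cases c1 : s₁.ireg 27 < s.ireg 22 <;> by_cases c2 : s.ireg 22 ≤ s₁.ireg 28
    · simp only [runs_ite, Test.holds, f22, c1, c2, runs_prim, Instr.Ok, Instr.step, true_and,
        forall_true_left, not_true, false_imp_iff, and_true, runs_skip]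
      refine ⟨by omega, by simp [*], fun _ => ?_⟩
      simpa [*] using key.2 ⟨c1, c2⟩
    all_goals
      have hn := mt key.1 (by tauto)
      simp only [runs_ite, Test.holds, f22, c1, c2, runs_prim, Instr.Ok, Instr.step, true_and,
        forall_true_left, not_true, false_imp_iff, and_true, runs_skip, not_false_eq_true]
      refine ⟨by omega, by simp [*], fun h => ?_⟩
      rw [f11]
      exact step h hn
  · rintro s' hf ⟨h23, -⟩
    have e21 := hf.ireg 21 rfl
    simp at e21
    simp [Test.holds, *]
  · rintro s' t ⟨ht, -, h11⟩
    refine ⟨by rw [show 8 * s.ireg 21 + 11 = 8 * s.ireg 21 + 10 + 1 from rfl]; omega, h11 ?_⟩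
    obtain ⟨v, hv, hvk⟩ := exists_isKth l hk (by simpa [hl] using hkm)
    obtain ⟨j, hj, rfl⟩ := mem_seg.1 hv
    exact ⟨j, hj, hvk⟩

/-! ### Filtering in place -/

/-- Keep the entries of the segment which pass the test, comparing value register `13` with value
register `12`. -/
def filterProg (b : Test) : Cmd :=
  block [.prim (.iconst 25 0), .prim (.iadd 29 20 25),
    .while (.ilt 25 21) (block [.prim (.iadd 26 20 25), .prim (.vload 13 26),
      .ite b (block [.prim (.vstore 29 13), .prim (.iadd 29 29 2)]) .skip,
      .prim (.iadd 25 25 2)])]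

theorem filterProg_runs {V : ℝ} {s : State ℝ} {b : Test} {p : ℝ → Bool} (h2 : s.ireg 2 = 1)
    (hb : ∀ s' : State ℝ, s'.vreg 12 = s.vreg 12 → (b.holds s' ↔ p (s'.vreg 13))) :
    Runs V (filterProg b) s fun s' t => t ≤ 7 * s.ireg 21 + 3 ∧
      seg s'.vmem (s.ireg 20) ((seg s.vmem (s.ireg 20) (s.ireg 21)).countP p) =
        (seg s.vmem (s.ireg 20) (s.ireg 21)).filter p ∧
      ∀ a < s.ireg 20, s'.vmem a = s.vmem a := by
  simp only [filterProg, block, runs_seq, runs_prim, Instr.Ok, Instr.step, true_and, runs_skip]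
  refine (Runs.while_count (fun i s' => s'.ireg 25 = i ∧
    s'.ireg 29 = s.ireg 20 + (seg s.vmem (s.ireg 20) i).countP p ∧
    seg s'.vmem (s.ireg 20) ((seg s.vmem (s.ireg 20) i).countP p) =
        (seg s.vmem (s.ireg 20) i).filter p ∧
    (∀ a, a < s.ireg 20 ∨ s.ireg 20 + i ≤ a → s'.vmem a = s.vmem a)) (s.ireg 21) 6
    (by simp) ?_ ?_).mono ?_
  · rintro i s' hi hf ⟨h25, h29, hseg, hm⟩
    have e2 := hf.ireg 2 rfl
    have e20 := hf.ireg 20 rfl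
    have e21 := hf.ireg 21 rfl
    have e12 := hf.vreg 12 (by cases b <;> rfl)
    simp at e2 e20 e21 e12
    have hmi := hm (s.ireg 20 + i) (by omega)
    have hle : (seg s.vmem (s.ireg 20) i).countP p ≤ i := by
      simpa using List.countP_le_length (p := p) (l := seg s.vmem (s.ireg 20) i)
    refine ⟨by simp [Test.holds, *], ?_⟩
    simp only [runs_seq, runs_prim, Instr.Ok, Instr.step, true_and, runs_ite, runs_skip,
      Function.update_self, Function.update_of_ne, ne_eq, Nat.reduceEqDiff, not_false_eq_true]
    constructor
    · intro c
      rw [hb _ (by simpa using e12)] at c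
      simp [*] at c
      refine ⟨by omega, by simp [*], ?_, ?_, ?_⟩
      · simp [seg_succ, List.countP_append, *, add_assoc]
      · simp only [seg_succ, List.countP_append, List.filter_append, List.countP_cons_of_pos,
          List.countP_nil, c, List.filter_cons_of_pos, List.filter_nil, zero_add]
        rw [seg_congr (mem := s'.vmem), hseg]
        · simp [*]
        · intro a _ ha
          rw [Function.update_of_ne (by omega)]
      · intro a ha
        rw [Function.update_of_ne (by omega)]
        exact hm a (by omega)
    · intro c
      rw [hb _ (by simpa using e12)] at c
      simp [*] at c
      refine ⟨by omega, by simp [*], ?_, ?_, ?_⟩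
      · simp [seg_succ, List.countP_append, *]
      · simp [seg_succ, List.countP_append, List.filter_append, *]
      · exact fun a ha => hm a (by omega)
  · rintro s' hf ⟨h25, -⟩
    have e21 := hf.ireg 21 (by cases b <;> rfl)
    simp at e21
    simp [Test.holds, *]
  · rintro s' t ⟨ht, -, -, h1, h2⟩
    exact ⟨by omega, h1, fun a ha => h2 a (.inl ha)⟩

/-! ### Selection in linear time

Besides index register `2`, which holds `1`, index registers `7`, `8`, `16` hold the constants
`0`, `2`, `10`.  The current segment has its base address and length in index registers `10`, `11`,
the rank is in index register `12`.  Index register `13` is `0` if an entry has to be found in the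
current segment, and `1` if it has been found and is in value register `11`; it is `2` at the end.
Suspended segments are on a stack in the index memory, which starts at the address in index
register `0` and ends before the address in index register `14`. -/

/-- Append the median of the next five entries to the list of medians. -/
def groupProg : Cmd :=
  block [bruteProg, .prim (.vstore 17 11), .prim (.iadd 17 17 2), .prim (.iadd 20 20 21)]

/-- Write the medians of groups of five entries, two at a time, behind the segment. -/
def mediansProg : Cmd :=
  block [.prim (.iadd 20 10 7), .prim (.iconst 21 5), .prim (.iconst 22 3),
    .prim (.iadd 17 10 11), .prim (.iadd 18 11 7), .prim (.iconst 19 0),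
    .while (.ile 16 18) (block [groupProg, groupProg, .prim (.isub 18 18 16),
      .prim (.iadd 19 19 2)])]

/-- The state of the computation of medians after `g` groups of the segment of length `m` at `b`. -/
structure MediansInv (b m : ℕ) (mem : ℕ → ℝ) (g : ℕ) (s : State ℝ) : Prop where
  one : s.ireg 2 = 1
  src : s.ireg 20 = b + 5 * g
  dst : s.ireg 17 = b + m + g
  five : s.ireg 21 = 5
  three : s.ireg 22 = 3
  old : ∀ a < b + m, s.vmem a = mem a
  ge : ∀ v, 3 * (seg s.vmem (b + m) g).countP (fun y => v ≤ y) ≤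
    (seg mem b (5 * g)).countP (fun y => v ≤ y)
  le : ∀ v, 3 * (seg s.vmem (b + m) g).countP (fun y => y ≤ v) ≤
    (seg mem b (5 * g)).countP (fun y => y ≤ v)

theorem countP_le_add_countP_lt (l : List ℝ) (v : ℝ) :
    l.countP (fun y => y ≤ v) + l.countP (fun y => v < y) = l.length := by
  rw [List.length_eq_countP_add_countP (fun y => decide (y ≤ v))]
  simp

theorem countP_lt_add_countP_le (l : List ℝ) (v : ℝ) :
    l.countP (fun y => y < v) + l.countP (fun y => v ≤ y) = l.length := by
  rw [List.length_eq_countP_add_countP (fun y => decide (y < v))]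
  simp

theorem MediansInv.step {V : ℝ} {b m g : ℕ} {mem : ℕ → ℝ} {s : State ℝ}
    (h : MediansInv b m mem g s) (hg : 5 * g + 5 ≤ m) :
    Runs V groupProg s fun s' t => t ≤ 260 ∧ MediansInv b m mem (g + 1) s' := by
  obtain ⟨h2, h20, h17, h21, h22, hm, hge, hle⟩ := h
  simp only [groupProg, block, runs_seq]
  refine (bruteProg_runs h2 (by omega) (by omega)).frame.mono ?_
  rintro s' t ⟨⟨ht, hk⟩, hf⟩
  have e2 := hf.ireg 2 rfl
  have e17 := hf.ireg 17 rfl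
  have e20 := hf.ireg 20 rfl
  have e21 := hf.ireg 21 rfl
  have e22 := hf.ireg 22 rfl
  have em := hf.vmem rfl
  rw [h2] at e2; rw [h17] at e17; rw [h20] at e20 hk; rw [h21] at e21 hk ht
  rw [h22] at e22 hk
  rw [seg_congr fun a _ ha => hm a (by omega)] at hk
  simp only [runs_prim, Instr.Ok, Instr.step, true_and, runs_skip,
      Function.update_of_ne, ne_eq, Nat.reduceEqDiff, not_false_eq_true]
  rw [em, e17]
  have hseg : seg (Function.update s.vmem (b + m + g) (s'.vreg 11)) (b + m) (g + 1) =
      seg s.vmem (b + m) g ++ [s'.vreg 11] := by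
    rw [seg_succ, Function.update_self, seg_congr]
    intro a _ ha
    rw [Function.update_of_ne (by omega)]
  have hlt := countP_le_add_countP_lt (seg mem (b + 5 * g) 5) (s'.vreg 11)
  rw [length_seg] at hlt
  refine ⟨by omega, ⟨by simp [e2], by simp [*]; omega, by simp [*]; omega, by simp [*],
    by simp [*], ?_, fun v => ?_, fun v => ?_⟩⟩
  · intro a ha
    simp only
    rw [Function.update_of_ne (by omega), hm a ha]
  · simp only [hseg, mul_add, seg_add, List.countP_append, mul_one]
    refine Nat.add_le_add (hge v) ?_
    by_cases c : v ≤ s'.vreg 11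
    · have : (seg mem (b + 5 * g) 5).countP (fun y => s'.vreg 11 ≤ y) ≤
        (seg mem (b + 5 * g) 5).countP (fun y => v ≤ y) :=
        List.countP_mono_left fun y _ hy => by
          simp only [decide_eq_true_eq] at hy ⊢
          exact c.trans hy
      have := hk.2
      simp [c]
      omega
    · simp [c]
  · simp only [hseg, mul_add, seg_add, List.countP_append, mul_one]
    refine Nat.add_le_add (hle v) ?_
    by_cases c : s'.vreg 11 ≤ v
    · have : (seg mem (b + 5 * g) 5).countP (fun y => y ≤ s'.vreg 11) ≤
        (seg mem (b + 5 * g) 5).countP (fun y => y ≤ v) :=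
        List.countP_mono_left fun y _ hy => by
          simp only [decide_eq_true_eq] at hy ⊢
          exact hy.trans c
      have := hk.1
      simp [c]
      omega
    · simp [c]

theorem mediansProg_runs {V : ℝ} {s : State ℝ} (h2 : s.ireg 2 = 1) (h7 : s.ireg 7 = 0)
    (h16 : s.ireg 16 = 10) :
    Runs V mediansProg s fun s' t => t ≤ 53 * s.ireg 11 + 7 ∧ s'.ireg 19 = s.ireg 11 / 10 ∧
      MediansInv (s.ireg 10) (s.ireg 11) s.vmem (2 * (s.ireg 11 / 10)) s' := by
  simp only [mediansProg, block, runs_seq, runs_prim, Instr.Ok, Instr.step, true_and, runs_skip]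
  refine (Runs.while_count (fun i s' => s'.ireg 18 = s.ireg 11 - 10 * i ∧ s'.ireg 19 = i ∧
    MediansInv (s.ireg 10) (s.ireg 11) s.vmem (2 * i) s') (s.ireg 11 / 10) 522
    ?_ ?_ ?_).mono ?_
  · refine ⟨by simp [h7], by simp, ⟨?_, ?_, ?_, ?_, ?_, ?_, ?_, ?_⟩⟩ <;> simp [h2, h7]
  · rintro i s' hi hf ⟨h18, h19, hI⟩
    have e2 := hf.ireg 2 rfl
    have e16 := hf.ireg 16 rfl
    simp [h2, h16] at e2 e16
    refine ⟨by simp only [Test.holds, e16, h18]; omega, ?_⟩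
    refine (hI.step (by omega)).bind ?_
    rintro s₁ t₁ ⟨ht₁, hI₁⟩ hf₁
    refine (hI₁.step (by omega)).bind ?_
    rintro s₂ t₂ ⟨ht₂, hI₂⟩ hf₂
    rw [show 2 * i + 1 + 1 = 2 * (i + 1) by ring] at hI₂
    have f2 := (hf₂.ireg 2 rfl).trans (hf₁.ireg 2 rfl)
    have f16 := (hf₂.ireg 16 rfl).trans (hf₁.ireg 16 rfl)
    have f18 := (hf₂.ireg 18 rfl).trans (hf₁.ireg 18 rfl)
    have f19 := (hf₂.ireg 19 rfl).trans (hf₁.ireg 19 rfl)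
    obtain ⟨a1, a2, a3, a4, a5, a6, a7, a8⟩ := hI₂
    simp [Instr.Ok, Instr.step]
    refine ⟨by omega, by simp [*]; omega, by simp [*], ⟨?_, ?_, ?_, ?_, ?_, ?_, ?_, ?_⟩⟩ <;>
      assumption
  · rintro s' hf ⟨h18, -⟩
    have e16 := hf.ireg 16 rfl
    simp [h16] at e16
    simp only [Test.holds, e16, h18]
    omega
  · rintro s' t ⟨ht, -, h19, hI⟩
    exact ⟨by omega, h19, hI⟩

/-- Compare the segment with the pivot in value register `11`. -/
def partitionProg : Cmd :=
  block [.prim (.vconst 14 0), .prim (.vop .add 12 11 14), .prim (.iadd 20 10 7),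
    .prim (.iadd 21 11 7), countProg,
    .ite (.ile 12 27)
      (block [filterProg (.vlt 12 13), .prim (.iadd 11 27 7), .prim (.iconst 13 0)])
      (.ite (.ile 12 28) .skip
        (block [filterProg (.vlt 13 12), .prim (.isub 12 12 28), .prim (.isub 11 11 28),
          .prim (.iconst 13 0)]))]

/-- One step of the selection. -/
def selectBody : Cmd :=
  .ite (.ilt 13 2)
    (.ite (.ilt 11 16)
      (block [.prim (.iadd 20 10 7), .prim (.iadd 21 11 7), .prim (.iadd 22 12 7), bruteProg,
        .prim (.iconst 13 1)])
      (block [mediansProg, .prim (.istore 14 10), .prim (.iadd 14 14 2), .prim (.istore 14 11),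
        .prim (.iadd 14 14 2), .prim (.istore 14 12), .prim (.iadd 14 14 2),
        .prim (.iadd 10 10 11), .prim (.iadd 11 19 19), .prim (.iadd 12 19 7)]))
    (.ite (.ile 14 0) (.prim (.iconst 13 2))
      (block [.prim (.isub 14 14 2), .prim (.iload 12 14), .prim (.isub 14 14 2),
        .prim (.iload 11 14), .prim (.isub 14 14 2), .prim (.iload 10 14), partitionProg]))

theorem selectBody_brute {V : ℝ} {s : State ℝ} (h2 : s.ireg 2 = 1) (h7 : s.ireg 7 = 0)
    (h16 : s.ireg 16 = 10) (h13 : s.ireg 13 = 0) (hm : s.ireg 11 < 10) (hk : 1 ≤ s.ireg 12)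
    (hkm : s.ireg 12 ≤ s.ireg 11) :
    Runs V selectBody s fun s' t => t ≤ 93 * s.ireg 11 + 10 ∧ s'.ireg 13 = 1 ∧
      s'.ireg 14 = s.ireg 14 ∧ s'.imem = s.imem ∧ s'.vmem = s.vmem ∧
      IsKth (seg s.vmem (s.ireg 10) (s.ireg 11)) (s.ireg 12) (s'.vreg 11) := by
  refine Runs.ite_intro (fun _ => Runs.ite_intro (fun _ => ?_)
    (fun hn => absurd (by simpa [Test.holds, h16] using hm) hn))
    (fun hn => absurd (by simp [Test.holds, *]) hn)
  simp only [block, runs_seq, runs_prim, Instr.Ok, Instr.step, true_and, runs_skip]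
  refine (bruteProg_runs (by simp [h2]) (by simp [*]) (by simp [*])).frame.mono ?_
  rintro s' t ⟨⟨ht, hI⟩, hf⟩
  have e14 := hf.ireg 14 rfl
  have ei := hf.imem rfl
  have ev := hf.vmem rfl
  simp [h7] at e14 ei ev ht hI
  have : s.ireg 11 * (8 * s.ireg 11 + 11) ≤ s.ireg 11 * 93 := Nat.mul_le_mul_left _ (by omega)
  refine ⟨by omega, by simp, by simpa using e14, ei, ev, hI⟩

theorem selectBody_push {V : ℝ} {s : State ℝ} (h2 : s.ireg 2 = 1) (h7 : s.ireg 7 = 0)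
    (h16 : s.ireg 16 = 10) (h13 : s.ireg 13 = 0) (hm : 10 ≤ s.ireg 11) :
    Runs V selectBody s fun s' t => t ≤ 53 * s.ireg 11 + 20 ∧ s'.ireg 13 = 0 ∧
      s'.ireg 14 = s.ireg 14 + 3 ∧ s'.ireg 10 = s.ireg 10 + s.ireg 11 ∧
      s'.ireg 11 = 2 * (s.ireg 11 / 10) ∧ s'.ireg 12 = s.ireg 11 / 10 ∧
      s'.imem (s.ireg 14) = s.ireg 10 ∧ s'.imem (s.ireg 14 + 1) = s.ireg 11 ∧
      s'.imem (s.ireg 14 + 2) = s.ireg 12 ∧ (∀ a < s.ireg 14, s'.imem a = s.imem a) ∧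
      MediansInv (s.ireg 10) (s.ireg 11) s.vmem (2 * (s.ireg 11 / 10)) s' := by
  refine Runs.ite_intro (fun _ => Runs.ite_intro
    (fun h => absurd (by simpa [Test.holds, h16] using h) (not_lt.2 hm)) (fun _ => ?_))
    (fun hn => absurd (by simp [Test.holds, *]) hn)
  refine (mediansProg_runs h2 h7 h16).bind ?_
  rintro s' t ⟨ht, h19, hI⟩ hf
  have e2 := hf.ireg 2 rfl
  have e7 := hf.ireg 7 rfl
  have e10 := hf.ireg 10 rfl
  have e11 := hf.ireg 11 rfl
  have e12 := hf.ireg 12 rfl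
  have e13 := hf.ireg 13 rfl
  have e14 := hf.ireg 14 rfl
  have ei := hf.imem rfl
  simp only [block, runs_seq, runs_prim, Instr.Ok, Instr.step, true_and, runs_skip]
  obtain ⟨a1, a2, a3, a4, a5, a6, a7, a8⟩ := hI
  refine ⟨by omega, by simp [*], by simp [*], by simp [*], by simp [*]; omega, by simp [*],
    by simp [*, Function.update_apply]; omega, by simp [*], by simp [*], ?_, ⟨?_, ?_, ?_, ?_, ?_, ?_, ?_, ?_⟩⟩
  · intro a ha
    simp [*, Function.update_apply]
    split_ifs <;> omega
  all_goals assumption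

/-- The segment which remains after the comparison with the pivot `v`: the configuration `s` is
about to continue with it, or the pivot is the entry which has to be found. -/
inductive Resumed (mem : ℕ → ℝ) (b m k : ℕ) (v : ℝ) (s : State ℝ) : Prop
  | gt (h : k ≤ (seg mem b m).countP (fun y => v < y)) (h13 : s.ireg 13 = 0)
      (h10 : s.ireg 10 = b) (h11 : s.ireg 11 = (seg mem b m).countP (fun y => v < y))
      (h12 : s.ireg 12 = k)
      (hs : seg s.vmem b (s.ireg 11) = (seg mem b m).filter (fun y => v < y))
  | eq (h : IsKth (seg mem b m) k v) (h13 : s.ireg 13 = 1) (h11 : s.vreg 11 = v)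
  | lt (h : (seg mem b m).countP (fun y => v ≤ y) < k) (h13 : s.ireg 13 = 0)
      (h10 : s.ireg 10 = b) (h11 : s.ireg 11 = (seg mem b m).countP (fun y => y < v))
      (h12 : s.ireg 12 = k - (seg mem b m).countP (fun y => v ≤ y))
      (hs : seg s.vmem b (s.ireg 11) = (seg mem b m).filter (fun y => y < v))

theorem partitionProg_runs {V : ℝ} {s : State ℝ} (h2 : s.ireg 2 = 1) (h7 : s.ireg 7 = 0)
    (h13 : s.ireg 13 = 1) :
    Runs V partitionProg s fun s' t => t ≤ 15 * s.ireg 11 + 20 ∧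
      (∀ a < s.ireg 10, s'.vmem a = s.vmem a) ∧
      Resumed s.vmem (s.ireg 10) (s.ireg 11) (s.ireg 12) (s.vreg 11) s' := by
  simp only [partitionProg, block, runs_seq, runs_prim, Instr.Ok, Instr.step, true_and, runs_skip]
  refine (countProg_runs (by simp [h2])).frame.mono ?_
  rintro s₁ t₁ ⟨⟨ht₁, h27, h28⟩, hf⟩
  have e2 := hf.ireg 2 rfl
  have e7 := hf.ireg 7 rfl
  have e10 := hf.ireg 10 rfl
  have e11 := hf.ireg 11 rfl
  have e12 := hf.ireg 12 rfl
  have e13 := hf.ireg 13 rfl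
  have e20 := hf.ireg 20 rfl
  have e21 := hf.ireg 21 rfl
  have ev11 := hf.vreg 11 rfl
  have ev12 := hf.vreg 12 rfl
  have ev := hf.vmem rfl
  simp [Op.eval, h2, h7, h13] at e2 e7 e10 e11 e12 e13 e20 e21 ev11 ev12 ev h27 h28 ht₁
  clear hf
  refine Runs.ite_intro (fun c => ?_) (fun c => Runs.ite_intro (fun c' => ?_) (fun c' => ?_))
  · simp only [Test.holds, e12, h27] at c
    refine (filterProg_runs (p := fun y => s.vreg 11 < y) e2
      (fun s' hs' => by simp [Test.holds, hs', ev12])).bind ?_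
    rintro s₂ t₂ ⟨ht₂, hseg, hmem⟩ hf₂
    have f7 := hf₂.ireg 7 rfl
    have f10 := hf₂.ireg 10 rfl
    have f12 := hf₂.ireg 12 rfl
    have f27 := hf₂.ireg 27 rfl
    rw [e20, e21, ev] at hseg
    rw [e20, ev] at hmem
    rw [e21] at ht₂
    simp only [runs_seq, runs_prim, Instr.Ok, Instr.step, true_and, runs_skip]
    refine ⟨by omega, hmem, .gt c ?_ ?_ ?_ ?_ ?_⟩ <;>
      simp [f7, e7, f10, e10, f12, e12, f27, h27, hseg]
  · simp only [Test.holds, e12, h27, not_le] at c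
    simp only [Test.holds, e12, h28] at c'
    simp only [runs_skip]
    exact ⟨by omega, by simp [ev], .eq ⟨c, c'⟩ e13 ev11⟩
  · simp only [Test.holds, e12, h28, not_le] at c'
    refine (filterProg_runs (p := fun y => y < s.vreg 11) e2
      (fun s' hs' => by simp [Test.holds, hs', ev12])).bind ?_
    rintro s₂ t₂ ⟨ht₂, hseg, hmem⟩ hf₂
    have f10 := hf₂.ireg 10 rfl
    have f11 := hf₂.ireg 11 rfl
    have f12 := hf₂.ireg 12 rfl
    have f28 := hf₂.ireg 28 rfl
    rw [e20, e21, ev] at hseg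
    rw [e20, ev] at hmem
    rw [e21] at ht₂
    clear hf₂
    have hc := countP_lt_add_countP_le (seg s.vmem (s.ireg 10) (s.ireg 11)) (s.vreg 11)
    rw [length_seg] at hc
    have hsub : s.ireg 11 - (seg s.vmem (s.ireg 10) (s.ireg 11)).countP (fun y => s.vreg 11 ≤ y) =
      (seg s.vmem (s.ireg 10) (s.ireg 11)).countP (fun y => y < s.vreg 11) := by omega
    simp only [runs_seq, runs_prim, Instr.Ok, Instr.step, true_and, runs_skip]
    refine ⟨by omega, hmem, .lt c' ?_ ?_ ?_ ?_ ?_⟩ <;>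
      simp [f10, e10, f11, e11, f12, e12, f28, h28, hsub, hseg]

theorem selectBody_resume {V : ℝ} {s : State ℝ} {q b m k : ℕ} (h2 : s.ireg 2 = 1)
    (h7 : s.ireg 7 = 0) (h13 : s.ireg 13 = 1) (h14 : s.ireg 14 = q + 3) (hq : s.ireg 0 ≤ q)
    (hb : s.imem q = b) (hm : s.imem (q + 1) = m) (hk : s.imem (q + 2) = k) :
    Runs V selectBody s fun s' t => t ≤ 15 * m + 30 ∧ s'.ireg 14 = q ∧ s'.imem = s.imem ∧
      (∀ a < b, s'.vmem a = s.vmem a) ∧ Resumed s.vmem b m k (s.vreg 11) s' := by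
  refine Runs.ite_intro (fun h => absurd h (by simp [Test.holds, *])) (fun _ =>
    Runs.ite_intro (fun h => absurd h (by simp [Test.holds, *]; omega)) (fun _ => ?_))
  simp only [block, runs_seq, runs_prim, Instr.Ok, Instr.step, true_and, runs_skip]
  refine (partitionProg_runs (by simp [h2]) (by simp [h7]) (by simp [h13])).frame.mono ?_
  rintro s' t ⟨⟨ht, hmem, hR⟩, hf⟩
  have e14 := hf.ireg 14 rfl
  have ei := hf.imem rfl
  simp [h2, h14, hb, hm, hk] at e14 ei ht hmem hR
  exact ⟨by omega, e14, ei, hmem, hR⟩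

theorem IsKth.of_filter_gt {l : List ℝ} {k : ℕ} {v w : ℝ} (hk : k ≤ l.countP (fun y => v < y))
    (h : IsKth (l.filter fun y => v < y) k w) : IsKth l k w := by
  obtain ⟨h1, h2⟩ := h
  have hex : ∃ y, v < y ∧ y ≤ w := by
    by_contra! hne
    have : (l.filter fun y => v < y).countP (fun y => w < y) = (l.filter fun y => v < y).length :=
      List.countP_eq_length.2 fun y hy => by
        simp only [List.mem_filter, decide_eq_true_eq] at hy ⊢
        exact hne y hy.2
    rw [← List.countP_eq_length_filter] at this
    omega
  obtain ⟨y, hvy, hyw⟩ := hex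
  constructor
  · rw [List.countP_filter] at h1
    refine lt_of_le_of_lt (List.countP_mono_left fun z _ hz => ?_) h1
    simp only [decide_eq_true_eq, Bool.and_eq_true] at hz ⊢
    exact ⟨hz, hvy.trans (hyw.trans_lt hz)⟩
  · exact h2.trans (List.filter_sublist.countP_le)

theorem IsKth.of_filter_lt {l : List ℝ} {k : ℕ} {v w : ℝ} (hk : l.countP (fun y => v ≤ y) < k)
    (h : IsKth (l.filter fun y => y < v) (k - l.countP (fun y => v ≤ y)) w) : IsKth l k w := by
  obtain ⟨h1, h2⟩ := h
  have hwv : w < v := by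
    have : 0 < (l.filter fun y => y < v).countP (fun y => w ≤ y) := by omega
    obtain ⟨y, hy, hwy⟩ := List.countP_pos_iff.1 this
    simp only [List.mem_filter, decide_eq_true_eq] at hy hwy
    exact hwy.trans_lt hy.2
  have split : ∀ p : ℝ → Bool, (∀ y, v ≤ y → p y) →
      l.countP p = (l.filter fun y => y < v).countP p + l.countP (fun y => v ≤ y) := by
    intro p hp
    rw [List.countP_eq_countP_filter_add l p fun y => y < v, Nat.add_left_cancel_iff,
      List.countP_filter]
    refine List.countP_congr fun y _ => ?_
    simp only [decide_eq_true_eq, Bool.and_eq_true, Bool.not_eq_true', decide_eq_false_iff_not,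
      not_lt]
    exact ⟨fun h => h.2, fun h => ⟨hp y h, h⟩⟩
  have s1 := split (fun y => w < y) fun y hy => by simpa using hwv.trans_le hy
  have s2 := split (fun y => w ≤ y) fun y hy => by simpa using (hwv.trans_le hy).le
  exact ⟨by omega, by omega⟩

theorem selectBody_iters {V : ℝ} (m : ℕ) : ∀ {s : State ℝ}, s.ireg 2 = 1 → s.ireg 7 = 0 →
    s.ireg 8 = 2 → s.ireg 16 = 10 → s.ireg 0 ≤ s.ireg 14 → s.ireg 13 = 0 → s.ireg 11 = m →
    1 ≤ s.ireg 12 → s.ireg 12 ≤ m →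
    Iters V (.ilt 13 8) selectBody s fun s' t => t ≤ 1500 * m ∧ s'.ireg 13 = 1 ∧
      s'.ireg 14 = s.ireg 14 ∧ IsKth (seg s.vmem (s.ireg 10) m) (s.ireg 12) (s'.vreg 11) ∧
      (∀ a < s.ireg 14, s'.imem a = s.imem a) ∧ ∀ a < s.ireg 10, s'.vmem a = s.vmem a := by
  induction m using Nat.strong_induction_on with
  | _ m ih =>
  intro s h2 h7 h8 h16 h0 h13 h11 hk hkm
  have hb : (Test.ilt 13 8).holds s := by simp [Test.holds, h13, h8]
  refine .step hb ?_
  rcases lt_or_ge m 10 with hm | hm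
  · refine (selectBody_brute h2 h7 h16 h13 (by omega) hk (by omega)).mono ?_
    rintro s' t ⟨ht, e13, e14, ei, ev, hI⟩
    rw [h11] at hI
    exact .refl ⟨by omega, e13, e14, hI, fun a _ => by rw [ei], fun a _ => by rw [ev]⟩
  refine (selectBody_push h2 h7 h16 h13 (by omega)).frame.mono ?_
  rintro s₁ t₁ ⟨⟨ht₁, a13, a14, a10, a11, a12, ai, ai1, ai2, aim, -, -, -, -, -, aold, age, ale⟩,
    hf₁⟩
  rw [h11] at a10 a11 a12 ai1 aold age ale ht₁
  have hr : 1 ≤ m / 10 := by omega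
  have b0 := hf₁.ireg 0 rfl
  have b2 := (hf₁.ireg 2 rfl).trans h2
  have b7 := (hf₁.ireg 7 rfl).trans h7
  have b8 := (hf₁.ireg 8 rfl).trans h8
  have b16 := (hf₁.ireg 16 rfl).trans h16
  refine (ih (2 * (m / 10)) (by omega) b2 b7 b8 b16 (by omega) a13 a11 (by omega)
    (by omega)).bind ?_
  rintro s₂ t₂ ⟨ht₂, c13, c14, hv, cim, cvm⟩ hf₂
  rw [a12, a10] at hv
  have hge : 3 * (m / 10) ≤ (seg s.vmem (s.ireg 10) m).countP (fun y => s₂.vreg 11 ≤ y) := by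
    have h1 := age (s₂.vreg 11)
    have h2 := hv.2
    rw [show m = 5 * (2 * (m / 10)) + m % 10 by omega, seg_add, List.countP_append,
      show 5 * (2 * (m / 10)) + m % 10 = m by omega]
    omega
  have hle : 3 * (m / 10) ≤ (seg s.vmem (s.ireg 10) m).countP (fun y => y ≤ s₂.vreg 11) := by
    have h1 := ale (s₂.vreg 11)
    have h2 := hv.1
    have h3 := countP_le_add_countP_lt (seg s₁.vmem (s.ireg 10 + m) (2 * (m / 10))) (s₂.vreg 11)
    rw [length_seg] at h3
    rw [show m = 5 * (2 * (m / 10)) + m % 10 by omega, seg_add, List.countP_append,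
      show 5 * (2 * (m / 10)) + m % 10 = m by omega]
    omega
  have hseg : seg s₂.vmem (s.ireg 10) m = seg s.vmem (s.ireg 10) m := seg_congr fun a _ ha => by
    rw [cvm a (by omega), aold a ha]
  have d0 := (hf₂.ireg 0 rfl).trans b0
  have d2 := (hf₂.ireg 2 rfl).trans b2
  have d7 := (hf₂.ireg 7 rfl).trans b7
  have d8 := (hf₂.ireg 8 rfl).trans b8
  have d16 := (hf₂.ireg 16 rfl).trans b16
  refine .step (by simp [Test.holds, c13, d8]) ?_
  refine (selectBody_resume d2 d7 c13 (c14.trans a14) (by omega)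
    ((cim _ (by omega)).trans ai) ((cim _ (by omega)).trans ai1)
    ((cim _ (by omega)).trans ai2)).frame.mono ?_
  rintro s₃ t₃ ⟨⟨ht₃, e14, eim, evm, hR⟩, hf₃⟩
  have him : ∀ a < s.ireg 14, s₃.imem a = s.imem a := fun a ha => by
    rw [eim, cim a (by omega), aim a ha]
  have hvm : ∀ a < s.ireg 10, s₃.vmem a = s.vmem a := fun a ha => by
    rw [evm a ha, cvm a (by omega), aold a (by omega)]
  have f0 := (hf₃.ireg 0 rfl).trans d0
  have f2 := (hf₃.ireg 2 rfl).trans d2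
  have f7 := (hf₃.ireg 7 rfl).trans d7
  have f8 := (hf₃.ireg 8 rfl).trans d8
  have f16 := (hf₃.ireg 16 rfl).trans d16
  have hlen1 := countP_le_add_countP_lt (seg s.vmem (s.ireg 10) m) (s₂.vreg 11)
  have hlen2 := countP_lt_add_countP_le (seg s.vmem (s.ireg 10) m) (s₂.vreg 11)
  rw [length_seg] at hlen1 hlen2
  rcases hR with ⟨h, h13, h10, h11', h12, hs⟩ | ⟨h, h13, h11'⟩ | ⟨h, h13, h10, h11', h12, hs⟩
  · rw [hseg] at h h11' hs
    rw [h11'] at hs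
    refine (ih _ (by omega) f2 f7 f8 f16 (by omega) h13 h11' (by omega) (by omega)).bind ?_
    rintro s₄ t₄ ⟨ht₄, g13, g14, hw, gim, gvm⟩ -
    refine .refl ⟨by omega, g13, by omega, ?_, fun a ha => (gim a (by omega)).trans (him a ha),
      fun a ha => (gvm a (by omega)).trans (hvm a ha)⟩
    rw [h10, h12, hs] at hw
    exact hw.of_filter_gt h
  · rw [hseg] at h
    rw [← h11'] at h
    exact .refl ⟨by omega, h13, by omega, h, him, hvm⟩
  · rw [hseg] at h h11' h12 hs
    rw [h11'] at hs
    refine (ih _ (by omega) f2 f7 f8 f16 (by omega) h13 h11' (by omega) (by omega)).bind ?_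
    rintro s₄ t₄ ⟨ht₄, g13, g14, hw, gim, gvm⟩ -
    refine .refl ⟨by omega, g13, by omega, ?_, fun a ha => (gim a (by omega)).trans (him a ha),
      fun a ha => (gvm a (by omega)).trans (hvm a ha)⟩
    rw [h10, h12, hs] at hw
    exact hw.of_filter_lt h

/-- Select among the entries at the address in index register `5`; their number is in index
register `0` and the rank in index register `1`. -/
def selectProg : Cmd :=
  block [.prim (.iadd 10 5 7), .prim (.iadd 11 0 7), .prim (.iadd 12 1 7), .prim (.iconst 13 0),
    .prim (.iadd 14 0 7), .prim (.iconst 16 10), .prim (.iconst 8 2),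
    .while (.ilt 13 8) selectBody]

theorem selectProg_runs {V : ℝ} {s : State ℝ} (h2 : s.ireg 2 = 1) (h7 : s.ireg 7 = 0)
    (hk : 1 ≤ s.ireg 1) (hkn : s.ireg 1 ≤ s.ireg 0) :
    Runs V selectProg s fun s' t => t ≤ 1500 * s.ireg 0 + 12 ∧
      IsKth (seg s.vmem (s.ireg 5) (s.ireg 0)) (s.ireg 1) (s'.vreg 11) ∧
      (∀ a < s.ireg 0, s'.imem a = s.imem a) ∧ ∀ a < s.ireg 5, s'.vmem a = s.vmem a := by
  simp only [selectProg, block, runs_seq, runs_prim, Instr.Ok, Instr.step, true_and, runs_skip]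
  refine ((selectBody_iters (s.ireg 0) (by simp [h2]) (by simp [h7]) (by simp) (by simp)
    (by simp [h7]) (by simp) (by simp [h7]) (by simpa [h7] using hk)
    (by simpa [h7] using hkn)).bind fun s₁ t₁ H hf => ?_).runs (fun _ _ h => h)
  obtain ⟨ht, h13, h14, hI, him, hvm⟩ := H
  have e0 := hf.ireg 0 rfl
  have e2 := hf.ireg 2 rfl
  have e8 := hf.ireg 8 rfl
  simp [h2, h7] at h14 hI him hvm e0 e2 e8
  refine .step (by simp [Test.holds, h13, e8]) ?_
  simp only [selectBody, runs_ite, Test.holds, h13, e2, h14, e0, lt_irrefl, le_refl, not_true,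
    not_false_eq_true, forall_true_left, false_imp_iff, true_and, and_true, runs_prim, Instr.Ok,
    Instr.step]
  exact .refl ⟨by simp [e8], by omega, hI, him, hvm⟩

/-! ### Evaluation of a preference -/

theorem kthScore_eq {n d : ℕ} {P : Fin n → Fin d → ℝ} {S : Finset (Fin n)} {k : ℕ}
    {u : Fin d → ℝ} {t : ℝ} (hk : 1 ≤ k) (hkS : k ≤ S.card)
    (h1 : (S.filter fun j => t < score u (P j)).card < k)
    (h2 : k ≤ (S.filter fun j => t ≤ score u (P j)).card) : kthScore P S k u = t :=
  have h := kthScore_spec P S k u hk hkS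
  le_antisymm (kthScore_unique h1 h.2.2) (kthScore_unique h.2.1 h2)

theorem IsKth.kthScore_eq {n d : ℕ} {P : Fin n → Fin d → ℝ} {k : ℕ} {u : Fin d → ℝ} {t : ℝ}
    (hk : 1 ≤ k) (hkn : k ≤ n) (h : IsKth (List.ofFn fun i => score u (P i)) k t) :
    kthScore P Finset.univ k u = t :=
  RMS.kthScore_eq hk (by simpa using hkn)
    (by rw [card_filter_eq_countP_ofFn (fun i => score u (P i)) (t < ·)]; exact h.1)
    (by rw [card_filter_eq_countP_ofFn (fun i => score u (P i)) (t ≤ ·)]; exact h.2)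

theorem kthScore_one_eq {n d : ℕ} {P : Fin n → Fin d → ℝ} {Q : Finset (Fin n)}
    {u : Fin d → ℝ} {t : ℝ} (h : ∃ i ∈ Q, score u (P i) = t)
    (ht : ∀ i ∈ Q, score u (P i) ≤ t) : kthScore P Q 1 u = t := by
  obtain ⟨i, hi, rfl⟩ := h
  refine kthScore_eq le_rfl (Finset.card_pos.2 ⟨i, hi⟩) ?_
    (Finset.card_pos.2 ⟨i, Finset.mem_filter.2 ⟨hi, le_rfl⟩⟩)
  rw [Nat.lt_one_iff, Finset.card_eq_zero, Finset.filter_eq_empty_iff]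
  exact fun j hj => not_lt.2 (ht j hj)

theorem score_nonneg {d : ℕ} {u p : Fin d → ℝ} (hu : ∀ j, 0 ≤ u j) (hp : ∀ j, 0 ≤ p j) :
    0 ≤ score u p :=
  Finset.sum_nonneg fun j _ => mul_nonneg (hu j) (hp j)

theorem seg_eq_ofFn (mem : ℕ → ℝ) (b m : ℕ) :
    seg mem b m = List.ofFn fun i : Fin m => mem (b + i) := by
  exact List.ext_getElem (by simp) fun i _ _ => by simp [seg]

/-- The inner product of the vectors at the addresses in index registers `4` and `31`, of the
length in index register `6`. -/
def dotProg : Cmd :=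
  block [.prim (.vconst 21 0), .prim (.iconst 32 0),
    .while (.ilt 32 6) (block [.prim (.iadd 33 4 32), .prim (.vload 22 33), .prim (.vload 23 31),
      .prim (.vop .mul 22 22 23), .prim (.vop .add 21 21 22), .prim (.iadd 31 31 2),
      .prim (.iadd 32 32 2)])]

theorem dotProg_runs {V : ℝ} {s : State ℝ} (h2 : s.ireg 2 = 1)
    (hV : ∀ j < s.ireg 6, |s.vmem (s.ireg 4 + j) * s.vmem (s.ireg 31 + j)| ≤ V) :
    Runs V dotProg s fun s' t => t ≤ 8 * s.ireg 6 + 3 ∧ s'.ireg 31 = s.ireg 31 + s.ireg 6 ∧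
      s'.vreg 21 = ∑ j ∈ Finset.range (s.ireg 6),
        s.vmem (s.ireg 4 + j) * s.vmem (s.ireg 31 + j) := by
  simp only [dotProg, block, runs_seq, runs_prim, Instr.Ok, Instr.step, true_and, runs_skip]
  refine (Runs.while_count (fun i s' => s'.ireg 32 = i ∧ s'.ireg 31 = s.ireg 31 + i ∧
    s'.vreg 21 = ∑ j ∈ Finset.range i, s.vmem (s.ireg 4 + j) * s.vmem (s.ireg 31 + j))
    (s.ireg 6) 7 (by simp) ?_ ?_).mono ?_
  · rintro i s' hi hf ⟨h32, h31, h21⟩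
    have e2 := hf.ireg 2 rfl
    have e4 := hf.ireg 4 rfl
    have e6 := hf.ireg 6 rfl
    have em := hf.vmem rfl
    simp [h2] at e2 e4 e6 em
    refine ⟨by simp [Test.holds, *], ?_⟩
    have := hV i hi
    rw [abs_mul] at this
    simp [Instr.Ok, Instr.step, Op.eval, e2, e4, em, h32, h31, h21, Finset.sum_range_succ,
      add_assoc, this]
  · rintro s' hf ⟨h32, -⟩
    have e6 := hf.ireg 6 rfl
    simp at e6
    simp [Test.holds, *]
  · rintro s' t ⟨ht, -, h31, h21⟩
    exact ⟨by omega, h31, h21⟩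

/-- Write the scores behind the address in index register `5` and put the largest score of `Q`
into value register `20`. -/
def scoresProg : Cmd :=
  block [.prim (.iconst 30 0), .prim (.iconst 31 0), .prim (.vconst 20 0),
    .while (.ilt 30 0) (block [dotProg, .prim (.iadd 33 5 30), .prim (.vstore 33 21),
      .prim (.iload 34 30),
      .ite (.ile 2 34) (.ite (.vlt 20 21) (.prim (.vload 20 33)) .skip) .skip,
      .prim (.iadd 30 30 2)])]

theorem scoresProg_runs {V : ℝ} {s : State ℝ} {f : ℕ → ℝ} (h2 : s.ireg 2 = 1)
    (h45 : s.ireg 4 + s.ireg 6 ≤ s.ireg 5) (h05 : s.ireg 0 * s.ireg 6 ≤ s.ireg 5)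
    (hV : ∀ i < s.ireg 0, ∀ j < s.ireg 6,
      |s.vmem (s.ireg 4 + j) * s.vmem (i * s.ireg 6 + j)| ≤ V)
    (hf : ∀ i < s.ireg 0, f i = ∑ j ∈ Finset.range (s.ireg 6),
      s.vmem (s.ireg 4 + j) * s.vmem (i * s.ireg 6 + j)) :
    Runs V scoresProg s fun s' t => t ≤ s.ireg 0 * (8 * s.ireg 6 + 13) + 4 ∧
      (∀ i < s.ireg 0, s'.vmem (s.ireg 5 + i) = f i) ∧
      (∀ a < s.ireg 5, s'.vmem a = s.vmem a) ∧
      (∀ i < s.ireg 0, 0 < s.imem i → f i ≤ s'.vreg 20) ∧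
      (s'.vreg 20 = 0 ∨ ∃ i < s.ireg 0, 0 < s.imem i ∧ f i = s'.vreg 20) ∧ 0 ≤ s'.vreg 20 := by
  simp only [scoresProg, block, runs_seq, runs_prim, Instr.Ok, Instr.step, true_and, runs_skip]
  refine (Runs.while_count (fun i s' => s'.ireg 30 = i ∧ s'.ireg 31 = i * s.ireg 6 ∧
      (∀ i' < i, s'.vmem (s.ireg 5 + i') = f i') ∧
      (∀ a < s.ireg 5, s'.vmem a = s.vmem a) ∧
      (∀ i' < i, 0 < s.imem i' → f i' ≤ s'.vreg 20) ∧
      (s'.vreg 20 = 0 ∨ ∃ i' < i, 0 < s.imem i' ∧ f i' = s'.vreg 20) ∧ 0 ≤ s'.vreg 20)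
    (s.ireg 0) (8 * s.ireg 6 + 12) (by simp) ?_ ?_).mono ?_
  · rintro i s' hi hfr ⟨h30, h31, hst, hold, hub, hex, hnn⟩
    have e2 := hfr.ireg 2 rfl
    have e0 := hfr.ireg 0 rfl
    have e4 := hfr.ireg 4 rfl
    have e5 := hfr.ireg 5 rfl
    have e6 := hfr.ireg 6 rfl
    have ei := hfr.imem rfl
    simp [h2] at e2 e0 e4 e5 e6 ei
    clear hfr
    have hmul : i * s.ireg 6 + s.ireg 6 ≤ s.ireg 0 * s.ireg 6 := by
      rw [← Nat.succ_mul]; exact Nat.mul_le_mul_right _ hi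
    have r1 : ∀ j < s.ireg 6, s'.vmem (s'.ireg 4 + j) = s.vmem (s.ireg 4 + j) := fun j hj => by
      rw [e4]; exact hold _ (by omega)
    have r2 : ∀ j < s.ireg 6, s'.vmem (s'.ireg 31 + j) = s.vmem (i * s.ireg 6 + j) :=
      fun j hj => by rw [h31]; exact hold _ (by omega)
    refine ⟨by simp [Test.holds, *], ?_⟩
    refine (dotProg_runs e2 fun j hj => ?_).bind ?_
    · rw [e6] at hj
      rw [r1 j hj, r2 j hj]
      exact hV i hi j hj
    rintro s₁ t₁ ⟨ht₁, g31, g21⟩ hf₁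
    have f2 := hf₁.ireg 2 rfl
    have f5 := hf₁.ireg 5 rfl
    have f30 := hf₁.ireg 30 rfl
    have fi := hf₁.imem rfl
    have fm := hf₁.vmem rfl
    have f20 := hf₁.vreg 20 rfl
    rw [e2] at f2; rw [e5] at f5; rw [h30] at f30; rw [ei] at fi; rw [h31, e6] at g31
    have g21' : s₁.vreg 21 = f i := by
      rw [g21, hf i hi, e6]
      exact Finset.sum_congr rfl fun j hj => by
        rw [r1 j (Finset.mem_range.1 hj), r2 j (Finset.mem_range.1 hj)]
    have hst' : ∀ i' < i + 1,
        Function.update s₁.vmem (s.ireg 5 + i) (f i) (s.ireg 5 + i') = f i' := by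
      intro i' hi'
      rcases Nat.lt_succ_iff_lt_or_eq.1 hi' with h | rfl
      · rw [Function.update_of_ne (by omega), fm, hst i' h]
      · rw [Function.update_self]
    have hold' : ∀ a < s.ireg 5, Function.update s₁.vmem (s.ireg 5 + i) (f i) a = s.vmem a :=
      fun a ha => by rw [Function.update_of_ne (by omega), fm, hold a ha]
    have e31 : i * s.ireg 6 + s.ireg 6 = (i + 1) * s.ireg 6 := (Nat.succ_mul _ _).symm
    rw [e31] at g31
    simp only [runs_seq, runs_prim, Instr.Ok, Instr.step, true_and, runs_ite, Test.holds,
      Function.update_self, Function.update_of_ne, ne_eq, Nat.reduceEqDiff, not_false_eq_true,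
      f2, f5, f30, fi, g21', f20, g31, runs_skip]
    refine ⟨fun c1 => ⟨fun c2 => ⟨by omega, hst', hold', ?_, .inr ⟨i, by omega, c1, rfl⟩,
      hnn.trans c2.le⟩, fun c2 => ⟨by omega, hst', hold', ?_, ?_, hnn⟩⟩,
      fun c1 => ⟨by omega, hst', hold', ?_, ?_, hnn⟩⟩
    · intro i' hi' hp
      rcases Nat.lt_succ_iff_lt_or_eq.1 hi' with h | rfl
      · exact (hub i' h hp).trans c2.le
      · exact le_rfl
    · intro i' hi' hp
      rcases Nat.lt_succ_iff_lt_or_eq.1 hi' with h | rfl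
      · exact hub i' h hp
      · exact not_lt.1 c2
    · exact hex.imp_right fun ⟨i', h, h'⟩ => ⟨i', by omega, h'⟩
    · intro i' hi' hp
      rcases Nat.lt_succ_iff_lt_or_eq.1 hi' with h | rfl
      · exact hub i' h hp
      · exact absurd hp c1
    · exact hex.imp_right fun ⟨i', h, h'⟩ => ⟨i', by omega, h'⟩
  · rintro s' hfr ⟨h30, -⟩
    have e0 := hfr.ireg 0 rfl
    simp at e0
    simp [Test.holds, *]
  · rintro s' t ⟨ht, -, -, h⟩
    exact ⟨by rw [show 8 * s.ireg 6 + 13 = 8 * s.ireg 6 + 12 + 1 from rfl]; omega, h⟩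

/-- The memory with the coordinates of the points, followed by `d` zeros, a `1` and zeros. -/
def pointMem {n d : ℕ} (P : Fin n → Fin d → ℝ) (a : ℕ) : ℝ :=
  if h : a < n * d then P (Fin.divNat ⟨a, h⟩) (Fin.modNat ⟨a, h⟩) else
    if a = n * d + d then 1 else 0

theorem mul_add_lt {n d i j : ℕ} (hi : i < n) (hj : j < d) : i * d + j < n * d :=
  calc i * d + j < i * d + d := by omega
    _ = (i + 1) * d := (Nat.succ_mul _ _).symm
    _ ≤ n * d := Nat.mul_le_mul_right _ hi

theorem divNat_mul_add {n d : ℕ} (i : Fin n) (j : Fin d) (h : (i : ℕ) * d + j < n * d) :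
    Fin.divNat ⟨i * d + j, h⟩ = i := by
  ext
  have hd : 0 < d := Nat.zero_lt_of_lt j.2
  simp only [Fin.coe_divNat]
  rw [mul_comm, Nat.mul_add_div hd, Nat.div_eq_of_lt j.2, add_zero]

theorem modNat_mul_add {n d : ℕ} (i : Fin n) (j : Fin d) (h : (i : ℕ) * d + j < n * d) :
    Fin.modNat ⟨i * d + j, h⟩ = j := by
  ext
  simp only [Fin.coe_modNat]
  rw [mul_comm, Nat.mul_add_mod, Nat.mod_eq_of_lt j.2]

theorem pointMem_mul_add {n d : ℕ} (P : Fin n → Fin d → ℝ) (i : Fin n) (j : Fin d) :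
    pointMem P (i * d + j) = P i j := by
  have h := mul_add_lt i.2 j.2
  rw [pointMem, dif_pos h, divNat_mul_add, modNat_mul_add]

/-- The fixed registers and memory cells during the computation of the regret ratio. -/
structure Env {n d : ℕ} (P : Fin n → Fin d → ℝ) (Q : Finset (Fin n)) (k : ℕ) (s : State ℝ) :
    Prop where
  size : s.ireg 0 = n
  rank : s.ireg 1 = k
  one : s.ireg 2 = 1
  rows : s.ireg 3 = n * d + d + 1
  pref : s.ireg 4 = n * d + 2 * d + 1
  scores : s.ireg 5 = n * d + 3 * d + 1
  dim : s.ireg 6 = d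
  zero : s.ireg 7 = 0
  mem_Q : ∀ i : Fin n, 0 < s.imem i ↔ i ∈ Q
  points : ∀ a < n * d + 2 * d + 1, s.vmem a = pointMem P a

/-- The quotient of value registers `0` and `1` is one of the regrets. -/
structure Best {n d : ℕ} (P : Fin n → Fin d → ℝ) (Q : Finset (Fin n)) (k : ℕ) (X : ℝ)
    (s : State ℝ) : Prop where
  num_nonneg : 0 ≤ s.vreg 0
  num_le : s.vreg 0 ≤ X
  den_pos : 0 < s.vreg 1
  den_le : s.vreg 1 ≤ X
  attained : s.vreg 0 / s.vreg 1 ∈ regrets P Q k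

/-- Evaluate the regret of the preference at the address in index register `4` and update the
best regret. -/
def evalProg : Cmd :=
  block [scoresProg, selectProg, .prim (.vconst 27 0), .prim (.vop .sub 24 11 20),
    .prim (.vop .mul 25 24 1), .prim (.vop .mul 26 0 11),
    .ite (.vlt 26 25) (block [.prim (.vop .add 0 24 27), .prim (.vop .add 1 11 27)]) .skip]

theorem evalProg_runs {V X : ℝ} {n d k : ℕ} {P : Fin n → Fin d → ℝ} {Q : Finset (Fin n)}
    {s : State ℝ} {u : Fin d → ℝ} (hk : 1 ≤ k) (hkn : k ≤ n) (hP : ∀ i j, 0 ≤ P i j)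
    (hQ : Q.Nonempty) (hE : Env P Q k s) (hB : Best P Q k X s)
    (hus : ∀ j : Fin d, s.vmem (n * d + 2 * d + 1 + j) = u j) (hu : ∀ j, 0 ≤ u j)
    (hX : 1 ≤ X) (hV : X * X ≤ V) (hscore : ∀ i, score u (P i) ≤ X) :
    Runs V evalProg s fun s' t => t ≤ (8 * d + 1540) * n ∧ Env P Q k s' ∧ Best P Q k X s' ∧
      regret P Q k u ≤ s'.vreg 0 / s'.vreg 1 ∧
      s.vreg 0 / s.vreg 1 ≤ s'.vreg 0 / s'.vreg 1 := by
  obtain ⟨e0, e1, e2, e3, e4, e5, e6, e7, eQ, eP⟩ := hE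
  have hXV : X ≤ V := by nlinarith
  have hterm : ∀ i : Fin n, ∀ j : Fin d,
      s.vmem (s.ireg 4 + j) * s.vmem (i * s.ireg 6 + j) = u j * P i j := fun i j => by
    rw [e4, e6, hus, eP _ (by have := mul_add_lt i.2 j.2; omega), pointMem_mul_add]
  have hle : ∀ i : Fin n, ∀ j : Fin d, |u j * P i j| ≤ V := fun i j => by
    rw [abs_of_nonneg (mul_nonneg (hu j) (hP i j))]
    exact ((Finset.single_le_sum (f := fun j => u j * P i j)
      (fun j _ => mul_nonneg (hu j) (hP i j)) (Finset.mem_univ j)).trans (hscore i)).trans hXV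
  refine (scoresProg_runs (f := fun i => if h : i < n then score u (P ⟨i, h⟩) else 0) e2
    (by omega) (by rw [e0, e6]; omega) (fun i hi j hj => ?_) (fun i hi => ?_)).bind ?_
  · rw [e0] at hi
    rw [e6] at hj
    have := hterm ⟨i, hi⟩ ⟨j, hj⟩
    simp only at this
    rw [this]
    exact hle _ _
  · rw [e0] at hi
    rw [dif_pos hi, Finset.sum_range, score]
    symm
    rw [← Fin.sum_congr' _ e6.symm]
    exact Finset.sum_congr rfl fun j _ => by simpa using hterm ⟨i, hi⟩ j
  rintro s₁ t₁ ⟨ht₁, hst, hold, hub, hex, hnn⟩ hf₁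
  rw [e0] at hst hub hex ht₁
  rw [e6] at ht₁
  rw [e5] at hold hst
  have f0 := (hf₁.ireg 0 rfl).trans e0
  have f1 := (hf₁.ireg 1 rfl).trans e1
  have f2 := (hf₁.ireg 2 rfl).trans e2
  have f3 := (hf₁.ireg 3 rfl).trans e3
  have f4 := (hf₁.ireg 4 rfl).trans e4
  have f5 := (hf₁.ireg 5 rfl).trans e5
  have f6 := (hf₁.ireg 6 rfl).trans e6
  have f7 := (hf₁.ireg 7 rfl).trans e7
  have fi := hf₁.imem rfl
  have fv0 := hf₁.vreg 0 rfl
  have fv1 := hf₁.vreg 1 rfl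
  clear hf₁
  have hst' : ∀ i : Fin n, s₁.vmem (n * d + 3 * d + 1 + i) = score u (P i) := fun i => by
    rw [hst i i.2, dif_pos i.2]
  have hQ1 : kthScore P Q 1 u = s₁.vreg 20 := by
    have hub' : ∀ i ∈ Q, score u (P i) ≤ s₁.vreg 20 := fun i hi => by
      have := hub i i.2 ((eQ i).2 hi)
      rwa [dif_pos i.2] at this
    refine kthScore_one_eq ?_ hub'
    rcases hex with h0 | ⟨i, hi, hiQ, h⟩
    · obtain ⟨i, hi⟩ := hQ
      exact ⟨i, hi, le_antisymm (hub' i hi) (h0 ▸ score_nonneg hu (hP i))⟩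
    · exact ⟨⟨i, hi⟩, (eQ ⟨i, hi⟩).1 hiQ, by rwa [dif_pos hi] at h⟩
  refine (selectProg_runs f2 f7 (by omega) (by omega)).bind ?_
  rintro s₂ t₂ ⟨ht₂, hI, him, hvm⟩ hf₂
  rw [f0, f1, f5, seg_eq_ofFn] at hI
  simp only [hst'] at hI
  have hkP := hI.kthScore_eq hk hkn
  rw [f0] at him ht₂
  rw [f5] at hvm
  have g0 := (hf₂.ireg 0 rfl).trans f0
  have g1 := (hf₂.ireg 1 rfl).trans f1
  have g2 := (hf₂.ireg 2 rfl).trans f2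
  have g3 := (hf₂.ireg 3 rfl).trans f3
  have g4 := (hf₂.ireg 4 rfl).trans f4
  have g5 := (hf₂.ireg 5 rfl).trans f5
  have g6 := (hf₂.ireg 6 rfl).trans f6
  have g7 := (hf₂.ireg 7 rfl).trans f7
  have gv0 := (hf₂.vreg 0 rfl).trans fv0
  have gv1 := (hf₂.vreg 1 rfl).trans fv1
  have gv20 := hf₂.vreg 20 rfl
  clear hf₂
  have gQ : ∀ i : Fin n, 0 < s₂.imem i ↔ i ∈ Q := fun i => by rw [him i i.2, fi]; exact eQ i
  have gP : ∀ a < n * d + 2 * d + 1, s₂.vmem a = pointMem P a := fun a ha => by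
    rw [hvm a (by omega), hold a (by omega), eP a ha]
  obtain ⟨b1, b2, b3, b4, b5⟩ := hB
  have hnP : 0 ≤ s₂.vreg 11 ∧ s₂.vreg 11 ≤ X := by
    obtain ⟨⟨i, -, hi⟩, -⟩ := kthScore_spec P Finset.univ k u hk (by simpa using hkn)
    rw [hkP] at hi
    rw [← hi]
    exact ⟨score_nonneg hu (hP i), hscore i⟩
  have hnQ : 0 ≤ s₁.vreg 20 ∧ s₁.vreg 20 ≤ X := by
    obtain ⟨⟨i, -, hi⟩, -⟩ := kthScore_spec P Q 1 u le_rfl (Finset.card_pos.2 hQ)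
    rw [hQ1] at hi
    rw [← hi]
    exact ⟨score_nonneg hu (hP i), hscore i⟩
  have hreg : regret P Q k u = max 0 (s₂.vreg 11 - s₁.vreg 20) / s₂.vreg 11 := by
    rw [regret, hkP, hQ1]
  have hmul1 : |(s₂.vreg 11 - s₁.vreg 20) * s.vreg 1| ≤ V := by
    rw [abs_mul, abs_of_pos b3]
    exact (mul_le_mul (abs_sub_le_iff.2 ⟨by linarith, by linarith⟩) b4 b3.le (by linarith)).trans hV
  have hmul2 : |s.vreg 0 * s₂.vreg 11| ≤ V := by
    rw [abs_of_nonneg (mul_nonneg b1 hnP.1)]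
    exact (mul_le_mul b2 hnP.2 hnP.1 (by linarith)).trans hV
  have htime : ∀ t, t ≤ 10 → t₁ + (t₂ + t) ≤ (8 * d + 1540) * n := fun t ht => by
    have : (8 * d + 1540) * n = n * (8 * d + 13) + 1500 * n + 27 * n := by ring
    omega
  simp only [runs_seq, runs_prim, Instr.Ok, Instr.step, true_and, runs_ite, Test.holds, block,
    Function.update_self, Function.update_of_ne, ne_eq, Nat.reduceEqDiff, not_false_eq_true,
    runs_skip, Op.eval, gv0, gv1, gv20, add_zero, Int.cast_zero]
  refine ⟨hmul1, hmul2, fun c => ⟨htime _ (by omega), ⟨g0, g1, g2, g3, g4, g5, g6, g7, gQ, gP⟩, ?_⟩,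
    fun c => ⟨htime _ (by omega), ⟨g0, g1, g2, g3, g4, g5, g6, g7, gQ, gP⟩, ?_⟩⟩
  · have hpos : 0 < s₂.vreg 11 := by
      rcases hnP.1.eq_or_lt with h | h
      · rw [← h] at c
        nlinarith [mul_nonneg hnQ.1 b3.le]
      · exact h
    have hdiff : 0 < s₂.vreg 11 - s₁.vreg 20 := by
      have := mul_nonneg b1 hnP.1
      by_contra! h
      nlinarith
    rw [max_eq_right hdiff.le] at hreg
    refine ⟨⟨by simpa using hdiff.le, by simp; linarith, by simpa using hpos,
      by simpa using hnP.2, ⟨u, hu, by simpa using hreg⟩⟩, by simp [hreg], ?_⟩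
    rw [div_le_div_iff₀ b3 hpos]
    exact c.le
  · rw [not_lt] at c
    refine ⟨⟨by simpa [gv0] using b1, by simpa [gv0] using b2, by simpa [gv1] using b3,
      by simpa [gv1] using b4, by simpa [gv0, gv1] using b5⟩, ?_, le_rfl⟩
    rw [hreg]
    rcases hnP.1.eq_or_lt with h | h
    · rw [← h, div_zero]
      exact div_nonneg b1 b3.le
    · rw [div_le_div_iff₀ h b3]
      rcases le_total (s₂.vreg 11 - s₁.vreg 20) 0 with h' | h'
      · rw [max_eq_left h', zero_mul]
        exact mul_nonneg b1 h.le
      · rw [max_eq_right h']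
        exact c

/-! ### Extreme preferences -/

section extreme

variable {ι : Type} {d : ℕ}

theorem score_add (u v p : Fin d → ℝ) : score (u + v) p = score u p + score v p := by
  simp [score, add_mul, Finset.sum_add_distrib]

theorem score_smul (r : ℝ) (u p : Fin d → ℝ) : score (r • u) p = r * score u p := by
  simp [score, Finset.mul_sum, mul_assoc]

theorem score_sub_right (u p q : Fin d → ℝ) : score u (p - q) = score u p - score u q := by
  simp [score, mul_sub]

theorem score_smul_right (r : ℝ) (u p : Fin d → ℝ) : score u (r • p) = r * score u p := by
  simp only [score, Finset.mul_sum, Pi.smul_apply, smul_eq_mul]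
  exact Finset.sum_congr rfl fun j _ => by ring

theorem score_single (u : Fin d → ℝ) (j : Fin d) : score u (Pi.single j 1) = u j := by
  simp [score, Pi.single_apply]

/-- `w` is in the closure of the cell of `u` in the arrangement of the hyperplanes with the normal
vectors `h a`. -/
def InCell (h : ι → Fin d → ℝ) (u w : Fin d → ℝ) : Prop :=
  ∀ a, (0 ≤ score u (h a) → 0 ≤ score w (h a)) ∧ (score u (h a) ≤ 0 → score w (h a) ≤ 0)

theorem InCell.trans {h : ι → Fin d → ℝ} {u v w : Fin d → ℝ} (h₁ : InCell h u v)
    (h₂ : InCell h v w) : InCell h u w :=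
  fun a => ⟨fun ha => (h₂ a).1 ((h₁ a).1 ha), fun ha => (h₂ a).2 ((h₁ a).2 ha)⟩

theorem exists_extreme [Finite ι] {h : ι → Fin d → ℝ} (hs : ∀ j, ∃ a, h a = Pi.single j 1)
    (c : Fin d → ℝ) {u : Fin d → ℝ} (hu : ∀ j, 0 ≤ u j) (huc : score u c < 0) :
    ∃ w : Fin d → ℝ, (∀ j, 0 ≤ w j) ∧ InCell h u w ∧ score w c < 0 ∧
      ∀ v : Fin d → ℝ, (∀ a, score w (h a) = 0 → score v (h a) = 0) → ∃ r : ℝ, v = r • w := by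
  induction hN : {a | score u (h a) ≠ 0}.ncard using Nat.strong_induction_on generalizing u with
  | _ N ih =>
  by_cases hext : ∀ v : Fin d → ℝ, (∀ a, score u (h a) = 0 → score v (h a) = 0) →
      ∃ r : ℝ, v = r • u
  · exact ⟨u, hu, fun a => ⟨id, id⟩, huc, hext⟩
  push Not at hext
  obtain ⟨v₀, hv₀, hne⟩ := hext
  have hsum : 0 < ∑ j, u j := by
    refine (Finset.sum_nonneg fun j _ => hu j).lt_of_ne fun h0 => ?_
    have := (Finset.sum_eq_zero_iff_of_nonneg fun j _ => hu j).1 h0.symm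
    simp [score, fun j => this j (Finset.mem_univ j)] at huc
  obtain ⟨v, hv, hvne, hvsum, hvc⟩ : ∃ v : Fin d → ℝ,
      (∀ a, score u (h a) = 0 → score v (h a) = 0) ∧ v ≠ 0 ∧ ∑ j, v j = 0 ∧ score v c ≤ 0 := by
    set r := (∑ j, v₀ j) / ∑ j, u j with hr
    have h1 : ∀ a, score u (h a) = 0 → score (v₀ + (-r) • u) (h a) = 0 := fun a ha => by
      rw [score_add, score_smul, hv₀ a ha, ha]; simp
    have h2 : v₀ + (-r) • u ≠ 0 := fun h0 => hne r (by
      rw [neg_smul, ← sub_eq_add_neg, sub_eq_zero] at h0; exact h0)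
    have h3 : ∑ j, (v₀ + (-r) • u) j = 0 := by
      simp only [Pi.add_apply, Pi.smul_apply, smul_eq_mul, Finset.sum_add_distrib,
        ← Finset.mul_sum]
      rw [hr]
      field_simp
      ring
    rcases le_total (score (v₀ + (-r) • u) c) 0 with h4 | h4
    · exact ⟨_, h1, h2, h3, h4⟩
    · refine ⟨(-1 : ℝ) • (v₀ + (-r) • u), fun a ha => by rw [score_smul, h1 a ha, mul_zero],
        smul_ne_zero (by norm_num) h2, ?_, by rw [score_smul]; linarith⟩
      simp only [Pi.smul_apply, smul_eq_mul, ← Finset.mul_sum] at h3 ⊢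
      rw [h3, mul_zero]
  have hT : {a | score u (h a) * score v (h a) < 0}.Nonempty := by
    have hex : ∃ j, v j < 0 := by
      by_contra! hge
      exact hvne (funext fun j => (Finset.sum_eq_zero_iff_of_nonneg fun j _ => hge j).1 hvsum j
        (Finset.mem_univ j))
    obtain ⟨j, hj⟩ := hex
    obtain ⟨a, ha⟩ := hs j
    refine ⟨a, ?_⟩
    have hz := hv a
    rw [ha, score_single, score_single] at hz
    simp only [Set.mem_ofPred_eq, ha, score_single]
    exact mul_neg_of_pos_of_neg ((hu j).lt_of_ne fun h0 => hj.ne (hz h0.symm)) hj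
  obtain ⟨a₀, ha₀, hmin⟩ := Set.exists_min_image _ (fun a => -score u (h a) / score v (h a))
    (Set.toFinite _) hT
  set t := -score u (h a₀) / score v (h a₀) with ht
  have hpos : ∀ a, score u (h a) * score v (h a) < 0 → 0 < -score u (h a) / score v (h a) := by
    intro a ha
    rcases mul_neg_iff.1 ha with ⟨h1, h2⟩ | ⟨h1, h2⟩
    · exact div_pos_of_neg_of_neg (by linarith) h2
    · exact div_pos (by linarith) h2
  have ht0 : 0 < t := hpos a₀ ha₀
  have hw : ∀ p, score (u + t • v) p = score u p + t * score v p := fun p => by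
    rw [score_add, score_smul]
  have hcell : InCell h u (u + t • v) := by
    intro a
    rw [hw]
    rcases lt_trichotomy (score u (h a)) 0 with h0 | h0 | h0
    · refine ⟨fun h1 => absurd h0 (not_lt.2 h1), fun _ => ?_⟩
      rcases le_or_gt (score v (h a)) 0 with h1 | h1
      · nlinarith
      · have : t ≤ -score u (h a) / score v (h a) := hmin a (mul_neg_of_neg_of_pos h0 h1)
        rw [le_div_iff₀ h1] at this
        linarith
    · rw [hv a h0, h0]; simp
    · refine ⟨fun _ => ?_, fun h1 => absurd h0 (not_lt.2 h1)⟩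
      rcases le_or_gt 0 (score v (h a)) with h1 | h1
      · positivity
      · have : t ≤ -score u (h a) / score v (h a) := hmin a (mul_neg_of_pos_of_neg h0 h1)
        rw [le_div_iff_of_neg h1] at this
        linarith
  have hlt : {a | score (u + t • v) (h a) ≠ 0}.ncard < N := by
    rw [← hN]
    refine Set.ncard_lt_ncard ⟨fun a ha h0 => ha ?_, fun hsub => ?_⟩ (Set.toFinite _)
    · rw [hw, h0, hv a h0]; simp
    · have hne : score v (h a₀) ≠ 0 := fun h0 => by simp [h0] at ha₀
      refine hsub (a := a₀) (fun h0 => by simp [h0] at ha₀) ?_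
      rw [hw, ht]
      field_simp
      ring
  obtain ⟨w, h1, h2, h3, h4⟩ := ih _ hlt (fun j => by
      obtain ⟨a, ha⟩ := hs j
      have := (hcell a).1
      rw [ha, score_single, score_single] at this
      exact this (hu j))
    (by rw [hw]; nlinarith) rfl
  exact ⟨w, h1, hcell.trans h2, h3, h4⟩

end extreme

/-- The preference which is orthogonal to the given vectors, if it is unique. -/
noncomputable def orthPref {D : ℕ} (M : Fin D → Fin (D + 1) → ℝ) : Fin (D + 1) → ℝ :=
  fun j => |(Matrix.of (Fin.cons 0 M : Fin (D + 1) → Fin (D + 1) → ℝ)).adjugate j 0|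

theorem exists_orthPref_eq {ι : Type} {D : ℕ} {h : ι → Fin (D + 1) → ℝ} {w : Fin (D + 1) → ℝ}
    (hw : ∀ j, 0 ≤ w j) (hw0 : w ≠ 0)
    (hext : ∀ v : Fin (D + 1) → ℝ, (∀ a, score w (h a) = 0 → score v (h a) = 0) →
      ∃ r : ℝ, v = r • w) :
    ∃ (a : Fin D → ι) (r : ℝ), 0 < r ∧ orthPref (fun l => h (a l)) = r • w := by
  have hww : 0 < score w w := by
    obtain ⟨j, hj⟩ := Function.ne_iff.1 hw0
    exact Finset.sum_pos' (fun j _ => mul_self_nonneg _) ⟨j, Finset.mem_univ j,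
      mul_self_pos.2 hj⟩
  set T : Set (Fin (D + 1) → ℝ) := insert w (h '' {a | score w (h a) = 0}) with hT
  have hspan : Submodule.span ℝ T = ⊤ := by
    by_contra hne
    obtain ⟨f, hf0, hf⟩ := Submodule.exists_le_ker_of_lt_top _ (lt_top_iff_ne_top.2 hne)
    have hfs : ∀ x, f x = score (fun j => f (Pi.single j 1)) x := fun x => by
      conv_lhs => rw [← Finset.univ_sum_single x, map_sum]
      refine Finset.sum_congr rfl fun j _ => ?_
      have : (Pi.single j (x j) : Fin (D + 1) → ℝ) = x j • Pi.single j 1 := by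
        rw [← Pi.single_smul]; simp
      rw [this, map_smul, smul_eq_mul, mul_comm]
    have hfT : ∀ x ∈ T, f x = 0 := fun x hx => hf (Submodule.subset_span hx)
    obtain ⟨r, hr⟩ := hext (fun j => f (Pi.single j 1)) fun a ha => by
      rw [← hfs]; exact hfT _ (Set.mem_insert_of_mem _ ⟨a, ha, rfl⟩)
    have h0 := hfT w (Set.mem_insert _ _)
    rw [hfs, hr, score_smul] at h0
    have hr0 : r = 0 := (mul_eq_zero.1 h0).resolve_right hww.ne'
    refine hf0 (LinearMap.ext fun x => ?_)
    rw [hfs, hr, hr0, score_smul]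
    simp
  obtain ⟨b, hbT, hwb, hTb, hb⟩ := exists_linearIndepOn_id_extension
    (K := ℝ) (s := {w}) (t := T) (by
      rw [LinearIndepOn, linearIndependent_unique_iff]
      exact hw0) (by simp [hT])
  have hbtop : ⊤ ≤ Submodule.span ℝ (Set.range (Subtype.val : b → Fin (D + 1) → ℝ)) := by
    rw [Subtype.range_coe, ← hspan]
    exact Submodule.span_le.2 hTb
  let B : Module.Basis b ℝ (Fin (D + 1) → ℝ) := Module.Basis.mk hb hbtop
  have : Finite b := Module.Finite.finite_basis B
  have : Fintype b := Fintype.ofFinite b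
  have hcard : Fintype.card b = D + 1 := by
    rw [← Module.finrank_eq_card_basis B]; simp
  let e₀ : Fin (D + 1) ≃ b := (Fintype.equivFinOfCardEq hcard).symm
  let w' : b := ⟨w, hwb rfl⟩
  let e : Fin (D + 1) ≃ b := (Equiv.swap 0 (e₀.symm w')).trans e₀
  have he0 : (e 0 : Fin (D + 1) → ℝ) = w := by simp [e, w']
  have hrow : ∀ l : Fin D, ∃ a, score w (h a) = 0 ∧ h a = e l.succ := by
    intro l
    have := hbT (e l.succ).2
    rw [hT, Set.mem_insert_iff] at this
    rcases this with h1 | ⟨a, ha, h1⟩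
    · have : e l.succ = e 0 := Subtype.ext (h1.trans he0.symm)
      exact absurd (e.injective this) (Fin.succ_ne_zero l)
    · exact ⟨a, ha, h1⟩
  choose a ha hae using hrow
  set M : Fin D → Fin (D + 1) → ℝ := fun l => h (a l) with hM
  set A : Matrix (Fin (D + 1)) (Fin (D + 1)) ℝ := Matrix.of (Fin.cons w M) with hA
  have hAe : A.row = fun i => (e i : Fin (D + 1) → ℝ) := by
    funext i
    refine Fin.cases ?_ (fun l => ?_) i
    · exact he0.symm
    · exact hae l
  have hdet : IsUnit A := by
    rw [← Matrix.linearIndependent_rows_iff_isUnit, hAe]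
    exact hb.comp e e.injective
  have hdet' : A.det ≠ 0 := ((Matrix.isUnit_iff_isUnit_det _).1 hdet).ne_zero
  have hadj : ∀ j, (Matrix.of (Fin.cons 0 M : Fin (D + 1) → Fin (D + 1) → ℝ)).adjugate j 0 =
      A.adjugate j 0 := fun j => by
    rw [Matrix.adjugate_apply, Matrix.adjugate_apply]
    congr 1
    ext i j'
    refine Fin.cases ?_ (fun l => ?_) i
    · simp
    · rw [Matrix.updateRow_ne (Fin.succ_ne_zero l), Matrix.updateRow_ne (Fin.succ_ne_zero l)]
      rfl
  have hm : (fun j => A.adjugate j 0) = (A.det / score w w) • w := by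
    refine Matrix.mulVec_injective_of_isUnit hdet ?_
    funext i
    have h1 : (A.mulVec fun j => A.adjugate j 0) i = (A * A.adjugate) i 0 := rfl
    rw [h1, Matrix.mul_adjugate, Matrix.mulVec_smul]
    refine Fin.cases ?_ (fun l => ?_) i
    · have : A.mulVec w 0 = score w w := rfl
      simp only [Pi.smul_apply, this, Matrix.smul_apply, Matrix.one_apply_eq, smul_eq_mul]
      field_simp
    · have : A.mulVec w l.succ = score w (h (a l)) := by
        simp only [Matrix.mulVec, dotProduct, score]
        exact Finset.sum_congr rfl fun j _ => mul_comm _ _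
      simp [this, ha l, Matrix.one_apply_ne (Fin.succ_ne_zero l)]
  refine ⟨a, |A.det / score w w|, abs_pos.2 (div_ne_zero hdet' hww.ne'), ?_⟩
  funext j
  have := congrFun hm j
  rw [Pi.smul_apply, smul_eq_mul] at this
  rw [orthPref, hadj, this, abs_mul, abs_of_nonneg (hw j)]
  rfl

theorem regret_le_of_orthPref {ι : Type} [Finite ι] {n D k : ℕ} {P : Fin n → Fin (D + 1) → ℝ}
    {Q : Finset (Fin n)} {h : ι → Fin (D + 1) → ℝ} {ρ : ℝ} (hk : 1 ≤ k) (hkn : k ≤ n)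
    (hP : ∀ i j, 0 ≤ P i j) (hQ : Q.Nonempty) (hs : ∀ j, ∃ a, h a = Pi.single j 1)
    (hd : ∀ i i', ∃ a, h a = P i - P i') (hρ : 0 ≤ ρ)
    (hle : ∀ a : Fin D → ι, regret P Q k (orthPref fun l => h (a l)) ≤ ρ)
    {u : Fin (D + 1) → ℝ} (hu : ∀ j, 0 ≤ u j) : regret P Q k u ≤ ρ := by
  by_contra! hlt
  have hkc : k ≤ (Finset.univ : Finset (Fin n)).card := by simpa using hkn
  obtain ⟨⟨p, -, hp⟩, hp1, hp2⟩ := kthScore_spec P Finset.univ k u hk hkc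
  obtain ⟨⟨q, hqQ, hq⟩, hq1, -⟩ := kthScore_spec P Q 1 u le_rfl (Finset.card_pos.2 hQ)
  rw [Nat.lt_one_iff, Finset.card_eq_zero, Finset.filter_eq_empty_iff] at hq1
  have hreg : regret P Q k u = max 0 (score u (P p) - score u (P q)) / score u (P p) := by
    rw [regret, hp, hq]
  rw [← hp] at hp1 hp2
  rw [← hq] at hq1
  have hp0 : 0 < score u (P p) := by
    refine (score_nonneg hu (hP p)).lt_of_ne fun h0 => ?_
    rw [hreg, ← h0, div_zero] at hlt
    exact absurd hlt (not_lt.2 hρ)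
  rw [hreg, lt_div_iff₀ hp0, lt_max_iff] at hlt
  have hlt := hlt.resolve_left (not_lt.2 (mul_nonneg hρ hp0.le))
  obtain ⟨w₀, hw₀, hcell₀, hc₀, hext⟩ := exists_extreme hs (P q - (1 - ρ) • P p) hu (by
    rw [score_sub_right, score_smul_right]; linarith)
  obtain ⟨a, r, hr, hrw⟩ := exists_orthPref_eq hw₀ (by rintro rfl; simp [score] at hc₀) hext
  have hle := hle a
  rw [hrw] at hle
  set w := r • w₀ with hw_def
  have hw : ∀ j, 0 ≤ w j := fun j => mul_nonneg hr.le (hw₀ j)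
  have hc : score w (P q - (1 - ρ) • P p) < 0 := by
    rw [hw_def, score_smul]; exact mul_neg_of_pos_of_neg hr hc₀
  have hcell : InCell h u w := hcell₀.trans fun a => by
    rw [hw_def, score_smul]
    exact ⟨fun h => mul_nonneg hr.le h, fun h => mul_nonpos_of_nonneg_of_nonpos hr.le h⟩
  have hmono : ∀ i i', score u (P i) ≤ score u (P i') → score w (P i) ≤ score w (P i') := by
    intro i i' hii
    obtain ⟨a, ha⟩ := hd i' i
    have := (hcell a).1
    rw [ha, score_sub_right, score_sub_right] at this
    linarith [this (by linarith)]
  have hkw : kthScore P Finset.univ k w = score w (P p) := by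
    refine kthScore_eq hk hkc (lt_of_le_of_lt (Finset.card_le_card fun i hi => ?_) hp1)
      (hp2.trans (Finset.card_le_card fun i hi => ?_)) <;>
      rw [Finset.mem_filter] at hi ⊢
    · exact ⟨hi.1, not_le.1 fun h' => not_le.2 hi.2 (hmono _ _ h')⟩
    · exact ⟨hi.1, hmono _ _ hi.2⟩
  have hqw : kthScore P Q 1 w = score w (P q) :=
    kthScore_one_eq ⟨q, hqQ, rfl⟩ fun i hi => hmono _ _ (not_lt.1 (hq1 hi))
  have hwq := score_nonneg hw (hP q)
  rw [score_sub_right, score_smul_right] at hc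
  have hwp : 0 < score w (P p) := by
    refine (score_nonneg hw (hP p)).lt_of_ne fun h0 => ?_
    rw [← h0] at hc
    linarith
  rw [regret, hkw, hqw, div_le_iff₀ hwp, max_le_iff] at hle
  linarith [hle.2]

/-! ### Straight-line evaluation of polynomials -/

/-- Entry `j` of the row `l`, the difference of the vectors at the addresses in index registers
`60 + 2 * l` and `61 + 2 * l`. -/
def rowEntry (s : State ℝ) (l j : ℕ) : ℝ :=
  s.vmem (s.ireg (60 + 2 * l) + j) - s.vmem (s.ireg (61 + 2 * l) + j)

/-- Put an entry of a row into value register `t`. -/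
def rowProg (l j t : ℕ) : Cmd :=
  block [.prim (.iconst 41 j), .prim (.iadd 42 41 (60 + 2 * l)), .prim (.vload t 42),
    .prim (.iadd 42 41 (61 + 2 * l)), .prim (.vload (t + 1) 42), .prim (.vop .sub t t (t + 1))]

theorem rowProg_runs {V : ℝ} {s : State ℝ} (l j t : ℕ) :
    Runs V (rowProg l j t) s fun s' T => T = 6 ∧ s'.vreg t = rowEntry s l j := by
  simp only [rowProg, block, runs_seq, runs_prim, Instr.Ok, Instr.step, true_and, runs_skip]
  have h1 : 60 + 2 * l ≠ 41 := by omega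
  have h2 : 61 + 2 * l ≠ 41 := by omega
  have h3 : 61 + 2 * l ≠ 42 := by omega
  simp [Op.eval, rowEntry, h1, h2, h3, add_comm j]

/-- The program only writes to index registers `41`, `42` and to value registers from `t` on. -/
structure IsLocal (t : ℕ) (c : Cmd) : Prop where
  ireg : ∀ r, r ≠ 41 → r ≠ 42 → c.KeepsI r
  vreg : ∀ r < t, c.KeepsV r
  imem : c.KeepsIM
  vmem : c.KeepsVM

theorem IsLocal.mono {t t' : ℕ} {c : Cmd} (h : IsLocal t c) (ht : t' ≤ t) : IsLocal t' c :=
  ⟨h.ireg, fun r hr => h.vreg r (hr.trans_le ht), h.imem, h.vmem⟩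

theorem anyInstr_seq {f : Instr → Bool} {a b : Cmd} :
    (Cmd.seq a b).anyInstr f = false ↔ a.anyInstr f = false ∧ b.anyInstr f = false := by
  simp [Cmd.anyInstr]

theorem IsLocal.seq {t : ℕ} {a b : Cmd} (ha : IsLocal t a) (hb : IsLocal t b) :
    IsLocal t (.seq a b) where
  ireg r h h' := anyInstr_seq.2 ⟨ha.ireg r h h', hb.ireg r h h'⟩
  vreg r h := anyInstr_seq.2 ⟨ha.vreg r h, hb.vreg r h⟩
  imem := anyInstr_seq.2 ⟨ha.imem, hb.imem⟩
  vmem := anyInstr_seq.2 ⟨ha.vmem, hb.vmem⟩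

theorem IsLocal.vop (o : Op) {t x y z : ℕ} (hx : t ≤ x) : IsLocal t (.prim (.vop o x y z)) where
  ireg _ _ _ := rfl
  vreg r hr := by simp [Cmd.KeepsV, Cmd.anyInstr, Instr.wv]; omega
  imem := rfl
  vmem := rfl

theorem isLocal_rowProg (l j t : ℕ) : IsLocal t (rowProg l j t) where
  ireg r h h' := by
    simp [Cmd.KeepsI, Cmd.anyInstr, Instr.wi, rowProg, block]; omega
  vreg r hr := by simp [Cmd.KeepsV, Cmd.anyInstr, Instr.wv, rowProg, block]; omega
  imem := rfl
  vmem := rfl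

theorem IsLocal.rowEntry_eq {t : ℕ} {c : Cmd} (h : IsLocal t c) {s s' : State ℝ}
    (hf : Frame c s s') : rowEntry s' = rowEntry s := by
  funext l j
  rw [rowEntry, rowEntry, hf.vmem h.vmem, hf.ireg _ (h.ireg _ (by omega) (by omega)),
    hf.ireg _ (h.ireg _ (by omega) (by omega))]

theorem natCast_mul_pow_le {W : ℝ} (hW : 1 ≤ W) {a b : ℕ} (h : a ≤ b) :
    (a : ℝ) * W ^ a ≤ b * W ^ b := by
  have : (0 : ℝ) ≤ W ^ a := by positivity
  exact mul_le_mul (by exact_mod_cast h) (pow_le_pow_right₀ hW h) this (by positivity)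

theorem exists_polyProg {D : ℕ} (p : MvPolynomial (Fin D × Fin (D + 1)) ℤ) :
    ∃ C : ℕ, ∀ t, ∃ c, IsLocal t c ∧ ∀ (s : State ℝ) (V W : ℝ), 1 ≤ W →
      (∀ l : Fin D, ∀ j : Fin (D + 1), |rowEntry s l j| ≤ W) → C * W ^ C ≤ V →
      Runs V c s fun s' T => T ≤ C ∧
        s'.vreg t = MvPolynomial.aeval (fun x => rowEntry s x.1 x.2) p ∧
        |s'.vreg t| ≤ C * W ^ C := by
  induction p using MvPolynomial.induction_on with
  | C a =>
    refine ⟨a.natAbs + 1, fun t => ⟨.prim (.vconst t a), ⟨fun _ _ _ => rfl, fun r hr => ?_, rfl, rfl⟩,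
      fun s V W hW _ _ => ?_⟩⟩
    · simp [Cmd.KeepsV, Cmd.anyInstr, Instr.wv]; omega
    · have h1 : (|a| : ℝ) ≤ ((a.natAbs + 1 : ℕ) : ℝ) := by
        push_cast
        rw [Nat.cast_natAbs, Int.cast_abs]
        linarith
      have h2 : (1 : ℝ) ≤ W ^ (a.natAbs + 1) := one_le_pow₀ hW
      simp only [runs_prim, Instr.Ok, Instr.step, true_and, Function.update_self]
      refine ⟨by omega, by simp, h1.trans (le_mul_of_one_le_right (by positivity) h2)⟩
  | add p q ihp ihq =>
    obtain ⟨Cp, hp⟩ := ihp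
    obtain ⟨Cq, hq⟩ := ihq
    refine ⟨Cp + Cq + 1, fun t => ?_⟩
    obtain ⟨cp, hlp, hp⟩ := hp t
    obtain ⟨cq, hlq, hq⟩ := hq (t + 1)
    refine ⟨.seq cp (.seq cq (.prim (.vop .add t t (t + 1)))),
      hlp.seq ((hlq.mono (by omega)).seq (.vop _ le_rfl)), fun s V W hW hrow hV => ?_⟩
    refine (hp s V W hW hrow ((natCast_mul_pow_le hW (by omega)).trans hV)).bind ?_
    rintro s₁ T₁ ⟨hT₁, hv₁, hb₁⟩ hf₁
    have hr := hlp.rowEntry_eq hf₁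
    refine (hq s₁ V W hW (by rwa [hr]) ((natCast_mul_pow_le hW (by omega)).trans hV)).bind ?_
    rintro s₂ T₂ ⟨hT₂, hv₂, hb₂⟩ hf₂
    have ht := hf₂.vreg t (hlq.vreg t (by omega))
    simp only [runs_prim, Instr.Ok, Instr.step, true_and, Function.update_self, Op.eval, ht]
    refine ⟨by omega, by rw [hv₁, hv₂, hr, map_add], ?_⟩
    have h3 : (Cp : ℝ) * W ^ Cp ≤ Cp * W ^ (Cp + Cq + 1) :=
      mul_le_mul_of_nonneg_left (pow_le_pow_right₀ hW (by omega)) (by positivity)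
    have h4 : (Cq : ℝ) * W ^ Cq ≤ Cq * W ^ (Cp + Cq + 1) :=
      mul_le_mul_of_nonneg_left (pow_le_pow_right₀ hW (by omega)) (by positivity)
    have h5 : (0 : ℝ) ≤ W ^ (Cp + Cq + 1) := by positivity
    have := abs_add_le (s₁.vreg t) (s₂.vreg (t + 1))
    push_cast
    linarith
  | mul_X p x ihp =>
    obtain ⟨Cp, hp⟩ := ihp
    refine ⟨Cp + 7, fun t => ?_⟩
    obtain ⟨cp, hlp, hp⟩ := hp t
    refine ⟨.seq cp (.seq (rowProg x.1 x.2 (t + 1)) (.prim (.vop .mul t t (t + 1)))),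
      hlp.seq (((isLocal_rowProg _ _ _).mono (by omega)).seq (.vop _ le_rfl)),
      fun s V W hW hrow hV => ?_⟩
    refine (hp s V W hW hrow ((natCast_mul_pow_le hW (by omega)).trans hV)).bind ?_
    rintro s₁ T₁ ⟨hT₁, hv₁, hb₁⟩ hf₁
    have hr := hlp.rowEntry_eq hf₁
    refine (rowProg_runs (x.1 : ℕ) (x.2 : ℕ) (t + 1)).bind ?_
    rintro s₂ T₂ ⟨hT₂, hv₂⟩ hf₂
    have ht := hf₂.vreg t ((isLocal_rowProg _ _ _).vreg t (by omega))
    have hb : |s₁.vreg t * s₂.vreg (t + 1)| ≤ ((Cp + 7 : ℕ) : ℝ) * W ^ (Cp + 7) := by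
      rw [abs_mul, hv₂, hr]
      calc |s₁.vreg t| * |rowEntry s x.1 x.2| ≤ Cp * W ^ Cp * W :=
            mul_le_mul hb₁ (hrow _ _) (abs_nonneg _) (by positivity)
        _ = Cp * W ^ (Cp + 1) := by ring
        _ ≤ ((Cp + 7 : ℕ) : ℝ) * W ^ (Cp + 7) :=
            mul_le_mul (by push_cast; linarith) (pow_le_pow_right₀ hW (by omega)) (by positivity)
              (by positivity)
    simp only [runs_prim, Instr.Ok, Instr.step, Function.update_self, Op.eval, ht]
    refine ⟨hb.trans hV, by omega, by rw [hv₁, hv₂, hr, map_mul, MvPolynomial.aeval_X], hb⟩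

theorem exists_prefProg {D : ℕ} (p : ℕ → MvPolynomial (Fin D × Fin (D + 1)) ℤ) (m : ℕ) :
    ∃ (C : ℕ) (c : Cmd), (∀ r, r ≠ 40 → r ≠ 41 → r ≠ 42 → c.KeepsI r) ∧
      (∀ r < 29, c.KeepsV r) ∧ c.KeepsIM ∧ ∀ (s : State ℝ) (V W : ℝ), 1 ≤ W →
      (∀ l : Fin D, ∀ j : Fin (D + 1), |rowEntry s l j| ≤ W) → C * W ^ C ≤ V →
      (∀ l : Fin D, s.ireg (60 + 2 * l) + D < s.ireg 4 ∧ s.ireg (61 + 2 * l) + D < s.ireg 4) →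
      Runs V c s fun s' T => T ≤ C ∧
        (∀ j < m, s'.vmem (s.ireg 4 + j) =
          |MvPolynomial.aeval (fun x => rowEntry s x.1 x.2) (p j)| ∧
          s'.vmem (s.ireg 4 + j) ≤ C * W ^ C) ∧
        ∀ a, a < s.ireg 4 ∨ s.ireg 4 + m ≤ a → s'.vmem a = s.vmem a := by
  induction m with
  | zero =>
    exact ⟨0, .skip, fun _ _ _ _ => rfl, fun _ _ => rfl, rfl, fun s V W _ _ _ _ => by simp⟩
  | succ m ih =>
    obtain ⟨C, c, hi, hv, him, hc⟩ := ih
    obtain ⟨C', hC'⟩ := exists_polyProg (p m)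
    obtain ⟨c', hl, hc'⟩ := hC' 30
    refine ⟨C + C' + 10, .seq c (.seq c' (block [.prim (.vconst 29 0),
      .ite (.vlt 30 29) (.prim (.vop .sub 30 29 30)) .skip, .prim (.iconst 40 m),
      .prim (.iadd 40 4 40), .prim (.vstore 40 30)])), fun r h0 h1 h2 => ?_, fun r hr => ?_, ?_,
      fun s V W hW hrow hV hU => ?_⟩
    · refine anyInstr_seq.2 ⟨hi r h0 h1 h2, anyInstr_seq.2 ⟨hl.ireg r h1 h2, ?_⟩⟩
      simp [Cmd.anyInstr, block, Instr.wi, Ne.symm h0]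
    · refine anyInstr_seq.2 ⟨hv r hr, anyInstr_seq.2 ⟨hl.vreg r (by omega), ?_⟩⟩
      simp [Cmd.anyInstr, block, Instr.wv]
      omega
    · exact anyInstr_seq.2 ⟨him, anyInstr_seq.2 ⟨hl.imem, rfl⟩⟩
    refine (hc s V W hW hrow ((natCast_mul_pow_le hW (by omega)).trans hV) hU).bind ?_
    rintro s₁ T₁ ⟨hT₁, hu₁, hm₁⟩ hf₁
    have e4 := hf₁.ireg 4 (hi 4 (by omega) (by omega) (by omega))
    have hr : ∀ (l : Fin D) (j : Fin (D + 1)), rowEntry s₁ l j = rowEntry s l j := fun l j => by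
      have := hU l
      rw [rowEntry, rowEntry, hf₁.ireg _ (hi _ (by omega) (by omega) (by omega)),
        hf₁.ireg _ (hi _ (by omega) (by omega) (by omega)), hm₁ _ (by omega), hm₁ _ (by omega)]
    refine (hc' s₁ V W hW (by simpa only [hr] using hrow)
      ((natCast_mul_pow_le hW (by omega)).trans hV)).bind ?_
    rintro s₂ T₂ ⟨hT₂, hv₂, hb₂⟩ hf₂
    simp only [hr] at hv₂
    rw [hv₂] at hb₂
    have f4 := (hf₂.ireg 4 (hl.ireg 4 (by omega) (by omega))).trans e4
    have fm := hf₂.vmem hl.vmem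
    have hb : |MvPolynomial.aeval (fun x => rowEntry s x.1 x.2) (p m)| ≤
        ((C + C' + 10 : ℕ) : ℝ) * W ^ (C + C' + 10) :=
      hb₂.trans (natCast_mul_pow_le hW (by omega))
    have key : ∀ v, v = |MvPolynomial.aeval (fun x => rowEntry s x.1 x.2) (p m)| →
        (∀ j < m + 1, Function.update s₁.vmem (s.ireg 4 + m) v (s.ireg 4 + j) =
          |MvPolynomial.aeval (fun x => rowEntry s x.1 x.2) (p j)| ∧
          Function.update s₁.vmem (s.ireg 4 + m) v (s.ireg 4 + j) ≤
            ((C + C' + 10 : ℕ) : ℝ) * W ^ (C + C' + 10)) ∧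
        ∀ a, a < s.ireg 4 ∨ s.ireg 4 + (m + 1) ≤ a →
          Function.update s₁.vmem (s.ireg 4 + m) v a = s.vmem a := by
      intro v hv
      refine ⟨fun j hj => ?_, fun a ha => ?_⟩
      · rcases Nat.lt_succ_iff_lt_or_eq.1 hj with h | rfl
        · rw [Function.update_of_ne (by omega)]
          exact ⟨(hu₁ j h).1, (hu₁ j h).2.trans (natCast_mul_pow_le hW (by omega))⟩
        · rw [Function.update_self]
          exact ⟨hv, hv ▸ hb⟩
      · rw [Function.update_of_ne (by omega), hm₁ a (by omega)]
    simp only [runs_seq, runs_prim, Instr.Ok, Instr.step, true_and, runs_ite, Test.holds, block,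
      Function.update_self, Function.update_of_ne, ne_eq, Nat.reduceEqDiff, not_false_eq_true,
      runs_skip, Op.eval, f4, fm, hv₂, Int.cast_zero, zero_sub]
    refine ⟨fun h => ⟨by omega, key _ (abs_of_neg h).symm⟩, fun h => ⟨by omega, ?_⟩⟩
    exact key _ (abs_of_nonneg (not_lt.1 h)).symm

/-! ### Nested loops -/

/-- `m` nested loops with the counters in index registers `60, …, 60 + m - 1`, all of which run up
to the bound in index register `3`. -/
def nest (body : Cmd) : ℕ → Cmd
  | 0 => body
  | m + 1 => .seq (.prim (.iconst (60 + m) 0)) (.while (.ilt (60 + m) 3)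
      (.seq (nest body m) (.prim (.iadd (60 + m) (60 + m) 2))))

/-- A bound for the running time of `m` nested loops. -/
def nestTime (N T : ℕ) : ℕ → ℕ
  | 0 => T
  | m + 1 => N * (nestTime N T m + 2) + 2

theorem keepsI_nest {body : Cmd} (m : ℕ) {r : ℕ} (hb : body.KeepsI r)
    (hr : r < 60 ∨ 60 + m ≤ r) : (nest body m).KeepsI r := by
  induction m with
  | zero => exact hb
  | succ m ih =>
    refine anyInstr_seq.2 ⟨?_, anyInstr_seq.2 ⟨ih (by omega), ?_⟩⟩ <;>
      simp [Cmd.anyInstr, Instr.wi] <;> omega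

theorem nest_runs {V : ℝ} {body : Cmd} {m₀ N T : ℕ} {J : State ℝ → Prop} {β : State ℝ → ℝ}
    {val : (ℕ → ℕ) → ℝ}
    (hJ : ∀ s, J s → s.ireg 2 = 1 ∧ s.ireg 3 = N)
    (hJu : ∀ s i x, J s → J { s with ireg := Function.update s.ireg (60 + i) x })
    (hβ : ∀ s i x, β { s with ireg := Function.update s.ireg (60 + i) x } = β s)
    (hkeep : ∀ i, body.KeepsI (60 + i))
    (hbody : ∀ s, J s → (∀ i < m₀, s.ireg (60 + i) < N) → Runs V body s fun s' t => t ≤ T ∧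
      J s' ∧ β s ≤ β s' ∧ val (fun i => s.ireg (60 + i)) ≤ β s') :
    ∀ m, m ≤ m₀ → ∀ s, J s → (∀ i, m ≤ i → i < m₀ → s.ireg (60 + i) < N) →
      Runs V (nest body m) s fun s' t => t ≤ nestTime N T m ∧ J s' ∧ β s ≤ β s' ∧
        ∀ τ : ℕ → ℕ, (∀ i, m ≤ i → τ i = s.ireg (60 + i)) → (∀ i < m, τ i < N) →
          val τ ≤ β s' := by
  intro m
  induction m with
  | zero =>
    intro _ s hs hi
    refine (hbody s hs fun i h => hi i (Nat.zero_le _) h).mono ?_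
    rintro s' t ⟨h1, h2, h3, h4⟩
    refine ⟨h1, h2, h3, fun τ hτ _ => ?_⟩
    rwa [show τ = fun i => s.ireg (60 + i) from funext fun i => hτ i (Nat.zero_le _)]
  | succ m ih =>
    intro hm s hs hi
    rw [nest, runs_seq, runs_prim]
    refine ⟨trivial, ?_⟩
    simp only [Instr.step]
    refine (Runs.while_count (fun c s' => s'.ireg (60 + m) = c ∧ J s' ∧ β s ≤ β s' ∧
      ∀ τ : ℕ → ℕ, (∀ i, m + 1 ≤ i → τ i = s.ireg (60 + i)) → (∀ i < m, τ i < N) → τ m < c →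
        val τ ≤ β s') N (nestTime N T m + 1)
      ⟨by simp, hJu s m 0 hs, (hβ s m 0).ge, fun τ _ _ h => absurd h (Nat.not_lt_zero _)⟩
      ?_ ?_).mono ?_
    · rintro c s' hc hf ⟨hcount, hJ', hle, hcov⟩
      have hout : ∀ i, m + 1 ≤ i → s'.ireg (60 + i) = s.ireg (60 + i) := fun i h =>
        (hf.ireg (60 + i) (anyInstr_seq.2 ⟨keepsI_nest m (hkeep i) (.inr (by omega)), by
          simp [Cmd.anyInstr, Instr.wi]; omega⟩)).trans (Function.update_of_ne (by omega) _ _)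
      clear hf
      refine ⟨by simp [Test.holds, hcount, (hJ _ hJ').2, hc], ?_⟩
      refine (ih (by omega) s' hJ' fun i h h' => ?_).bind ?_
      · rcases h.eq_or_lt with rfl | h
        · rwa [hcount]
        · rw [hout i h]; exact hi i h h'
      rintro s₁ t₁ ⟨ht₁, hJ₁, hle₁, hcov₁⟩ hf₁
      have e := hf₁.ireg (60 + m) (keepsI_nest m (hkeep m) (.inr le_rfl))
      rw [runs_prim]
      simp only [Instr.Ok, Instr.step, true_and, Function.update_self]
      refine ⟨by omega, by rw [e, hcount, (hJ _ hJ₁).1], hJu _ _ _ hJ₁, ?_, fun τ h1 h2 h3 => ?_⟩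
      · rw [hβ]; exact hle.trans hle₁
      · rw [hβ]
        rcases Nat.lt_succ_iff_lt_or_eq.1 h3 with h | h
        · exact (hcov τ h1 h2 h).trans hle₁
        · refine hcov₁ τ (fun i hi' => ?_) h2
          rcases hi'.eq_or_lt with rfl | hi'
          · rw [h, hcount]
          · rw [h1 i hi', hout i hi']
    · rintro s' _ ⟨hcount, hJ', -⟩
      simp [Test.holds, hcount, (hJ _ hJ').2]
    · rintro s' t ⟨ht, -, hJ', hle, hcov⟩
      have ht' : t ≤ N * (nestTime N T m + 2) + 1 := ht
      refine ⟨by rw [nestTime]; omega, hJ', hle, fun τ h1 h2 =>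
        hcov τ h1 (fun i h => h2 i (by omega)) (h2 m (by omega))⟩

theorem exists_nestTime_le (a b m : ℕ) :
    ∃ C, ∀ n N T, 1 ≤ n → N ≤ a * n → T ≤ b * n → nestTime N T m ≤ C * n ^ (m + 1) := by
  induction m with
  | zero => exact ⟨b, fun n N T _ _ hT => by simpa [nestTime] using hT⟩
  | succ m ih =>
    obtain ⟨C, hC⟩ := ih
    refine ⟨a * (C + 2) + 2, fun n N T hn hN hT => ?_⟩
    have h1 : 1 ≤ n ^ (m + 1) := Nat.one_le_pow _ _ hn
    have h2 : 1 ≤ n ^ (m + 1 + 1) := Nat.one_le_pow _ _ hn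
    calc N * (nestTime N T m + 2) + 2 ≤ (a * n) * (C * n ^ (m + 1) + 2 * n ^ (m + 1)) +
          2 * n ^ (m + 1 + 1) := by
          gcongr
          · exact hC n N T hn hN hT
          · omega
          · omega
      _ = (a * (C + 2) + 2) * n ^ (m + 1 + 1) := by ring

/-! ### The regret ratio -/

/-- The row given by two addresses. -/
noncomputable def windowRow {n d : ℕ} (P : Fin n → Fin d → ℝ) (a b : ℕ) : Fin d → ℝ :=
  fun j => pointMem P (a + j) - pointMem P (b + j)

theorem windowRow_points {n d : ℕ} (P : Fin n → Fin d → ℝ) (i i' : Fin n) :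
    windowRow P (i * d) (i' * d) = P i - P i' := by
  funext j
  rw [windowRow, pointMem_mul_add, pointMem_mul_add, Pi.sub_apply]

theorem windowRow_single {n d : ℕ} (P : Fin n → Fin d → ℝ) (j : Fin d) :
    windowRow P (n * d + d - j) (n * d) = Pi.single j 1 := by
  have := j.2
  funext j'
  have := j'.2
  rw [windowRow, pointMem, pointMem, dif_neg (by omega), dif_neg (by omega),
    if_neg (show ¬ n * d + (j' : ℕ) = n * d + d by omega), sub_zero, Pi.single_apply]
  by_cases h : j' = j
  · subst h
    rw [if_pos rfl, if_pos (by omega)]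
  · have : (j' : ℕ) ≠ j := fun h' => h (Fin.ext h')
    rw [if_neg h, if_neg (by omega)]

theorem pointMem_mem_Icc {n d : ℕ} {P : Fin n → Fin d → ℝ} {W : ℝ} (hW : 1 ≤ W)
    (hP : ∀ i j, 0 ≤ P i j) (hPW : ∀ i j, P i j ≤ W) (a : ℕ) :
    0 ≤ pointMem P a ∧ pointMem P a ≤ W := by
  rw [pointMem]
  split_ifs
  · exact ⟨hP _ _, hPW _ _⟩
  · exact ⟨zero_le_one, hW⟩
  · exact ⟨le_rfl, by linarith⟩

/-- The coordinates of `orthPref` as polynomials in the coordinates of the rows. -/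
noncomputable def orthPoly (D j : ℕ) : MvPolynomial (Fin D × Fin (D + 1)) ℤ :=
  if h : j < D + 1 then
    (Matrix.of (Fin.cons 0 fun l j' => MvPolynomial.X (l, j') :
      Fin (D + 1) → Fin (D + 1) → MvPolynomial (Fin D × Fin (D + 1)) ℤ)).adjugate ⟨j, h⟩ 0
  else 0

theorem abs_aeval_orthPoly {D : ℕ} (M : Fin D → Fin (D + 1) → ℝ) (j : Fin (D + 1)) :
    |MvPolynomial.aeval (fun x => M x.1 x.2) (orthPoly D j)| = orthPref M j := by
  rw [orthPoly, dif_pos j.2, orthPref]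
  congr 1
  set f := MvPolynomial.aeval (R := ℤ) (fun x : Fin D × Fin (D + 1) => M x.1 x.2) with hf
  set A : Matrix (Fin (D + 1)) (Fin (D + 1)) (MvPolynomial (Fin D × Fin (D + 1)) ℤ) :=
    Matrix.of (Fin.cons 0 fun l j' => MvPolynomial.X (l, j')) with hA
  have h := congrFun (congrFun (AlgHom.map_adjugate f A) j) 0
  have hmap : f.mapMatrix A = Matrix.of (Fin.cons 0 M) := by
    ext i j'
    refine Fin.cases ?_ (fun l => ?_) i
    · simp [hA]
    · simp [hA, hf]
  rw [hmap] at h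
  exact h

theorem keepsI_evalProg {r : ℕ} (hr : 43 ≤ r) : evalProg.KeepsI r := by
  simp [Cmd.KeepsI, Cmd.anyInstr, evalProg, block, scoresProg, dotProg, selectProg, selectBody,
    bruteProg, countProg, mediansProg, groupProg, partitionProg, filterProg, Instr.wi]
  omega

/-- The program for one choice of rows. -/
theorem exists_bodyProg (D : ℕ) : ∃ (C : ℕ) (c : Cmd), 1 ≤ C ∧ (∀ r, 43 ≤ r → c.KeepsI r) ∧
    ∀ {n k : ℕ} {P : Fin n → Fin (D + 1) → ℝ} {Q : Finset (Fin n)} {V W : ℝ} {s : State ℝ},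
      1 ≤ k → k ≤ n → (∀ i j, 0 ≤ P i j) → Q.Nonempty → 1 ≤ W → (∀ i j, P i j ≤ W) →
      (C * W ^ C) * (C * W ^ C) ≤ V → Env P Q k s → Best P Q k (C * W ^ C) s →
      (∀ i < 2 * D, s.ireg (60 + i) < n * (D + 1) + (D + 1) + 1) →
      Runs V c s fun s' t => t ≤ C * n ∧ (Env P Q k s' ∧ Best P Q k (C * W ^ C) s') ∧
        s.vreg 0 / s.vreg 1 ≤ s'.vreg 0 / s'.vreg 1 ∧
        regret P Q k (orthPref fun l : Fin D =>
          windowRow P (s.ireg (60 + 2 * l)) (s.ireg (61 + 2 * l))) ≤ s'.vreg 0 / s'.vreg 1 := by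
  obtain ⟨C, c, hi, hv, him, hc⟩ := exists_prefProg (orthPoly D) (D + 1)
  obtain ⟨C', hC'⟩ : ∃ C', C' = (D + 1) * C + C + 8 * (D + 1) + 1540 := ⟨_, rfl⟩
  refine ⟨C', .seq c evalProg, by omega, fun r hr => anyInstr_seq.2
    ⟨hi r (by omega) (by omega) (by omega), keepsI_evalProg hr⟩, ?_⟩
  intro n k P Q V W s hk hkn hP hQ hW hPW hV hE hB hreg
  have hn : 1 ≤ n := hk.trans hkn
  have hWC : (1 : ℝ) ≤ W ^ C' := one_le_pow₀ hW
  have hX : (1 : ℝ) ≤ C' * W ^ C' := by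
    have : (1 : ℝ) ≤ C' := by exact_mod_cast (by omega : 1 ≤ C')
    nlinarith
  have hmem : ∀ l : Fin D, ∀ j : Fin (D + 1), rowEntry s l j =
      windowRow P (s.ireg (60 + 2 * l)) (s.ireg (61 + 2 * l)) j := fun l j => by
    have h1 := hreg (2 * l) (by omega)
    have h2 := hreg (2 * l + 1) (by omega)
    rw [show 60 + (2 * (l : ℕ) + 1) = 61 + 2 * l by ring] at h2
    rw [rowEntry, windowRow, hE.points _ (by omega), hE.points _ (by omega)]
  refine (hc s V W hW (fun l j => ?_) ?_ fun l => ?_).bind ?_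
  · rw [hmem, windowRow]
    have h1 := pointMem_mem_Icc hW hP hPW (s.ireg (60 + 2 * l) + j)
    have h2 := pointMem_mem_Icc hW hP hPW (s.ireg (61 + 2 * l) + j)
    exact abs_sub_le_iff.2 ⟨by linarith, by linarith⟩
  · have := natCast_mul_pow_le hW (show C ≤ C' by omega)
    nlinarith
  · have h1 := hreg (2 * l) (by omega)
    have h2 := hreg (2 * l + 1) (by omega)
    rw [show 60 + (2 * (l : ℕ) + 1) = 61 + 2 * l by ring] at h2
    rw [hE.pref]
    omega
  rintro s₁ t₁ ⟨ht₁, hu, hold⟩ hf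
  rw [hE.pref] at hu hold
  have hkeep : ∀ r < 40, s₁.ireg r = s.ireg r := fun r hr =>
    hf.ireg r (hi r (by omega) (by omega) (by omega))
  have hE₁ : Env P Q k s₁ :=
    ⟨(hkeep 0 (by omega)).trans hE.size, (hkeep 1 (by omega)).trans hE.rank,
      (hkeep 2 (by omega)).trans hE.one, (hkeep 3 (by omega)).trans hE.rows,
      (hkeep 4 (by omega)).trans hE.pref, (hkeep 5 (by omega)).trans hE.scores,
      (hkeep 6 (by omega)).trans hE.dim, (hkeep 7 (by omega)).trans hE.zero,
      by rw [hf.imem him]; exact hE.mem_Q, fun a ha => by rw [hold a (.inl ha), hE.points a ha]⟩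
  have v0 := hf.vreg 0 (hv 0 (by omega))
  have v1 := hf.vreg 1 (hv 1 (by omega))
  have hB₁ : Best P Q k (C' * W ^ C') s₁ := by
    obtain ⟨b1, b2, b3, b4, b5⟩ := hB
    constructor <;> simpa only [v0, v1]
  set u : Fin (D + 1) → ℝ := orthPref fun l : Fin D =>
    windowRow P (s.ireg (60 + 2 * l)) (s.ireg (61 + 2 * l)) with hu_def
  have hu₁ : ∀ j : Fin (D + 1), s₁.vmem (n * (D + 1) + 2 * (D + 1) + 1 + j) = u j := fun j => by
    rw [(hu j j.2).1]
    simp only [hmem]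
    exact abs_aeval_orthPoly (fun l : Fin D =>
      windowRow P (s.ireg (60 + 2 * l)) (s.ireg (61 + 2 * l))) j
  have hu0 : ∀ j, 0 ≤ u j := fun j => abs_nonneg _
  have huC : ∀ j, u j ≤ C * W ^ C := fun j => by rw [← hu₁]; exact (hu j j.2).2
  refine (evalProg_runs hk hkn hP hQ hE₁ hB₁ hu₁ hu0 hX hV fun i => ?_).mono ?_
  · calc score u (P i) ≤ ∑ _j : Fin (D + 1), (C * W ^ C) * W :=
          Finset.sum_le_sum fun j _ =>
            mul_le_mul (huC j) (hPW i j) (hP i j) (by positivity)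
      _ = ((D + 1 : ℕ) * C : ℝ) * W ^ (C + 1) := by
          rw [Finset.sum_const, Finset.card_univ, Fintype.card_fin, nsmul_eq_mul]; ring
      _ ≤ C' * W ^ C' := by
          refine mul_le_mul ?_ (pow_le_pow_right₀ hW (by omega)) (by positivity) (by positivity)
          rw [← Nat.cast_mul]
          exact Nat.cast_le.2 (by omega)
  · rintro s₂ t₂ ⟨ht₂, hE₂, hB₂, h1, h2⟩
    rw [v0, v1] at h2
    refine ⟨?_, ⟨hE₂, hB₂⟩, h2, h1⟩
    have h3 : C ≤ C * n := Nat.le_mul_of_pos_right _ hn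
    have h4 : C' * n = (D + 1) * C * n + C * n + (8 * (D + 1) + 1540) * n := by rw [hC']; ring
    omega

/-- Put the product of index registers `0` and `6` into index register `9`. -/
def mulProg : Cmd :=
  block [.prim (.iconst 9 0), .prim (.iconst 36 0),
    .while (.ilt 36 6) (block [.prim (.iadd 9 9 0), .prim (.iadd 36 36 2)])]

theorem mulProg_runs {V : ℝ} {s : State ℝ} (h2 : s.ireg 2 = 1) :
    Runs V mulProg s fun s' t => t ≤ 3 * s.ireg 6 + 3 ∧
      s'.ireg 9 = s.ireg 0 * s.ireg 6 := by
  simp only [mulProg, block, runs_seq, runs_prim, Instr.Ok, Instr.step, true_and, runs_skip]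
  refine (Runs.while_count (fun i s' => s'.ireg 36 = i ∧ s'.ireg 9 = s.ireg 0 * i) (s.ireg 6) 2
    (by simp) ?_ ?_).mono ?_
  · rintro i s' hi hf ⟨h36, h9⟩
    have e0 := hf.ireg 0 rfl
    have e2 := hf.ireg 2 rfl
    have e6 := hf.ireg 6 rfl
    simp [h2] at e0 e2 e6
    simp [Test.holds, Instr.Ok, Instr.step, h36, h9, e0, e2, e6, hi, mul_add]
  · rintro s' hf ⟨h36, -⟩
    have e6 := hf.ireg 6 rfl
    simp at e6
    simp [Test.holds, *]
  · rintro s' t ⟨ht, -, h9⟩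
    exact ⟨by omega, h9⟩

/-- Set up the registers for the computation of the regret ratio in dimension `d`. -/
def initProg (d : ℕ) : Cmd :=
  block [.prim (.iconst 2 1), .prim (.iconst 7 0), .prim (.iconst 6 d), mulProg,
    .prim (.iadd 35 9 6), .prim (.vconst 1 1), .prim (.vstore 35 1), .prim (.iadd 3 35 2),
    .prim (.iadd 4 3 6), .prim (.iadd 5 4 6), .prim (.vconst 0 0)]

theorem zero_mem_regrets {n d k : ℕ} (P : Fin n → Fin d → ℝ) (Q : Finset (Fin n)) (hk : 1 ≤ k)
    (hkn : k ≤ n) : (0 : ℝ) ∈ regrets P Q k := by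
  refine ⟨0, fun _ => le_rfl, ?_⟩
  obtain ⟨⟨i, -, hi⟩, -⟩ := kthScore_spec P Finset.univ k 0 hk (by simpa using hkn)
  rw [regret, ← hi]
  simp [score]

theorem initProg_runs {V X : ℝ} {n d k : ℕ} {P : Fin n → Fin d → ℝ} {Q : Finset (Fin n)}
    {s : State ℝ} (hk : 1 ≤ k) (hkn : k ≤ n) (hX : 1 ≤ X) (h0 : s.ireg 0 = n) (h1 : s.ireg 1 = k)
    (hQ : ∀ i : Fin n, 0 < s.imem i ↔ i ∈ Q)
    (hP : ∀ a < n * d + 2 * d + 1, s.vmem a =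
      if h : a < n * d then P (Fin.divNat ⟨a, h⟩) (Fin.modNat ⟨a, h⟩) else 0) :
    Runs V (initProg d) s fun s' t => t ≤ 3 * d + 20 ∧ Env P Q k s' ∧ Best P Q k X s' := by
  simp only [initProg, block, runs_seq, runs_prim, Instr.Ok, Instr.step, true_and]
  refine (mulProg_runs (by simp)).frame.mono ?_
  rintro s₁ t₁ ⟨⟨ht₁, h9⟩, hf⟩
  have e0 := hf.ireg 0 rfl
  have e1 := hf.ireg 1 rfl
  have e2 := hf.ireg 2 rfl
  have e6 := hf.ireg 6 rfl
  have e7 := hf.ireg 7 rfl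
  have ei := hf.imem rfl
  have em := hf.vmem rfl
  simp [h0, h1] at e0 e1 e2 e6 e7 ei em h9 ht₁
  clear hf
  simp only [runs_skip, Function.update_self, Function.update_of_ne, ne_eq, Nat.reduceEqDiff,
    not_false_eq_true, e6, h9, em, e2]
  refine ⟨by omega, ⟨?_, ?_, ?_, ?_, ?_, ?_, ?_, ?_, ?_, ?_⟩, ⟨?_, ?_, ?_, ?_, ?_⟩⟩
  · simp [e0]
  · simp [e1]
  · simp [e2]
  · simp
  · simp; ring
  · simp; ring
  · simp [e6]
  · simp [e7]
  · simpa [ei] using hQ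
  · intro a ha
    simp only [Function.update_apply]
    rw [hP a ha, pointMem]
    by_cases h : a < n * d
    · rw [dif_pos h, dif_pos h, if_neg (by omega)]
    · rw [dif_neg h, dif_neg h]
      simp
  · simp
  · simp; linarith
  · simp
  · simpa using hX
  · simpa using zero_mem_regrets P Q hk hkn

/-- The program for the regret ratio, without the final division. -/
theorem exists_regretProg (D : ℕ) : ∃ (C : ℕ) (c : Cmd), (∀ r, 43 ≤ r → r < 60 → c.KeepsI r) ∧
    ∀ {n k : ℕ} {P : Fin n → Fin (D + 1) → ℝ} {Q : Finset (Fin n)} {V W : ℝ} {s : State ℝ},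
      1 ≤ k → k ≤ n → (∀ i j, 0 ≤ P i j) → Q.Nonempty → 1 ≤ W → (∀ i j, P i j ≤ W) →
      (C * W ^ C) * (C * W ^ C) ≤ V → s.ireg 0 = n → s.ireg 1 = k →
      (∀ i : Fin n, 0 < s.imem i ↔ i ∈ Q) →
      (∀ a < n * (D + 1) + 2 * (D + 1) + 1, s.vmem a = if h : a < n * (D + 1) then
        P (Fin.divNat ⟨a, h⟩) (Fin.modNat ⟨a, h⟩) else 0) →
      Runs V c s fun s' t => t ≤ C * n ^ (2 * D + 1) ∧ 0 ≤ s'.vreg 0 ∧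
        s'.vreg 0 ≤ C * W ^ C ∧ 0 < s'.vreg 1 ∧ s'.vreg 1 ≤ C * W ^ C ∧
        IsGreatest (regrets P Q k) (s'.vreg 0 / s'.vreg 1) := by
  obtain ⟨C₀, c, hC₀, hkeep, hc⟩ := exists_bodyProg D
  obtain ⟨C₁, hC₁⟩ := exists_nestTime_le (2 * D + 3) C₀ (2 * D)
  refine ⟨C₀ + C₁ + 3 * D + 23, .seq (initProg (D + 1)) (nest c (2 * D)), fun r h1 h2 =>
    anyInstr_seq.2 ⟨?_, keepsI_nest _ (hkeep r h1) (.inl h2)⟩, ?_⟩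
  · simp [Cmd.anyInstr, initProg, mulProg, block, Instr.wi]
    omega
  intro n k P Q V W s hk hkn hP hQ hW hPW hV h0 h1 hsQ hsP
  have hn : 1 ≤ n := hk.trans hkn
  have hCW := natCast_mul_pow_le hW (show C₀ ≤ C₀ + C₁ + 3 * D + 23 by omega)
  have hV₀ : (C₀ * W ^ C₀) * (C₀ * W ^ C₀) ≤ V :=
    (mul_le_mul hCW hCW (by positivity) (by positivity)).trans hV
  have hX : (1 : ℝ) ≤ C₀ * W ^ C₀ := by
    have h1 : (1 : ℝ) ≤ C₀ := by exact_mod_cast hC₀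
    have h2 : (1 : ℝ) ≤ W ^ C₀ := one_le_pow₀ hW
    nlinarith
  set N := n * (D + 1) + (D + 1) + 1 with hN
  have hNn : N ≤ (2 * D + 3) * n := by
    have h1 : D + 1 ≤ (D + 1) * n := Nat.le_mul_of_pos_right _ hn
    have h2 : (2 * D + 3) * n = n * (D + 1) + (D + 1) * n + n := by ring
    omega
  refine (initProg_runs hk hkn hX h0 h1 hsQ hsP).bind ?_
  rintro s₁ t₁ ⟨ht₁, hE, hB⟩ -
  refine (nest_runs (m₀ := 2 * D) (N := N) (T := C₀ * n)
    (J := fun s => Env P Q k s ∧ Best P Q k (C₀ * W ^ C₀) s)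
    (β := fun s => s.vreg 0 / s.vreg 1) (val := fun τ => regret P Q k (orthPref fun l : Fin D =>
      windowRow P (τ (2 * l)) (τ (2 * l + 1))))
    (fun s hs => ⟨hs.1.one, hs.1.rows⟩) ?_ (fun _ _ _ => rfl)
    (fun i => hkeep _ (by omega)) ?_ (2 * D) le_rfl s₁ ⟨hE, hB⟩
    (fun i h h' => absurd h (by omega))).mono ?_
  · rintro s i x ⟨⟨a0, a1, a2, a3, a4, a5, a6, a7, aQ, aP⟩, ⟨b1, b2, b3, b4, b5⟩⟩
    refine ⟨⟨?_, ?_, ?_, ?_, ?_, ?_, ?_, ?_, aQ, aP⟩, b1, b2, b3, b4, b5⟩ <;>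
      exact (Function.update_of_ne (by omega) _ _).trans (by assumption)
  · rintro s ⟨hE, hB⟩ hs
    refine (hc hk hkn hP hQ hW hPW hV₀ hE hB hs).mono ?_
    rintro s' t ⟨h1, h2, h3, h4⟩
    have e : ∀ l : Fin D, 60 + (2 * (l : ℕ) + 1) = 61 + 2 * l := fun l => by omega
    exact ⟨h1, h2, h3, by simpa only [e] using h4⟩
  · rintro s₂ t₂ ⟨ht₂, ⟨-, hB₂⟩, -, hcov⟩
    refine ⟨?_, hB₂.num_nonneg, hB₂.num_le.trans hCW, hB₂.den_pos, hB₂.den_le.trans hCW,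
      hB₂.attained, ?_⟩
    · have h1 := hC₁ n N (C₀ * n) hn hNn le_rfl
      have h2 : 1 ≤ n ^ (2 * D + 1) := Nat.one_le_pow _ _ hn
      have h3 : (C₀ + C₁ + 3 * D + 23) * n ^ (2 * D + 1) = C₁ * n ^ (2 * D + 1) +
          (C₀ + 3 * D + 23) * n ^ (2 * D + 1) := by ring
      have h4 := Nat.mul_le_mul_left (C₀ + 3 * D + 23) h2
      omega
    · rintro ρ ⟨u, hu, rfl⟩
      refine regret_le_of_orthPref (h := fun a : Fin N × Fin N => windowRow P a.1 a.2) hk hkn hP hQ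
        (fun j => ⟨(⟨n * (D + 1) + (D + 1) - j, by omega⟩, ⟨n * (D + 1), by omega⟩),
          windowRow_single P j⟩) (fun i i' => ?_)
        (div_nonneg hB₂.num_nonneg hB₂.den_pos.le) (fun a => ?_) hu
      · have h1 : (i : ℕ) * (D + 1) + 0 < n * (D + 1) := mul_add_lt i.2 D.succ_pos
        have h2 : (i' : ℕ) * (D + 1) + 0 < n * (D + 1) := mul_add_lt i'.2 D.succ_pos
        exact ⟨(⟨i * (D + 1), by omega⟩, ⟨i' * (D + 1), by omega⟩), windowRow_points P i i'⟩
      · have h := hcov (fun i => if h : i / 2 < D then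
            (if i % 2 = 0 then (a ⟨i / 2, h⟩).1 else (a ⟨i / 2, h⟩).2) else s₁.ireg (60 + i))
          (fun i hi => dif_neg (by omega)) (fun i hi => by
            rw [dif_pos (show i / 2 < D by omega)]
            split_ifs
            · exact (a _).1.2
            · exact (a _).2.2)
        have e1 : ∀ l : Fin D, 2 * (l : ℕ) / 2 = l := fun l => by omega
        have e2 : ∀ l : Fin D, (2 * (l : ℕ) + 1) / 2 = l := fun l => by omega
        have e3 : ∀ l : Fin D, (2 * (l : ℕ) + 1) % 2 = 1 := fun l => by omega
        simpa [e1, e2, e3] using h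

/-- The regret ratio is computed on the real RAM in time `O(n ^ (2 * d - 1))`. -/
theorem exists_realRAM_regretRatio (D : ℕ) : ∃ (prog : Cmd) (C : ℕ),
    ∀ (n k : ℕ) (P : Fin n → Fin (D + 1) → ℝ) (Q : Finset (Fin n)),
      1 ≤ k → k ≤ n → (∀ i j, 0 ≤ P i j) → Q.Nonempty →
        IsGreatest (regrets P Q k) (regretRatio P Q k) ∧
        ∃ (s : State ℝ) (t : ℕ), Exec (unitCost ℝ) prog (regretInput P Q k) s t ∧
          s.vreg 0 = regretRatio P Q k ∧ t ≤ C * n ^ (2 * D + 1) := by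
  obtain ⟨C, c, -, hc⟩ := exists_regretProg D
  refine ⟨.seq c (.prim (.vop .div 0 0 1)), C + 1, fun n k P Q hk hkn hP hQ => ?_⟩
  have hPW : ∀ i j, P i j ≤ 1 + ∑ i, ∑ j, P i j := fun i j => by
    have h1 := Finset.single_le_sum (fun j _ => hP i j) (Finset.mem_univ j)
    have h2 := Finset.single_le_sum (f := fun i => ∑ j, P i j)
      (fun i _ => Finset.sum_nonneg fun j _ => hP i j) (Finset.mem_univ i)
    linarith
  have hW : 1 ≤ 1 + ∑ i, ∑ j, P i j :=
    le_add_of_nonneg_right (Finset.sum_nonneg fun i _ => Finset.sum_nonneg fun j _ => hP i j)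
  obtain ⟨s, t, he, ht, -, -, -, -, hg⟩ := hc (s := regretInput P Q k) hk hkn hP hQ hW hPW le_rfl
    rfl rfl (fun i => by simp only [regretInput, dif_pos i.2]; split_ifs with h <;> simp [h])
    (fun a _ => rfl)
  have hr : regretRatio P Q k = s.vreg 0 / s.vreg 1 := hg.csSup_eq
  refine ⟨hr ▸ hg, _, _, .seq he.exec (.prim _ _), ?_, ?_⟩
  · simp [Instr.step, Op.eval, hr]
  · have : 1 ≤ n ^ (2 * D + 1) := Nat.one_le_pow _ _ (hk.trans hkn)
    rw [Instr.cost_unitCost, add_mul]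
    omega

/-! ### The verifier -/

/-- Set the flag in index register `50` to `0` unless the test succeeds. -/
def checkProg (b : Test) : Cmd := .ite b .skip (.prim (.iconst 50 0))

theorem checks_runs {V : ℝ} {s₀ : State ℝ} (l : List Test)
    (hl : ∀ b ∈ l, ∀ s : State ℝ, (∀ r ≠ 50, s.ireg r = s₀.ireg r) → (b.holds s ↔ b.holds s₀)) :
    ∀ s : State ℝ, (∀ r ≠ 50, s.ireg r = s₀.ireg r) →
      Runs V (block (l.map checkProg)) s fun s' t => t ≤ 2 * l.length ∧
        (∀ r ≠ 50, s'.ireg r = s₀.ireg r) ∧ s'.imem = s.imem ∧ s'.vreg = s.vreg ∧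
        s'.vmem = s.vmem ∧ ((∀ b ∈ l, b.holds s₀) → s'.ireg 50 = s.ireg 50) ∧
        ((¬ ∀ b ∈ l, b.holds s₀) → s.ireg 50 ≤ 1 → s'.ireg 50 = 0) ∧
        (s.ireg 50 = 0 → s'.ireg 50 = 0) := by
  induction l with
  | nil => intro s hs; simpa [block] using hs
  | cons b l ih =>
    intro s hs
    have hb := hl b (by simp) s hs
    have hl' : ∀ b ∈ l, ∀ s : State ℝ, (∀ r ≠ 50, s.ireg r = s₀.ireg r) →
      (b.holds s ↔ b.holds s₀) := fun b hb => hl b (by simp [hb])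
    simp only [List.map_cons, block, runs_seq, checkProg, runs_ite, runs_skip, runs_prim,
      Instr.Ok, true_and]
    refine ⟨fun h => (ih hl' s hs).mono ?_, fun h => (ih hl' _ fun r hr => ?_).mono ?_⟩
    · rintro s' t ⟨h1, h2, h3, h4, h5, h6, h7, h8⟩
      refine ⟨by simp; omega, h2, h3, h4, h5, fun h => h6 fun b hb => h b (by simp [hb]),
        fun hn => h7 fun hn' => hn ?_, h8⟩
      simpa [hb.1 h] using hn'
    · simpa [Instr.step, hr] using hs r hr
    · rintro s' t ⟨h1, h2, h3, h4, h5, h6, h7, h8⟩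
      have h0 : s'.ireg 50 = 0 := h8 (by simp [Instr.step])
      exact ⟨by simp; omega, h2, h3, h4, h5, fun h' => absurd (hb.2 (h' b (by simp))) h,
        fun _ _ => h0, fun _ => h0⟩

/-- Read the parameters of an instance in dimension `d`. -/
def readProg (d : ℕ) : Cmd :=
  block [.prim (.iconst 2 1), .prim (.iconst 7 0), .prim (.iconst 6 d), .prim (.iadd 43 0 7),
    .prim (.iconst 50 1), .prim (.iload 0 7), .prim (.iload 1 2), .prim (.iadd 44 2 2),
    .prim (.iload 47 44), .prim (.iadd 44 44 2), .prim (.iload 48 44), .prim (.iadd 44 44 2),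
    .prim (.iload 49 44), .prim (.iadd 44 44 2), mulProg, .prim (.iadd 45 44 9),
    .prim (.iadd 46 45 9)]

/-- Read the parameters of an instance in dimension `d` and check them. -/
def headProg (d : ℕ) : Cmd :=
  .seq (readProg d)
    (block ([.ile 43 46, .ile 46 43, .ile 2 1, .ile 1 0, .ile 2 49].map checkProg))

/-- The conditions on the parameters of an instance in dimension `d` which is encoded by a sequence
of length `len` with the entries `x 0, x 1, …`. -/
def HeadValid (d len : ℕ) (x : ℕ → ℕ) : Prop :=
  len = 5 + 2 * (x 0 * d) ∧ 1 ≤ x 1 ∧ x 1 ≤ x 0 ∧ 1 ≤ x 4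

/-- The parameters of an instance have been read. -/
structure HeadRead (d : ℕ) (x : ℕ → ℕ) (s : State ℝ) : Prop where
  size : s.ireg 0 = x 0
  rank : s.ireg 1 = x 1
  one : s.ireg 2 = 1
  num : s.ireg 44 = 5
  den : s.ireg 45 = 5 + x 0 * d
  cert : s.ireg 46 = 5 + 2 * (x 0 * d)
  bound : s.ireg 47 = x 2
  epsNum : s.ireg 48 = x 3
  epsDen : s.ireg 49 = x 4
  coords : s.ireg 9 = x 0 * d

theorem readProg_runs {V : ℝ} {s : State ℝ} (d : ℕ) :
    Runs V (readProg d) s fun s' t => t ≤ 3 * d + 20 ∧ HeadRead d s.imem s' ∧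
      s'.ireg 43 = s.ireg 0 ∧ s'.ireg 50 = 1 ∧ s'.imem = s.imem ∧ s'.vmem = s.vmem := by
  simp only [readProg, block, runs_seq, runs_prim, Instr.Ok, Instr.step, true_and]
  refine (mulProg_runs (by simp)).frame.mono ?_
  rintro s₁ t₁ ⟨⟨ht₁, h9⟩, hf⟩
  have e0 := hf.ireg 0 rfl
  have e1 := hf.ireg 1 rfl
  have e2 := hf.ireg 2 rfl
  have e43 := hf.ireg 43 rfl
  have e44 := hf.ireg 44 rfl
  have e47 := hf.ireg 47 rfl
  have e48 := hf.ireg 48 rfl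
  have e49 := hf.ireg 49 rfl
  have e50 := hf.ireg 50 rfl
  have ei := hf.imem rfl
  have em := hf.vmem rfl
  simp at e0 e1 e2 e43 e44 e47 e48 e49 e50 ei em h9 ht₁
  clear hf
  simp only [runs_skip]
  refine ⟨by omega, ⟨?_, ?_, ?_, ?_, ?_, ?_, ?_, ?_, ?_, ?_⟩, ?_, ?_, ei, em⟩
  · simp [e0]
  · simp [e1]
  · simp [e2]
  · simp [e44]
  · simp [e44, h9]
  · simp [e44, h9]; omega
  · simp [e47]
  · simp [e48]
  · simp [e49]
  · simp [h9]
  · simp [e43]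
  · simp [e50]

theorem HeadRead.congr {d : ℕ} {x : ℕ → ℕ} {s s' : State ℝ} (h : HeadRead d x s)
    (hs : ∀ r < 50, s'.ireg r = s.ireg r) : HeadRead d x s' := by
  obtain ⟨h1, h2, h3, h4, h5, h6, h7, h8, h9, h10⟩ := h
  constructor <;> rwa [hs _ (by decide)]

theorem headProg_runs {V : ℝ} {s : State ℝ} (d : ℕ) :
    Runs V (headProg d) s fun s' t => t ≤ 3 * d + 30 ∧ HeadRead d s.imem s' ∧
      ((HeadValid d (s.ireg 0) s.imem → s'.ireg 50 = 1) ∧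
        (¬ HeadValid d (s.ireg 0) s.imem → s'.ireg 50 = 0)) ∧
      s'.imem = s.imem ∧ s'.vmem = s.vmem := by
  refine (readProg_runs d).bind ?_
  rintro s₁ t₁ ⟨ht₁, hR, h43, h50, him, hvm⟩ -
  refine (checks_runs (s₀ := s₁) _ ?_ s₁ fun _ _ => rfl).mono ?_
  · intro b hb s hs
    simp only [List.mem_cons, List.not_mem_nil, or_false] at hb
    rcases hb with rfl | rfl | rfl | rfl | rfl <;> simp [Test.holds, hs]
  rintro s₂ t₂ ⟨ht₂, hr, him₂, -, hvm₂, h6, h7, -⟩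
  have hiff : (∀ b ∈ [Test.ile 43 46, .ile 46 43, .ile 2 1, .ile 1 0, .ile 2 49], b.holds s₁) ↔
      HeadValid d (s.ireg 0) s.imem := by
    simp only [List.forall_mem_cons, List.not_mem_nil, false_imp_iff, implies_true, and_true,
      Test.holds, h43, hR.cert, hR.one, hR.rank, hR.size, hR.epsDen, HeadValid]
    omega
  rw [hiff] at h6 h7
  simp at ht₂
  exact ⟨by omega, hR.congr fun r hr' => hr r (by omega), ⟨fun h => (h6 h).trans h50,
    fun h => h7 h h50.le⟩, him₂.trans him, hvm₂.trans hvm⟩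

/-- The product of the numerator of the coordinate `a` and of the first `m` denominators other than
the one of the coordinate `a`. -/
def entryVal (num den : ℕ → ℕ) (a m : ℕ) : ℕ :=
  num a * ∏ b ∈ Finset.range m, if b = a then 1 else den b

/-- Multiply value register `2` by all denominators except the one of the coordinate in index
register `51`. -/
def denProg : Cmd :=
  block [.prim (.iconst 54 0), .while (.ilt 54 9) (block [.prim (.iadd 52 45 54),
    .prim (.iload 53 52), .prim (.vcast 3 53),
    .ite (.ilt 54 51) (.prim (.vop .mul 2 2 3))
      (.ite (.ilt 51 54) (.prim (.vop .mul 2 2 3)) .skip),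
    .prim (.iadd 54 54 2)])]

theorem denProg_runs {V : ℝ} {s : State ℝ} {d : ℕ} {num : ℕ → ℕ} (hR : HeadRead d s.imem s)
    (h2 : s.vreg 2 = num (s.ireg 51))
    (hV : ∀ m ≤ s.imem 0 * d, (entryVal num (fun b => s.imem (5 + s.imem 0 * d + b))
      (s.ireg 51) m : ℝ) ≤ V) :
    Runs V denProg s fun s' t => t ≤ 8 * (s.imem 0 * d) + 2 ∧
      s'.vreg 2 = entryVal num (fun b => s.imem (5 + s.imem 0 * d + b)) (s.ireg 51)
        (s.imem 0 * d) := by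
  set den : ℕ → ℕ := fun b => s.imem (5 + s.imem 0 * d + b) with hden
  simp only [denProg, block, runs_seq, runs_prim, Instr.Ok, Instr.step, true_and, runs_skip]
  refine (Runs.while_count (fun i s' => s'.ireg 54 = i ∧
    s'.vreg 2 = entryVal num den (s.ireg 51) i) (s.imem 0 * d) 7
    (by simp [entryVal, h2]) ?_ ?_).mono ?_
  · rintro i s' hi hf ⟨h54, h2'⟩
    have e2 := hf.ireg 2 rfl
    have e9 := hf.ireg 9 rfl
    have e45 := hf.ireg 45 rfl
    have e51 := hf.ireg 51 rfl
    have ei := hf.imem rfl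
    simp [hR.one, hR.coords, hR.den] at e2 e9 e45 e51 ei
    clear hf
    refine ⟨by simp [Test.holds, h54, e9, hi], ?_⟩
    have hs : entryVal num den (s.ireg 51) (i + 1) =
        entryVal num den (s.ireg 51) i * (if i = s.ireg 51 then 1 else den i) := by
      simp only [entryVal, Finset.prod_range_succ, mul_assoc]
    have hVi := hV (i + 1) hi
    rw [hs] at hVi
    rcases lt_trichotomy i (s.ireg 51) with h | h | h
    · rw [if_neg h.ne] at hVi
      have hden' : s.imem (5 + s.imem 0 * d + i) = den i := rfl
      rw [Nat.cast_mul] at hVi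
      simp [Instr.Ok, Instr.step, Op.eval, Test.holds, e2, e45, e51, ei, h54, h2', hs, h, h.ne,
        hden', abs_mul, hVi]
    · simp [Instr.Ok, Instr.step, Op.eval, Test.holds, e2, e45, e51, ei, h54, h2', h]
      rw [← h] at hs ⊢
      rw [hs, if_pos rfl, mul_one]
    · rw [if_neg h.ne'] at hVi
      have hden' : s.imem (5 + s.imem 0 * d + i) = den i := rfl
      rw [Nat.cast_mul] at hVi
      simp [Instr.Ok, Instr.step, Op.eval, Test.holds, e2, e45, e51, ei, h54, h2', hs, h, h.ne',
        hden', abs_mul, hVi, h.le]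
  · rintro s' hf ⟨h54, -⟩
    have e9 := hf.ireg 9 rfl
    simp [hR.coords] at e9
    simp [Test.holds, h54, e9]
  · rintro s' t ⟨ht, -, h⟩
    exact ⟨by omega, h⟩

/-- Load the numerator of the coordinate in index register `51` and check its denominator. -/
def loadProg : Cmd :=
  block [.prim (.iadd 52 44 51), .prim (.iload 53 52), .prim (.vcast 2 53),
    .prim (.iadd 52 45 51), .prim (.iload 53 52), checkProg (.ile 2 53)]

theorem loadProg_runs {V : ℝ} {s : State ℝ} {d : ℕ} (hR : HeadRead d s.imem s) :
    Runs V loadProg s fun s' t => t ≤ 7 ∧ s'.vreg 2 = s.imem (5 + s.ireg 51) ∧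
      s'.ireg 50 = if 1 ≤ s.imem (5 + s.imem 0 * d + s.ireg 51) then s.ireg 50 else 0 := by
  simp only [loadProg, checkProg, block, runs_seq, runs_prim, runs_ite, runs_skip, Instr.Ok,
    Instr.step, Test.holds, true_and]
  refine ⟨fun h => ?_, fun h => ?_⟩ <;> simp [hR.den, hR.one] at h <;> simp [h, hR.num]

/-- Write the coordinate in index register `51` of the points, multiplied by the product of all
denominators, and check its denominator. -/
def entryProg : Cmd :=
  .seq loadProg (.seq denProg (block [.prim (.vstore 51 2), .prim (.iadd 51 51 2)]))

theorem entryProg_runs {V : ℝ} {s : State ℝ} {d : ℕ} (hR : HeadRead d s.imem s)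
    (hV : ∀ m ≤ s.imem 0 * d, (entryVal (fun a => s.imem (5 + a))
      (fun b => s.imem (5 + s.imem 0 * d + b)) (s.ireg 51) m : ℝ) ≤ V) :
    Runs V entryProg s fun s' t => t ≤ 8 * (s.imem 0 * d) + 12 ∧ s'.ireg 51 = s.ireg 51 + 1 ∧
      s'.vmem = Function.update s.vmem (s.ireg 51) (entryVal (fun a => s.imem (5 + a))
        (fun b => s.imem (5 + s.imem 0 * d + b)) (s.ireg 51) (s.imem 0 * d) : ℝ) ∧
      s'.ireg 50 = if 1 ≤ s.imem (5 + s.imem 0 * d + s.ireg 51) then s.ireg 50 else 0 := by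
  refine (loadProg_runs hR).bind ?_
  rintro s₁ t₁ ⟨ht₁, h2, hfl⟩ hf
  have e51 := hf.ireg 51 rfl
  have ei := hf.imem rfl
  have em := hf.vmem rfl
  have hR₁ : HeadRead d s₁.imem s₁ := by
    rw [ei]
    exact hR.congr fun r hr => hf.ireg r (by
      simp [Cmd.KeepsI, Cmd.anyInstr, loadProg, checkProg, block, Instr.wi]; omega)
  clear hf
  refine (denProg_runs (num := fun a => s.imem (5 + a)) hR₁ (by rw [h2, e51])
    (by rw [ei, e51]; exact hV)).bind ?_
  rintro s₂ t₂ ⟨ht₂, h2'⟩ hf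
  have f2 := hf.ireg 2 rfl
  have f50 := hf.ireg 50 rfl
  have f51 := hf.ireg 51 rfl
  have fm := hf.vmem rfl
  clear hf
  rw [ei, e51] at h2'
  rw [ei] at ht₂
  rw [hR₁.one] at f2
  simp only [block, runs_seq, runs_prim, Instr.Ok, Instr.step, true_and, runs_skip, fm, em, h2',
    f51, e51, f2]
  exact ⟨by omega, by simp, by simp [f50, hfl]⟩

/-- Write the points, multiplied by the product of all denominators, to the value memory, and check
the denominators. -/
def pointsProg : Cmd :=
  block [.prim (.iconst 51 0), .while (.ilt 51 9) entryProg]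

theorem pointsProg_runs {V : ℝ} {s : State ℝ} {d : ℕ} (hR : HeadRead d s.imem s)
    (hV : ∀ a < s.imem 0 * d, ∀ m ≤ s.imem 0 * d, (entryVal (fun a => s.imem (5 + a))
      (fun b => s.imem (5 + s.imem 0 * d + b)) a m : ℝ) ≤ V) :
    Runs V pointsProg s fun s' t =>
      t ≤ s.imem 0 * d * (8 * (s.imem 0 * d) + 13) + 2 ∧
      (∀ a, s'.vmem a = if a < s.imem 0 * d then (entryVal (fun a => s.imem (5 + a))
        (fun b => s.imem (5 + s.imem 0 * d + b)) a (s.imem 0 * d) : ℝ) else s.vmem a) ∧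
      s'.ireg 50 = if ∀ a < s.imem 0 * d, 1 ≤ s.imem (5 + s.imem 0 * d + a) then s.ireg 50
        else 0 := by
  simp only [pointsProg, block, runs_seq, runs_prim, Instr.Ok, Instr.step, true_and, runs_skip]
  refine (Runs.while_count (fun i s' => s'.ireg 51 = i ∧
      (∀ a, s'.vmem a = if a < i then (entryVal (fun a => s.imem (5 + a))
        (fun b => s.imem (5 + s.imem 0 * d + b)) a (s.imem 0 * d) : ℝ) else s.vmem a) ∧
      s'.ireg 50 = if ∀ a < i, 1 ≤ s.imem (5 + s.imem 0 * d + a) then s.ireg 50 else 0)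
    (s.imem 0 * d) (8 * (s.imem 0 * d) + 12) (by simp) ?_ ?_).mono ?_
  · rintro i s' hi hf ⟨h51, hm, hfl⟩
    have e9 := hf.ireg 9 rfl
    have ei := hf.imem rfl
    have hR' : HeadRead d s'.imem s' := by
      rw [ei]
      refine hR.congr fun r hr => (hf.ireg r ?_).trans (Function.update_of_ne (by omega) _ _)
      simp [Cmd.KeepsI, Cmd.anyInstr, entryProg, loadProg, denProg, checkProg, block, Instr.wi]
      omega
    clear hf
    simp [hR.coords] at e9 ei
    refine ⟨by simp [Test.holds, h51, e9, hi], (entryProg_runs hR' ?_).mono ?_⟩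
    · rw [ei, h51]
      exact hV i hi
    · rintro s'' t ⟨ht, h51', hm', hfl'⟩
      rw [ei] at ht hm' hfl'
      rw [h51] at h51' hm' hfl'
      refine ⟨ht, h51', fun a => ?_, ?_⟩
      · rw [hm', Function.update_apply, hm]
        rcases lt_trichotomy a i with h | rfl | h
        · simp [h, h.ne, h.trans i.lt_succ_self]
        · simp
        · rw [if_neg h.ne', if_neg (by omega), if_neg (by omega)]
      · rw [hfl', hfl]
        simp only [Nat.forall_lt_succ_right]
        split_ifs <;> simp_all
  · rintro s' hf ⟨h51, -⟩
    have e9 := hf.ireg 9 rfl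
    simp [hR.coords] at e9
    simp [Test.holds, h51, e9]
  · rintro s' t ⟨ht, -, h⟩
    exact ⟨by simp only [add_assoc, Nat.reduceAdd] at ht ⊢; omega, h⟩

/-- Copy the first entries of the certificate to the beginning of the index memory, and put the
number of the nonzero ones into index register `55`. -/
def copyProg : Cmd :=
  block [.prim (.iconst 51 0), .prim (.iconst 55 0), .while (.ilt 51 0) (block [
    .prim (.iadd 52 46 51), .prim (.iload 53 52), .prim (.istore 51 53),
    .ite (.ile 2 53) (.prim (.iadd 55 55 2)) .skip, .prim (.iadd 51 51 2)])]

theorem copyProg_runs {V : ℝ} {s : State ℝ} {d : ℕ} (hR : HeadRead d s.imem s) :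
    Runs V copyProg s fun s' t => t ≤ 7 * s.imem 0 + 3 ∧
      (∀ i < s.imem 0, s'.imem i = s.imem (5 + 2 * (s.imem 0 * d) + i)) ∧
      s'.ireg 55 = ((Finset.range (s.imem 0)).filter fun i =>
        0 < s.imem (5 + 2 * (s.imem 0 * d) + i)).card := by
  simp only [copyProg, block, runs_seq, runs_prim, Instr.Ok, Instr.step, true_and]
  refine (Runs.while_count (fun i s' => s'.ireg 51 = i ∧
      (∀ a, s'.imem a = if a < i then s.imem (5 + 2 * (s.imem 0 * d) + a) else s.imem a) ∧
      s'.ireg 55 = ((Finset.range i).filter fun i =>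
        0 < s.imem (5 + 2 * (s.imem 0 * d) + i)).card)
    (s.imem 0) 6 (by simp) ?_ ?_).mono ?_
  · rintro i s' hi hf ⟨h51, hm, h55⟩
    have e0 := hf.ireg 0 rfl
    have e2 := hf.ireg 2 rfl
    have e46 := hf.ireg 46 rfl
    clear hf
    simp [hR.size, hR.one, hR.cert] at e0 e2 e46
    have hl : s'.imem (5 + 2 * (s.imem 0 * d) + i) = s.imem (5 + 2 * (s.imem 0 * d) + i) := by
      rw [hm, if_neg (by omega)]
    refine ⟨by simp [Test.holds, h51, e0, hi], ?_⟩
    simp only [runs_seq, runs_prim, runs_ite, runs_skip, Instr.Ok, Instr.step, Test.holds, true_and,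
      Function.update_self, Function.update_of_ne, ne_eq, Nat.reduceEqDiff, not_false_eq_true,
      h51, e2, e46, hl, h55, Finset.range_add_one, Finset.filter_insert]
    have hstore : ∀ a, Function.update s'.imem i (s.imem (5 + 2 * (s.imem 0 * d) + i)) a =
        if a < i + 1 then s.imem (5 + 2 * (s.imem 0 * d) + a) else s.imem a := fun a => by
      rw [Function.update_apply, hm]
      rcases lt_trichotomy a i with h | rfl | h
      · simp [h, h.ne, h.trans i.lt_succ_self]
      · simp
      · rw [if_neg h.ne', if_neg (by omega), if_neg (by omega)]
    refine ⟨fun h => ⟨by omega, hstore, ?_⟩, fun h => ⟨by omega, hstore, ?_⟩⟩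
    · rw [if_pos (by omega), Finset.card_insert_of_notMem (by simp)]
    · rw [if_neg (by omega)]
  · rintro s' hf ⟨h51, -⟩
    have e0 := hf.ireg 0 rfl
    simp [hR.size] at e0
    simp [Test.holds, h51, e0]
  · rintro s' t ⟨ht, -, hm, h55⟩
    simp only [runs_skip]
    exact ⟨by omega, fun i hi => by rw [hm, if_pos hi], h55⟩

/-! ### Scaling -/

theorem score_mul {d : ℕ} (u p : Fin d → ℝ) (c : ℝ) :
    score u (fun j => c * p j) = c * score u p := by
  simp only [score, Finset.mul_sum]
  exact Finset.sum_congr rfl fun j _ => by ring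

theorem kthScore_mul {n d k : ℕ} (P : Fin n → Fin d → ℝ) {S : Finset (Fin n)} {c : ℝ} (hc : 0 < c)
    (hk : 1 ≤ k) (hkS : k ≤ S.card) (u : Fin d → ℝ) :
    kthScore (fun i j => c * P i j) S k u = c * kthScore P S k u := by
  obtain ⟨-, h1, h2⟩ := kthScore_spec P S k u hk hkS
  refine kthScore_eq hk hkS ?_ ?_
  · simpa only [score_mul, mul_lt_mul_iff_right₀ hc] using h1
  · simpa only [score_mul, mul_le_mul_iff_right₀ hc] using h2

theorem regrets_mul {n d k : ℕ} (P : Fin n → Fin d → ℝ) {Q : Finset (Fin n)} {c : ℝ} (hc : 0 < c)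
    (hk : 1 ≤ k) (hkn : k ≤ n) (hQ : Q.Nonempty) :
    regrets (fun i j => c * P i j) Q k = regrets P Q k := by
  ext ρ
  refine exists_congr fun u => and_congr_right fun _ => ?_
  rw [regret, regret, kthScore_mul P hc hk (by simpa using hkn),
    kthScore_mul P hc le_rfl (Finset.card_pos.2 hQ), ← mul_sub,
    show max 0 (c * (kthScore P Finset.univ k u - kthScore P Q 1 u)) =
      c * max 0 (kthScore P Finset.univ k u - kthScore P Q 1 u) by
        rw [mul_max_of_nonneg _ _ hc.le, mul_zero], mul_div_mul_left _ _ hc.ne']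

/-! ### The whole verifier -/

/-- The points of an instance which is encoded by the sequence `x`. -/
noncomputable def ratPoints (d : ℕ) (x : ℕ → ℕ) : Fin (x 0) → Fin d → ℝ := fun i j =>
  (x (5 + (i * d + j)) : ℝ) / x (5 + x 0 * d + (i * d + j))

/-- The subset with the indicator `y`. -/
def certSet (n : ℕ) (y : ℕ → ℕ) : Finset (Fin n) := Finset.univ.filter fun i => 0 < y i

/-- The conditions which the verifier tests on the sequence `x`, which is an encoded instance
of length `len` followed by a certificate. -/
def Verifies (d len : ℕ) (x : ℕ → ℕ) : Prop :=
  HeadValid d len x ∧ (∀ a < x 0 * d, 1 ≤ x (5 + x 0 * d + a)) ∧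
  (certSet (x 0) fun i => x (5 + 2 * (x 0 * d) + i)).Nonempty ∧
  (certSet (x 0) fun i => x (5 + 2 * (x 0 * d) + i)).card ≤ x 2 ∧
  regretRatio (ratPoints d x) (certSet (x 0) fun i => x (5 + 2 * (x 0 * d) + i)) (x 1) ≤
    (x 3 : ℝ) / x 4

theorem card_certSet (n : ℕ) (y : ℕ → ℕ) :
    (certSet n y).card = ((Finset.range n).filter fun i => 0 < y i).card := by
  rw [certSet, ← Finset.card_map Fin.valEmbedding]
  congr 1
  ext i
  simp only [Finset.mem_map, Finset.mem_filter, Finset.mem_univ, true_and, Fin.valEmbedding_apply,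
    Finset.mem_range]
  exact ⟨fun ⟨j, hj, h⟩ => h ▸ ⟨j.2, hj⟩, fun h => ⟨⟨i, h.1⟩, h.2, rfl⟩⟩

theorem prod_range_ite_eq {den : ℕ → ℕ} {a m : ℕ} (ha : a < m) :
    den a * ∏ b ∈ Finset.range m, (if b = a then 1 else den b) = ∏ b ∈ Finset.range m, den b := by
  have ha' : a ∈ Finset.range m := Finset.mem_range.2 ha
  rw [← Finset.mul_prod_erase _ _ ha', ← Finset.mul_prod_erase _ den ha', if_pos rfl, one_mul]
  congr 1
  exact Finset.prod_congr rfl fun b hb => if_neg (Finset.ne_of_mem_erase hb)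

/-- Compare the fraction of value registers `0` and `1` with the one of index registers `48`
and `49`. -/
def compareProg : Cmd :=
  block [.prim (.vcast 2 48), .prim (.vcast 3 49), .prim (.vop .mul 4 0 3),
    .prim (.vop .mul 5 2 1), .ite (.vle 4 5) (.prim (.iconst 0 1)) (.prim (.iconst 0 0))]

theorem compareProg_runs {V X W : ℝ} {s : State ℝ} (h0 : 0 ≤ s.vreg 0) (h0X : s.vreg 0 ≤ X)
    (h1 : 0 < s.vreg 1) (h1X : s.vreg 1 ≤ X) (h48 : (s.ireg 48 : ℝ) ≤ W)
    (h49 : (s.ireg 49 : ℝ) ≤ W) (hpos : 1 ≤ s.ireg 49) (hV : X * W ≤ V) :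
    Runs V compareProg s fun s' t => t ≤ 6 ∧
      (s'.ireg 0 = 1 ↔ s.vreg 0 / s.vreg 1 ≤ (s.ireg 48 : ℝ) / s.ireg 49) := by
  have hpos' : (0 : ℝ) < s.ireg 49 := by exact_mod_cast hpos
  have g1 : s.vreg 0 * s.ireg 49 ≤ V :=
    (mul_le_mul h0X h49 hpos'.le (h0.trans h0X)).trans hV
  have g2 : s.ireg 48 * s.vreg 1 ≤ V := by
    rw [mul_comm]
    exact (mul_le_mul h1X h48 (Nat.cast_nonneg _) (h0.trans h0X)).trans hV
  rw [div_le_div_iff₀ h1 hpos']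
  by_cases h : s.vreg 0 * s.ireg 49 ≤ s.ireg 48 * s.vreg 1
  · simp [compareProg, block, Instr.Ok, Instr.step, Op.eval, Test.holds, abs_mul, abs_of_nonneg h0,
      abs_of_pos h1, g1, g2, h]
  · simp [compareProg, block, Instr.Ok, Instr.step, Op.eval, Test.holds, abs_mul, abs_of_nonneg h0,
      abs_of_pos h1, g1, g2, h, not_le.1 h]

/-- The part of the verifier after the parameters have been read and found valid; `c` is a program
for the regret ratio. -/
def mainProg (c : Cmd) : Cmd :=
  .seq pointsProg (.seq copyProg (.seq (block ([.ile 2 55, .ile 55 47].map checkProg))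
    (.ite (.ile 2 50) (.seq c compareProg) (.prim (.iconst 0 0)))))

/-- The verifier. -/
def verifProg (d : ℕ) (c : Cmd) : Cmd :=
  .seq (headProg d) (.ite (.ile 2 50) (mainProg c) (.prim (.iconst 0 0)))

/-- All points of the encoded instance, multiplied by the product of all denominators. -/
noncomputable def intPoints (d : ℕ) (x : ℕ → ℕ) : Fin (x 0) → Fin d → ℝ := fun i j =>
  (entryVal (fun a => x (5 + a)) (fun b => x (5 + x 0 * d + b)) (i * d + j) (x 0 * d) : ℕ)

theorem intPoints_eq {d : ℕ} {x : ℕ → ℕ} (hx : ∀ a < x 0 * d, 1 ≤ x (5 + x 0 * d + a)) :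
    intPoints d x = fun i j =>
      ((∏ b ∈ Finset.range (x 0 * d), x (5 + x 0 * d + b) : ℕ) : ℝ) * ratPoints d x i j := by
  funext i j
  have hij : i * d + j < x 0 * d := mul_add_lt i.2 j.2
  have h1 := prod_range_ite_eq (den := fun b => x (5 + x 0 * d + b)) hij
  have h2 : (x (5 + x 0 * d + (i * d + j)) : ℝ) ≠ 0 := by
    have := hx _ hij
    positivity
  simp only [intPoints, ratPoints, entryVal]
  rw [← h1]
  push_cast
  field_simp

theorem mainProg_runs {D C : ℕ} {c : Cmd} (hkeep : ∀ r, 43 ≤ r → r < 60 → c.KeepsI r)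
    (hc : ∀ {n k : ℕ} {P : Fin n → Fin (D + 1) → ℝ} {Q : Finset (Fin n)} {V W : ℝ} {s : State ℝ},
      1 ≤ k → k ≤ n → (∀ i j, 0 ≤ P i j) → Q.Nonempty → 1 ≤ W → (∀ i j, P i j ≤ W) →
      (C * W ^ C) * (C * W ^ C) ≤ V → s.ireg 0 = n → s.ireg 1 = k →
      (∀ i : Fin n, 0 < s.imem i ↔ i ∈ Q) →
      (∀ a < n * (D + 1) + 2 * (D + 1) + 1, s.vmem a = if h : a < n * (D + 1) then
        P (Fin.divNat ⟨a, h⟩) (Fin.modNat ⟨a, h⟩) else 0) →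
      Runs V c s fun s' t => t ≤ C * n ^ (2 * D + 1) ∧ 0 ≤ s'.vreg 0 ∧
        s'.vreg 0 ≤ C * W ^ C ∧ 0 < s'.vreg 1 ∧ s'.vreg 1 ≤ C * W ^ C ∧
        IsGreatest (regrets P Q k) (s'.vreg 0 / s'.vreg 1))
    {len : ℕ} {V W : ℝ} {s : State ℝ} (hR : HeadRead (D + 1) s.imem s) (hfl : s.ireg 50 = 1)
    (hv : HeadValid (D + 1) len s.imem) (hm : ∀ a, s.vmem a = 0) (hW : 1 ≤ W)
    (hWe : ∀ a < s.imem 0 * (D + 1), ∀ m ≤ s.imem 0 * (D + 1), (entryVal (fun a => s.imem (5 + a))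
      (fun b => s.imem (5 + s.imem 0 * (D + 1) + b)) a m : ℝ) ≤ W)
    (hW3 : (s.imem 3 : ℝ) ≤ W) (hW4 : (s.imem 4 : ℝ) ≤ W) (hWV : W ≤ V)
    (hV : (C * W ^ C) * (C * W ^ C) ≤ V) (hV' : C * W ^ C * W ≤ V) :
    Runs V (mainProg c) s fun s' t =>
      t ≤ s.imem 0 * (D + 1) * (8 * (s.imem 0 * (D + 1)) + 13) + 7 * s.imem 0 +
        C * s.imem 0 ^ (2 * D + 1) + 20 ∧
      (s'.ireg 0 = 1 ↔ Verifies (D + 1) len s.imem) := by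
  set x := s.imem with hx
  refine (pointsProg_runs hR fun a ha m hm => (hWe a ha m hm).trans hWV).bind ?_
  rintro s₁ t₁ ⟨ht₁, hm₁, hfl₁⟩ hf
  have ei := hf.imem rfl
  have hR₁ : HeadRead (D + 1) s₁.imem s₁ := by
    rw [ei]
    exact hR.congr fun r hr => hf.ireg r (by
      simp [Cmd.KeepsI, Cmd.anyInstr, pointsProg, entryProg, loadProg, denProg, checkProg, block,
        Instr.wi]
      omega)
  clear hf
  rw [← hx] at ei ht₁ hm₁
  rw [hfl] at hfl₁
  refine (copyProg_runs hR₁).bind ?_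
  rintro s₂ t₂ ⟨ht₂, hi₂, h55⟩ hf
  have e50 := hf.ireg 50 rfl
  have em := hf.vmem rfl
  have hR₂ : HeadRead (D + 1) x s₂ := by
    rw [← ei]
    exact hR₁.congr fun r hr => hf.ireg r (by
      simp [Cmd.KeepsI, Cmd.anyInstr, copyProg, block, Instr.wi]
      omega)
  clear hf
  rw [ei] at ht₂ hi₂ h55
  rw [← card_certSet (x 0) fun i => x (5 + 2 * (x 0 * (D + 1)) + i)] at h55
  obtain ⟨Q, hQ⟩ : ∃ Q, Q = certSet (x 0) fun i => x (5 + 2 * (x 0 * (D + 1)) + i) := ⟨_, rfl⟩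
  rw [← hQ] at h55
  refine Runs.bind (checks_runs (s₀ := s₂) _ ?_ s₂ fun _ _ => rfl) ?_
  · intro b hb s hs
    simp only [List.mem_cons, List.not_mem_nil, or_false] at hb
    rcases hb with rfl | rfl <;> simp [Test.holds, hs]
  rintro s₃ t₃ ⟨ht₃, hr₃, hi₃, -, hm₃, h6, h7, h8⟩ -
  have hiff : (∀ b ∈ [Test.ile 2 55, .ile 55 47], b.holds s₂) ↔ 1 ≤ Q.card ∧ Q.card ≤ x 2 := by
    simp only [List.forall_mem_cons, List.not_mem_nil, false_imp_iff, implies_true, and_true,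
      Test.holds, h55, hR₂.one, hR₂.bound]
  rw [hiff] at h6 h7
  have hR₃ : HeadRead (D + 1) x s₃ := hR₂.congr fun r hr => hr₃ r (by omega)
  have h50 : 1 ≤ s₃.ireg 50 ↔ (∀ a < x 0 * (D + 1), 1 ≤ x (5 + x 0 * (D + 1) + a)) ∧
      1 ≤ Q.card ∧ Q.card ≤ x 2 := by
    by_cases hd : ∀ a < x 0 * (D + 1), 1 ≤ x (5 + x 0 * (D + 1) + a)
    · rw [if_pos hd] at hfl₁
      by_cases hq : 1 ≤ Q.card ∧ Q.card ≤ x 2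
      · rw [h6 hq, e50, hfl₁]
        exact ⟨fun _ => ⟨hd, hq⟩, fun _ => le_rfl⟩
      · rw [h7 hq (by omega)]
        exact ⟨fun h => absurd h (by omega), fun h => absurd h.2 hq⟩
    · rw [if_neg hd] at hfl₁
      rw [h8 (e50.trans hfl₁)]
      simp [hd]
  have hver : Verifies (D + 1) len x ↔ 1 ≤ s₃.ireg 50 ∧
      regretRatio (ratPoints (D + 1) x) Q (x 1) ≤ (x 3 : ℝ) / x 4 := by
    rw [h50, Verifies, ← hQ, ← Finset.card_pos, and_iff_right hv, and_assoc, and_assoc]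
    rfl
  simp only [List.length_cons, List.length_nil] at ht₃
  refine Runs.ite_intro (fun hb => ?_) fun hb => ?_
  · have hb' : 1 ≤ s₃.ireg 50 := by simpa [Test.holds, hR₃.one] using hb
    obtain ⟨hd, hq, -⟩ := h50.1 hb'
    have hM : (0 : ℝ) < (∏ b ∈ Finset.range (x 0 * (D + 1)), x (5 + x 0 * (D + 1) + b) : ℕ) := by
      exact_mod_cast Finset.prod_pos fun b hb => hd b (Finset.mem_range.1 hb)
    refine (hc (P := intPoints (D + 1) x) (Q := Q) (W := W) hv.2.1 hv.2.2.1
      (fun i j => Nat.cast_nonneg _) (Finset.card_pos.1 hq) hW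
      (fun i j => hWe _ (mul_add_lt i.2 j.2) _ le_rfl) hV hR₃.size hR₃.rank (fun i => ?_)
      fun a ha => ?_).bind ?_
    · rw [hi₃, hi₂ i i.2, hQ, certSet]
      simp
    · rw [hm₃, em, hm₁]
      split_ifs with h
      · simp only [intPoints, Fin.divNat, Fin.modNat, Nat.div_add_mod']
      · exact hm a
    · rintro s₄ t₄ ⟨ht₄, g1, g2, g3, g4, hg⟩ hf
      have e48 := hf.ireg 48 (hkeep 48 (by decide) (by decide))
      have e49 := hf.ireg 49 (hkeep 49 (by decide) (by decide))
      rw [hR₃.epsNum] at e48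
      rw [hR₃.epsDen] at e49
      clear hf
      refine (compareProg_runs g1 g2 g3 g4 (by rwa [e48]) (by rwa [e49])
        (by rw [e49]; exact hv.2.2.2) hV').mono ?_
      rintro s₅ t₅ ⟨ht₅, h0⟩
      rw [intPoints_eq hd, regrets_mul _ hM hv.2.1 hv.2.2.1 (Finset.card_pos.1 hq)] at hg
      have hrr : regretRatio (ratPoints (D + 1) x) Q (x 1) = s₄.vreg 0 / s₄.vreg 1 := hg.csSup_eq
      rw [e48, e49, ← hrr] at h0
      exact ⟨by omega, by rw [h0, hver, and_iff_right hb']⟩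
  · have hb' : ¬ 1 ≤ s₃.ireg 50 := by simpa [Test.holds, hR₃.one] using hb
    simp only [runs_prim, Instr.Ok, Instr.step, true_and, Function.update_self]
    exact ⟨by omega, by simp [hver, hb']⟩

/-- The verifier in dimension `D + 1`. -/
theorem exists_verifProg (D : ℕ) : ∃ (C : ℕ) (c : Cmd), ∀ {V W : ℝ} {N : ℕ} {s : State ℝ},
    (∀ a, s.vmem a = 0) → 1 ≤ W → (HeadValid (D + 1) (s.ireg 0) s.imem → s.imem 0 ≤ N ∧
      (∀ a < s.imem 0 * (D + 1), ∀ m ≤ s.imem 0 * (D + 1), (entryVal (fun a => s.imem (5 + a))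
        (fun b => s.imem (5 + s.imem 0 * (D + 1) + b)) a m : ℝ) ≤ W) ∧
      (s.imem 3 : ℝ) ≤ W ∧ (s.imem 4 : ℝ) ≤ W) → (C * W ^ C) * (C * W ^ C) ≤ V →
    Runs V c s fun s' t => t ≤ C * (N + 1) ^ C ∧
      (s'.ireg 0 = 1 ↔ Verifies (D + 1) (s.ireg 0) s.imem) := by
  obtain ⟨C₀, c, hkeep, hc⟩ := exists_regretProg D
  obtain ⟨C, hC⟩ : ∃ C, C =
    C₀ + (3 * D + 60) + (13 * (D + 1) + 7) + 8 * (D + 1) * (D + 1) := ⟨_, rfl⟩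
  refine ⟨C, verifProg (D + 1) c, fun {V W N s} hm hW hx hV => ?_⟩
  have hCW := natCast_mul_pow_le hW (show C₀ ≤ C by omega)
  have hCW1 := natCast_mul_pow_le hW (show 1 ≤ C by omega)
  rw [Nat.cast_one, one_mul, pow_one] at hCW1
  have hC0 : 0 ≤ C₀ * W ^ C₀ := by positivity
  have hM : 1 ≤ (N + 1) ^ C := Nat.one_le_pow _ _ (by omega)
  have hCM : C ≤ C * (N + 1) ^ C := Nat.le_mul_of_pos_right _ hM
  refine (headProg_runs (D + 1)).bind ?_
  rintro s₁ t₁ ⟨ht₁, hR, ⟨hv1, hv0⟩, hi, hm₁⟩ -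
  by_cases hv : HeadValid (D + 1) (s.ireg 0) s.imem
  · obtain ⟨hN, hWe, hW3, hW4⟩ := hx hv
    have h50 := hv1 hv
    refine Runs.ite_intro (fun _ => ?_) fun hb => absurd hb (by simp [Test.holds, hR.one, h50])
    rw [← hi] at hR hv hWe hW3 hW4 hN ⊢
    refine (mainProg_runs hkeep hc hR h50 hv (fun a => by rw [hm₁, hm]) hW hWe hW3 hW4
      (hCW1.trans ((le_mul_of_one_le_right (by linarith) (by linarith)).trans hV))
      ((mul_le_mul hCW hCW hC0 (by linarith)).trans hV)
      ((mul_le_mul hCW hCW1 (by linarith) (by linarith)).trans hV)).mono ?_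
    rintro s₂ t₂ ⟨ht₂, h0⟩
    refine ⟨?_, h0⟩
    have p1 : s₁.imem 0 ≤ (N + 1) ^ C := hN.trans (N.le_succ.trans (Nat.le_self_pow (by omega) _))
    have p2 : s₁.imem 0 * s₁.imem 0 ≤ (N + 1) ^ C := by
      have : (N + 1) ^ 2 ≤ (N + 1) ^ C := Nat.pow_le_pow_right (by omega) (by omega)
      nlinarith
    have p3 : s₁.imem 0 ^ (2 * D + 1) ≤ (N + 1) ^ C :=
      (Nat.pow_le_pow_left (hN.trans N.le_succ) _).trans
        (Nat.pow_le_pow_right (by omega) (by omega))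
    have q1 := Nat.mul_le_mul_left (13 * (D + 1) + 7) p1
    have q2 := Nat.mul_le_mul_left (8 * (D + 1) * (D + 1)) p2
    have q3 := Nat.mul_le_mul_left C₀ p3
    have q4 := Nat.mul_le_mul_left (3 * D + 60) hM
    have e : ∀ M, C * M = C₀ * M + (3 * D + 60) * M + (13 * (D + 1) + 7) * M +
        8 * (D + 1) * (D + 1) * M := fun M => by rw [hC]; ring
    rw [e]
    linarith
  · refine Runs.ite_intro (fun hb => absurd hb (by simp [Test.holds, hR.one, hv0 hv])) fun _ => ?_
    simp only [runs_prim, Instr.Ok, Instr.step, true_and, Function.update_self]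
    exact ⟨by omega, by simp [Verifies, hv]⟩

/-! ### Encodings and sizes -/

theorem length_encode {d : ℕ} (I : Instance d) : I.encode.length = 5 + 2 * (I.n * d) := by
  simp [Instance.encode]
  ring

theorem encode_append_getD_num {d : ℕ} (I : Instance d) (y : List ℕ) (a : Fin (I.n * d)) :
    (I.encode ++ y).getD (5 + a) 0 = I.num a.divNat a.modNat := by
  rw [Instance.encode, List.append_assoc, List.append_assoc, List.getD_append_right _ _ _ _ (by simp),
    List.getD_append _ _ _ _ (by simp), List.getD_eq_getElem _ _ (by simp)]
  simp

theorem encode_append_getD_den {d : ℕ} (I : Instance d) (y : List ℕ) (a : Fin (I.n * d)) :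
    (I.encode ++ y).getD (5 + I.n * d + a) 0 = I.den a.divNat a.modNat := by
  rw [Instance.encode, List.append_assoc, List.getD_append_right _ _ _ _ (by simp; omega),
    List.getD_append _ _ _ _ (by simp; omega), List.getD_eq_getElem _ _ (by simp; omega)]
  simp [show 5 + I.n * d + (a : ℕ) - (I.n * d + 1 + 1 + 1 + 1 + 1) = a by omega]

theorem encode_append_getD_cert {d : ℕ} (I : Instance d) (y : List ℕ) (i : ℕ) :
    (I.encode ++ y).getD (5 + 2 * (I.n * d) + i) 0 = y.getD i 0 := by
  rw [List.getD_append_right _ _ _ _ (by rw [length_encode]; omega), length_encode]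
  congr 1
  omega

/-- A sequence with the parts of an encoded instance is the encoding of this instance. -/
theorem encode_eq {d : ℕ} {I : Instance d} {x : List ℕ} (hl : x.length = 5 + 2 * (I.n * d))
    (h0 : x.getD 0 0 = I.n) (h1 : x.getD 1 0 = I.k) (h2 : x.getD 2 0 = I.r)
    (h3 : x.getD 3 0 = I.epsNum) (h4 : x.getD 4 0 = I.epsDen)
    (hnum : ∀ a : Fin (I.n * d), x.getD (5 + a) 0 = I.num a.divNat a.modNat)
    (hden : ∀ a : Fin (I.n * d), x.getD (5 + I.n * d + a) 0 = I.den a.divNat a.modNat) :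
    I.encode = x := by
  have key : ∀ a < x.length, I.encode.getD a 0 = x.getD a 0 := fun a ha => by
    rcases lt_or_ge a 5 with h | h
    · interval_cases a
      exacts [h0.symm, h1.symm, h2.symm, h3.symm, h4.symm]
    obtain ⟨b, rfl⟩ := Nat.exists_eq_add_of_le h
    rcases lt_or_ge b (I.n * d) with hb | hb
    · simpa [← hnum ⟨b, hb⟩] using encode_append_getD_num I [] ⟨b, hb⟩
    · obtain ⟨c, rfl⟩ := Nat.exists_eq_add_of_le hb
      have hc : c < I.n * d := by omega
      rw [← add_assoc]
      simpa [← hden ⟨c, hc⟩] using encode_append_getD_den I [] ⟨c, hc⟩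
  refine List.ext_getElem (by rw [length_encode, hl]) fun a h h' => ?_
  simpa [List.getD_eq_getElem, h, h'] using key a h'

theorem size_getD_le (x : List ℕ) (a : ℕ) : (x.getD a 0).size ≤ inputSize x := by
  rcases lt_or_ge a x.length with h | h
  · rw [List.getD_eq_getElem _ _ h]
    have := List.single_le_sum (l := x.map fun a => a.size + 1) (by simp) (x[a].size + 1)
      (List.mem_map_of_mem (List.getElem_mem h))
    rw [inputSize]
    omega
  · simp [h]

theorem length_le_inputSize (x : List ℕ) : x.length ≤ inputSize x := by
  induction x with
  | nil => simp [inputSize]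
  | cons a x ih =>
    simp only [inputSize, List.map_cons, List.sum_cons, List.length_cons] at ih ⊢
    omega

theorem inputSize_append (x y : List ℕ) : inputSize (x ++ y) = inputSize x + inputSize y := by
  simp [inputSize]

theorem inputSize_le_of_le_one {y : List ℕ} (h : ∀ a ∈ y, a ≤ 1) : inputSize y ≤ 2 * y.length := by
  induction y with
  | nil => simp [inputSize]
  | cons a y ih =>
    have h1 : a.size ≤ 1 := Nat.size_le.2 (by have := h a (by simp); omega)
    have h2 := ih fun b hb => h b (by simp [hb])
    simp only [inputSize, List.map_cons, List.sum_cons, List.length_cons] at h2 ⊢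
    omega

theorem entryVal_le {num den : ℕ → ℕ} {S a m s : ℕ} (hnum : (num a).size ≤ S)
    (hden : ∀ b, (den b).size ≤ S) (hm : m ≤ s) : entryVal num den a m ≤ 2 ^ (S * (s + 1)) := by
  have h1 : num a ≤ 2 ^ S := (Nat.size_le.1 hnum).le
  have h2 : ∏ b ∈ Finset.range m, (if b = a then 1 else den b) ≤ (2 ^ S) ^ m := by
    refine (Finset.prod_le_pow_card _ _ (2 ^ S) fun b _ => ?_).trans (by simp)
    split_ifs
    · exact Nat.one_le_two_pow
    · exact (Nat.size_le.1 (hden b)).le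
  calc entryVal num den a m ≤ 2 ^ S * (2 ^ S) ^ m := Nat.mul_le_mul h1 h2
    _ = 2 ^ (S * (m + 1)) := by rw [← pow_mul, ← pow_add]; congr 1; ring
    _ ≤ 2 ^ (S * (s + 1)) :=
      Nat.pow_le_pow_right (by omega) (Nat.mul_le_mul_left _ (by omega))

/-! ### Membership in NP -/

theorem mem_rmsLanguage_of_verifies {d : ℕ} {x y : List ℕ}
    (h : Verifies d x.length fun a => (x ++ y).getD a 0) : x ∈ rmsLanguage d := by
  obtain ⟨⟨hl, hk, hkn, he⟩, hden, hQ, hr, hrat⟩ := h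
  set X : ℕ → ℕ := fun a => (x ++ y).getD a 0 with hX
  have hx : ∀ a < x.length, x.getD a 0 = X a := fun a ha => (List.getD_append _ _ _ _ ha).symm
  refine ⟨⟨X 0, X 1, X 2, X 3, X 4, fun i j => X (5 + (i * d + j)),
    fun i j => X (5 + X 0 * d + (i * d + j)), hk, hkn, he,
    fun i j => hden _ (mul_add_lt i.2 j.2)⟩, encode_eq hl (hx 0 (by omega)) (hx 1 (by omega))
    (hx 2 (by omega)) (hx 3 (by omega)) (hx 4 (by omega)) (fun a => ?_) (fun a => ?_),
    _, hQ, hr, hrat⟩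
  · have ha : (a : ℕ) < X 0 * d := a.2
    rw [hx _ (by omega)]
    simp only [Fin.divNat, Fin.modNat, Nat.div_add_mod']
  · have ha : (a : ℕ) < X 0 * d := a.2
    refine (hx _ (show 5 + X 0 * d + (a : ℕ) < _ by omega)).trans ?_
    simp only [Fin.divNat, Fin.modNat, Nat.div_add_mod']

theorem verifies_iff {d len n : ℕ} {x : ℕ → ℕ} {P : Fin n → Fin d → ℝ} {Q : Finset (Fin n)}
    (h0 : x 0 = n) (hP : ∀ i j, P i j = (x (5 + (i * d + j)) : ℝ) / x (5 + n * d + (i * d + j)))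
    (hQ : ∀ i : Fin n, i ∈ Q ↔ 0 < x (5 + 2 * (n * d) + i)) :
    Verifies d len x ↔ HeadValid d len x ∧ (∀ a < n * d, 1 ≤ x (5 + n * d + a)) ∧
      Q.Nonempty ∧ Q.card ≤ x 2 ∧ regretRatio P Q (x 1) ≤ (x 3 : ℝ) / x 4 := by
  subst h0
  rw [show P = ratPoints d x from funext₂ hP,
    show Q = certSet (x 0) fun i => x (5 + 2 * (x 0 * d) + i) by ext i; simp [hQ, certSet]]
  rfl

theorem exists_verifies {d : ℕ} {x : List ℕ} (hd : 1 ≤ d) (hx : x ∈ rmsLanguage d) :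
    ∃ y : List ℕ, inputSize y ≤ 2 * inputSize x ∧
      Verifies d x.length fun a => (x ++ y).getD a 0 := by
  obtain ⟨I, rfl, Q, hQ, hr, hrat⟩ := hx
  obtain ⟨y, hy⟩ : ∃ y : List ℕ, y = List.ofFn fun i : Fin I.n => if i ∈ Q then 1 else 0 :=
    ⟨_, rfl⟩
  have hyl : y.length = I.n := by simp [hy]
  refine ⟨y, ?_, (verifies_iff (n := I.n) (P := I.points) (Q := Q) rfl (fun i j => ?_)
    fun i => ?_).2 ⟨⟨length_encode I, I.one_le_k, I.k_le_n, I.epsDen_pos⟩, fun a ha => ?_, hQ, hr,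
      hrat⟩⟩
  · have h1 := length_le_inputSize I.encode
    have h2 : I.n ≤ I.n * d := Nat.le_mul_of_pos_right _ hd
    have h3 : inputSize y ≤ 2 * y.length := inputSize_le_of_le_one fun a ha => by
      rw [hy, List.mem_ofFn] at ha
      obtain ⟨i, rfl⟩ := ha
      split_ifs <;> omega
    rw [length_encode] at h1
    omega
  · have hij : (i : ℕ) * d + j < I.n * d := mul_add_lt i.2 j.2
    have h1 := encode_append_getD_num I y ⟨_, hij⟩
    have h2 := encode_append_getD_den I y ⟨_, hij⟩
    rw [divNat_mul_add, modNat_mul_add] at h1 h2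
    rw [Instance.points, ← h1, ← h2]
  · rw [encode_append_getD_cert, hy, List.getD_eq_getElem _ _ (by simp), List.getElem_ofFn]
    split_ifs with h <;> simpa using h
  · rw [encode_append_getD_den I y ⟨a, ha⟩]
    exact I.den_pos _ _

theorem sizeLe_verifierInput (x y : List ℕ) :
    (verifierInput x y).SizeLe (inputSize x + inputSize y) := by
  have hx := length_le_inputSize x
  have hy := length_le_inputSize y
  have size_le : ∀ n : ℕ, n.size ≤ n := fun n => Nat.size_le.2 n.lt_two_pow_self
  have h1 := size_le x.length
  have h2 := size_le y.length
  refine ⟨fun i => ?_, fun a => ?_, fun _ => by simp [verifierInput],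
    fun _ => by simp [verifierInput]⟩
  · simp only [verifierInput]
    split_ifs
    · omega
    · omega
    · simp
  · rw [← inputSize_append]
    exact size_getD_le _ a

theorem natAbs_size_le {C E : ℕ} {z : ℤ}
    (hz : |(z : ℝ)| ≤ C * (2 ^ E : ℝ) ^ C * (C * (2 ^ E : ℝ) ^ C)) :
    z.natAbs.size ≤ 2 * (C * (E + 1)) := by
  have h1 : z.natAbs ≤ C * (2 ^ E) ^ C * (C * (2 ^ E) ^ C) := by
    have : ((z.natAbs : ℕ) : ℝ) ≤ (C * (2 ^ E) ^ C * (C * (2 ^ E) ^ C) : ℕ) := by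
      rw [Nat.cast_natAbs, Int.cast_abs]
      push_cast
      exact hz
    exact_mod_cast this
  have h2 : C * (2 ^ E) ^ C < 2 ^ C * (2 ^ E) ^ C :=
    Nat.mul_lt_mul_of_pos_right C.lt_two_pow_self (by positivity)
  rw [Nat.size_le]
  calc z.natAbs ≤ _ := h1
    _ < (2 ^ C * (2 ^ E) ^ C) * (2 ^ C * (2 ^ E) ^ C) := Nat.mul_lt_mul'' h2 h2
    _ = 2 ^ (2 * (C * (E + 1))) := by
      rw [← pow_mul, ← pow_add, ← pow_add]
      congr 1
      ring

/-- The RMS decision problem is in NP. -/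
theorem inNP_rmsLanguage (D : ℕ) : InNP (rmsLanguage (D + 1)) := by
  obtain ⟨C, c, hc⟩ := exists_verifProg D
  have key : ∀ x y : List ℕ, inputSize y ≤ 2 * inputSize x → ∀ s, s = inputSize x →
      ∀ A T, A = 2 * (C * (3 * s * (s + 1) + 1)) + c.constSize + 3 * s → T = C * (s + 1) ^ C →
      ∃ (s' : State ℤ) (t : ℕ), Exec logCost c (verifierInput x y) s' t ∧
        t ≤ T * (1 + 3 * (A + T)) ∧
        (s'.ireg 0 = 1 ↔ Verifies (D + 1) x.length fun a => (x ++ y).getD a 0) := by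
    rintro x y hy s rfl A T hA hT
    have hsz := sizeLe_verifierInput x y
    have himem : ∀ a, ((x ++ y).getD a 0).size ≤ 3 * inputSize x := fun a =>
      (hsz.imem a).trans (by omega)
    have hle : ∀ a, (x ++ y).getD a 0 ≤ 2 ^ (3 * inputSize x * (inputSize x + 1)) := fun a =>
      (Nat.size_le.1 (himem a)).le.trans (Nat.pow_le_pow_right (by omega)
        (Nat.le_mul_of_pos_right _ (by omega)))
    have hbound : HeadValid (D + 1) x.length (fun a => (x ++ y).getD a 0) →
        (x ++ y).getD 0 0 ≤ inputSize x ∧ (∀ a < (x ++ y).getD 0 0 * (D + 1),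
          ∀ m ≤ (x ++ y).getD 0 0 * (D + 1), (entryVal (fun a => (x ++ y).getD (5 + a) 0)
            (fun b => (x ++ y).getD (5 + (x ++ y).getD 0 0 * (D + 1) + b) 0) a m : ℝ) ≤
              2 ^ (3 * inputSize x * (inputSize x + 1))) ∧
        ((x ++ y).getD 3 0 : ℝ) ≤ 2 ^ (3 * inputSize x * (inputSize x + 1)) ∧
        ((x ++ y).getD 4 0 : ℝ) ≤ 2 ^ (3 * inputSize x * (inputSize x + 1)) := fun hv => by
      have hl : x.length = 5 + 2 * ((x ++ y).getD 0 0 * (D + 1)) := hv.1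
      have hl' := length_le_inputSize x
      have h1 : (x ++ y).getD 0 0 ≤ (x ++ y).getD 0 0 * (D + 1) :=
        Nat.le_mul_of_pos_right _ D.succ_pos
      refine ⟨by omega, fun a ha m hm => ?_, ?_, ?_⟩
      · exact_mod_cast entryVal_le (num := fun a => (x ++ y).getD (5 + a) 0) (himem _)
          (fun b => himem _) (show m ≤ inputSize x by omega)
      · exact_mod_cast hle 3
      · exact_mod_cast hle 4
    obtain ⟨s₁, t₁, he, ht₁, h0⟩ := hc (s := (verifierInput x y).toReal)
      (fun a => by simp [State.toReal, verifierInput]) (one_le_pow₀ one_le_two) hbound le_rfl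
    obtain ⟨s', t', he', hs', -, ht'⟩ := he.logCost_sim (a := A) rfl (by omega)
      (hsz.mono (by omega)) fun z hz => (natAbs_size_le hz).trans (by omega)
    refine ⟨s', t', he', ht'.trans ?_, ?_⟩
    · rw [← hT] at ht₁
      exact Nat.mul_le_mul ht₁ (by omega)
    · rw [← hs'] at h0
      exact h0
  refine ⟨c, (.C C * (.X + 1) ^ C) * (1 + 3 * ((2 * (.C C * (3 * .X * (.X + 1) + 1)) +
    .C c.constSize + 3 * .X) + .C C * (.X + 1) ^ C)), 2 * .X, fun x => ⟨fun y hy => ?_, ?_, ?_⟩⟩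
  · obtain ⟨s', t, he, ht, -⟩ := key x y (by simpa using hy) _ rfl _ _ rfl rfl
    exact ⟨s', t, he, by simpa using ht⟩
  · intro hx
    obtain ⟨y, hy, hv⟩ := exists_verifies D.succ_pos hx
    obtain ⟨s', t, he, -, h⟩ := key x y hy _ rfl _ _ rfl rfl
    exact ⟨y, by simpa using hy, s', t, he, h.2 hv⟩
  · rintro ⟨y, hy, s', t, he, h1⟩
    obtain ⟨s₂, t₂, he₂, -, h⟩ := key x y (by simpa using hy) _ rfl _ _ rfl rfl
    obtain ⟨rfl, -⟩ := he.deterministic he₂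
    exact mem_rmsLanguage_of_verifies (h.1 h1)

end RMS

theorem mainTheorem6 (d : ℕ) (hd : 1 ≤ d) :
    (∃ (prog : RMS.Cmd) (C : ℕ), ∀ (n k : ℕ) (P : Fin n → Fin d → ℝ) (Q : Finset (Fin n)),
      1 ≤ k → k ≤ n → (∀ i j, 0 ≤ P i j) → Q.Nonempty →
        IsGreatest (RMS.regrets P Q k) (RMS.regretRatio P Q k) ∧
        ∃ (s : RMS.State ℝ) (t : ℕ),
          RMS.Exec (RMS.unitCost ℝ) prog (RMS.regretInput P Q k) s t ∧
          s.vreg 0 = RMS.regretRatio P Q k ∧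
          t ≤ C * n ^ (2 * d - 1)) ∧
    RMS.InNP (RMS.rmsLanguage d) := by
  obtain ⟨D, rfl⟩ : ∃ D, d = D + 1 := ⟨d - 1, by omega⟩
  refine ⟨?_, ?_⟩
  · rw [show 2 * (D + 1) - 1 = 2 * D + 1 by omega]
    exact RMS.exists_realRAM_regretRatio D
  · exact RMS.inNP_rmsLanguage D
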